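/- We work in the smooth category. Let $1\le n\le\infty$. An $n$-component multiray in $\mathbb R^3$ is the image $\tau$ of a proper smooth embedding of $Z\times[0,\infty)$, where $Z$ is a discrete space with $n$ points (countably infinite if $n=\infty$); the images of the sets $\{z\}\times[0,\infty)$ are its components. A multiray is unknotted if some diffeomorphism of $\mathbb R^3$ carries it to a multiray each of whose components lies in a straight ray emanating from the origin, and knotted otherwise. Put $\mathbb R^3_+=\{(x,y,z): z\ge 0\}$ and $\zeta=\{(0,0)\}\times[1,\infty)$. A (smooth, closed) regular neighborhood $\nu\tau$ of $\tau$ is the image of a proper smooth embedding of $Z\times\mathbb R^3_+$ into $\mathbb R^3$ that carries $Z\times\zeta$ onto $\tau$; its boundary is denoted $\partial\nu\tau$. An isotopy between diffeomorphisms $f_0,f_1$ of $\mathbb R^3$ is a smooth proper map $F:\mathbb R^3\times[0,1]\to\mathbb R^3$ such that every $F_t$ is a diffeomorphism of $\mathbb R^3$, $F_0=f_0$ and $F_1=f_1$; it is relative to $A\subset\mathbb R^3$ if $F_t|_A=f_0|_A$ for all $t$. **Proposition.** Let $\tau$ and $\tau'$ be multirays in $\mathbb R^3$, each with $n$ components,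 $1\le n\le\infty$. Let $\nu\tau$ and $\nu\tau'$ be regular neighborhoods of them, and let $H=\partial\nu\tau$ and $H'=\partial\nu\tau'$. (1) If $f$ is a diffeomorphism of $\mathbb R^3$ with $f(\tau)=\tau'$, then $f$ is isotopic relative to $\tau$ to a diffeomorphism $g$ of $\mathbb R^3$ with $g(H)=H'$. (2) Conversely, let $g$ be a diffeomorphism of $\mathbb R^3$ with $g(H)=H'$, and suppose that at least one of the following holds: (a) $g(\nu\tau)=\nu\tau'$; (b) $n\ge 2$; (c) $n=1$, and $\tau$ or $\tau'$ is knotted. Then $g$ is isotopic relative to $\mathbb R^3\setminus\operatorname{Int}\nu\tau$ to a diffeomorphism $f$ of $\mathbb R^3$ with $f(\tau)=\tau'$. -/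

import Mathlib

open scoped Manifold ContDiff

/-- Euclidean `3`-space. -/
abbrev E3 : Type := EuclideanSpace ℝ (Fin 3)

/-- The standard discrete space with `n` points, `0 ≤ n ≤ ∞`: the natural numbers less than `n`
(all natural numbers if `n = ⊤`), with the discrete subspace topology. -/
abbrev Idx (n : ℕ∞) : Type := {k : ℕ // (k : ℕ∞) < n}

/-- `f` restricts to a proper smooth embedding of `Z × D` into `F`, where `Z` is a (discrete) index
space and `D` is a full-dimensional piece of a normed space with smooth boundary (here a half-line
or a half-space): it is smooth up to the boundary of `D`, an immersion, injective and proper. -/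
structure IsProperSmoothEmbedding {Z : Type} [TopologicalSpace Z]
    {E F : Type} [NormedAddCommGroup E] [NormedSpace ℝ E]
    [NormedAddCommGroup F] [NormedSpace ℝ F] (D : Set E) (f : Z → E → F) : Prop where
  smooth : ∀ z, ContDiffOn ℝ ∞ (f z) D
  immersion : ∀ z, ∀ x ∈ D, Function.Injective (fderivWithin ℝ (f z) D x)
  injective : Function.Injective (fun p : Z × D => f p.1 p.2)
  proper : IsProperMap (fun p : Z × D => f p.1 p.2)

/-- `τ` is a multiray in `ℝ³` with `n` components: the image of a proper smooth embedding of
`Z × [0, ∞)`, with `Z` a discrete space of `n` points. -/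
def IsMultiray (n : ℕ∞) (τ : Set E3) : Prop :=
  ∃ γ : Idx n → ℝ → E3, IsProperSmoothEmbedding (Set.Ici 0) γ ∧ τ = ⋃ z, γ z '' Set.Ici 0

/-- The closed upper half-space `ℝ³₊ = {(x, y, z) | z ≥ 0}`. -/
def upperHalfSpace3 : Set E3 := {p | 0 ≤ p 2}

/-- The ray `ζ = {(0, 0)} × [1, ∞)` in the positive `z`-axis. -/
def zetaRay : Set E3 := {p | p 0 = 0 ∧ p 1 = 0 ∧ 1 ≤ p 2}

/-- `N` is a smooth closed regular neighborhood of the `n`-component multiray `τ`: a properly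
embedded disjoint union of `n` copies of the standard model `(ℝ³₊, ζ)`, the copies of `ζ` being the
components of `τ`. -/
def IsRegularNhd (n : ℕ∞) (τ N : Set E3) : Prop :=
  ∃ φ : Idx n → E3 → E3, IsProperSmoothEmbedding upperHalfSpace3 φ ∧
    N = ⋃ z, φ z '' upperHalfSpace3 ∧ τ = ⋃ z, φ z '' zetaRay

/-- A union of embedded intervals is radial if each component lies on a straight ray emanating
from the origin. -/
def IsRadial (ρ : Set E3) : Prop :=
  ∀ x ∈ ρ, ∃ v : E3, v ≠ 0 ∧ connectedComponentIn ρ x ⊆ {p | ∃ s : ℝ, 0 ≤ s ∧ p = s • v}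

/-- A multiray is knotted if no diffeomorphism of `ℝ³` carries it to a radial one. -/
def IsKnotted (τ : Set E3) : Prop := ¬ ∃ h : E3 ≃ₘ[ℝ] E3, IsRadial (h '' τ)

/-- The diffeomorphisms `f` and `g` of `ℝ³` are isotopic relative to `A`: there is a smooth, proper
isotopy `F : [0, 1] × ℝ³ → ℝ³` through diffeomorphisms, from `f` to `g`, that is constant in time
on `A`. (Only the times `t ∈ [0, 1]` matter.) -/
def IsotopicRel (A : Set E3) (f g : E3 ≃ₘ[ℝ] E3) : Prop :=
  ∃ F : ℝ → (E3 ≃ₘ[ℝ] E3),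
    ContDiffOn ℝ ∞ (fun p : ℝ × E3 => F p.1 p.2) (Set.Icc 0 1 ×ˢ Set.univ) ∧
    IsProperMap (fun p : Set.Icc (0 : ℝ) 1 × E3 => F p.1 p.2) ∧
    F 0 = f ∧ F 1 = g ∧ ∀ t ∈ Set.Icc (0 : ℝ) 1, ∀ x ∈ A, F t x = f x

/-! Both directions come down to a uniqueness statement. Composing the parametrization of the first
neighborhood with the given diffeomorphism turns (1) into: two regular neighborhoods of the same
multiray are ambient isotopic relative to it. In the same way (2) becomes, once the neighborhoods
are known to correspond: two multirays that are cores of the same neighborhood are isotopic inside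
it. All isotopies are built in model coordinates, one component at a time, and transplanted
simultaneously. Properness makes the images of closed sets locally finite, so infinitely many
components need no separate argument.

Uniqueness of neighborhoods (`IsRayChart.exists_isotopy`). The map `expChart` identifies ℝ³ with the
open half-space and the half-axis with ζ. In these coordinates a neighborhood can be isotoped,
relative to the ray, to the region above any negative height: `exists_push` moves it off its
boundary to the region above a graph, and vertical isotopies move graphs. For two charts along one
ray, the transition map preserves the half-axis. Reparametrizing both charts by height-preserving
families of linear maps makes its derivative along the axis close to the identity
(`exists_axis_normalization`). A cutoff then makes it agree near the axis with the end of an isotopy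
(`exists_axis_interpolation`). Finally `exists_thin_isotopy` squeezes the half-spaces into the
region of agreement, where the two neighborhoods become the same set.

Uniqueness of cores (`exists_isotopy_of_image_eq`). The ray of the first parametrization is laid
down onto the graph of a small function over a horizontal half-line. So close to the boundary, this
graph is also a graph in the second parametrization, where the curve can be stood up again and moved
to the second ray. Everything happens away from the boundary.

Correspondence of the neighborhoods (`image_eq_of_image_frontier_eq`). The complement of a multiray
is connected, because cones over it have Hausdorff dimension at most two; hence so is the complement
of a regular neighborhood. Therefore two neighborhoods with the same boundary coincide, or there is
just one component and they are complementary half-spaces. In the latter case blowing up a collar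
gives a diffeomorphism from ℝ³ to ℝ³ which carries the half-axis to the ray, so both rays are
unknotted. This is excluded by (b) and by (c). -/

open Set Function Filter Topology

set_option linter.unusedSectionVars false

/-! ### Global consequences of the inverse function theorem -/

section InverseFunction

variable {E : Type*} [NormedAddCommGroup E] [NormedSpace ℝ E] [FiniteDimensional ℝ E]

theorem exists_equiv_of_injective (L : E →L[ℝ] E) (hL : Injective L) :
    ∃ e : E ≃L[ℝ] E, (e : E →L[ℝ] E) = L := by
  refine ⟨(LinearEquiv.ofInjectiveEndo (L : E →ₗ[ℝ] E) hL).toContinuousLinearEquiv, ?_⟩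
  ext x; rfl

/-- An injective smooth map with injective derivatives on an open set is open there, with smooth
inverse. -/
theorem isOpen_image_and_exists_smooth_inverse {f : E → E} {U : Set E} (hU : IsOpen U)
    (hf : ContDiffOn ℝ ∞ f U) (hinj : InjOn f U) (hd : ∀ x ∈ U, Injective (fderiv ℝ f x)) :
    (∀ V ⊆ U, IsOpen V → IsOpen (f '' V)) ∧
      ∃ g : E → E, ContDiffOn ℝ ∞ g (f '' U) ∧ ∀ x ∈ U, g (f x) = x := by
  have : CompleteSpace E := FiniteDimensional.complete ℝ E
  have key : ∀ x ∈ U, ∃ e : OpenPartialHomeomorph E E, (e : E → E) = f ∧ x ∈ e.source ∧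
      ContDiffAt ℝ ∞ e.symm (f x) := by
    intro x hx
    obtain ⟨e', he'⟩ := exists_equiv_of_injective _ (hd x hx)
    have hfx : ContDiffAt ℝ ∞ f x := hf.contDiffAt (hU.mem_nhds hx)
    have hder : HasFDerivAt f (e' : E →L[ℝ] E) x := by
      rw [he']; exact (hfx.differentiableAt (by simp)).hasFDerivAt
    refine ⟨hfx.toOpenPartialHomeomorph f hder (by simp), rfl,
      hfx.mem_toOpenPartialHomeomorph_source hder (by simp), hfx.to_localInverse hder (by simp)⟩
  constructor
  · intro V hVU hV
    rw [isOpen_iff_mem_nhds]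
    rintro _ ⟨x, hx, rfl⟩
    obtain ⟨e, he, hxe, -⟩ := key x (hVU hx)
    have := e.image_mem_nhds hxe (hV.mem_nhds hx)
    rwa [he] at this
  · classical
    rcases isEmpty_or_nonempty E with hE | hE
    · exact ⟨id, contDiffOn_id, fun x => (hE.false x).elim⟩
    refine ⟨invFunOn f U, ?_, fun x hx => hinj.leftInvOn_invFunOn hx⟩
    rintro _ ⟨x, hx, rfl⟩
    obtain ⟨e, he, hxe, hsm⟩ := key x hx
    refine (hsm.congr_of_eventuallyEq ?_).contDiffWithinAt
    have h1 : e.symm (f x) = x := by rw [← he]; exact e.left_inv hxe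
    have h2 : ∀ᶠ y in 𝓝 (f x), e.symm y ∈ U := by
      have := e.continuousAt_symm (x := f x) (by rw [← he]; exact e.map_source hxe)
      refine this.eventually ?_
      rw [h1]; exact hU.mem_nhds hx
    have h3 : ∀ᶠ y in 𝓝 (f x), y ∈ e.target :=
      e.open_target.mem_nhds (by rw [← he]; exact e.map_source hxe)
    filter_upwards [h2, h3] with y hy2 hy3
    have h4 : f (e.symm y) = y := by rw [← he]; exact e.right_inv hy3
    have h5 := hinj.leftInvOn_invFunOn hy2
    rwa [h4] at h5

theorem exists_smooth_inverse_of_bijective {f : E → E} (hf : ContDiff ℝ ∞ f)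
    (hb : Bijective f) (hd : ∀ x, Injective (fderiv ℝ f x)) :
    ∃ g : E → E, ContDiff ℝ ∞ g ∧ (∀ x, g (f x) = x) ∧ ∀ x, f (g x) = x := by
  obtain ⟨-, g, hg, hgf⟩ := isOpen_image_and_exists_smooth_inverse isOpen_univ hf.contDiffOn
    hb.1.injOn (fun x _ => hd x)
  rw [image_univ, hb.2.range_eq, contDiffOn_univ] at hg
  refine ⟨g, hg, fun x => hgf x trivial, fun x => ?_⟩
  obtain ⟨y, rfl⟩ := hb.2 x
  rw [hgf y trivial]

end InverseFunction

/-! ### Ambient isotopies starting at the identity -/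

/-- `d` is the end of a smooth ambient isotopy of `ℝ³` which starts at the identity and is
constant on `A`. -/
def IsotopicToIdRel (A : Set E3) (d : E3 → E3) : Prop :=
  ∃ F G : ℝ × E3 → E3, ContDiff ℝ ∞ F ∧ ContDiff ℝ ∞ G ∧
    (∀ t x, G (t, F (t, x)) = x) ∧ (∀ t x, F (t, G (t, x)) = x) ∧
    (∀ x, F (0, x) = x) ∧ (∀ x, F (1, x) = d x) ∧ ∀ t, ∀ x ∈ A, F (t, x) = x

namespace IsotopicToIdRel

variable {A B : Set E3} {d e : E3 → E3}

theorem mono (h : IsotopicToIdRel A d) (hBA : B ⊆ A) : IsotopicToIdRel B d := by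
  obtain ⟨F, G, hF, hG, h1, h2, h3, h4, h5⟩ := h
  exact ⟨F, G, hF, hG, h1, h2, h3, h4, fun t x hx => h5 t x (hBA hx)⟩

theorem apply_eq (h : IsotopicToIdRel A d) {x : E3} (hx : x ∈ A) : d x = x := by
  obtain ⟨F, G, -, -, -, -, -, h4, h5⟩ := h
  rw [← h4, h5 1 x hx]

theorem comp (hd : IsotopicToIdRel A d) (he : IsotopicToIdRel A e) :
    IsotopicToIdRel A (d ∘ e) := by
  obtain ⟨F, G, hF, hG, h1, h2, h3, h4, h5⟩ := hd
  obtain ⟨F', G', hF', hG', h1', h2', h3', h4', h5'⟩ := he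
  refine ⟨fun p => F (p.1, F' p), fun p => G' (p.1, G p), hF.comp (contDiff_fst.prodMk hF'),
    hG'.comp (contDiff_fst.prodMk hG), fun t x => ?_, fun t x => ?_, fun x => ?_, fun x => ?_,
    fun t x hx => ?_⟩
  · simp only [h1, h1']
  · simp only [h2, h2']
  · simp only [h3, h3']
  · simp only [h4, h4', comp_apply]
  · simp only [h5' t x hx, h5 t x hx]

/-- The inverse of a diffeomorphism isotopic to the identity. -/
theorem exists_inverse (hd : IsotopicToIdRel A d) :
    ∃ e, IsotopicToIdRel A e ∧ (∀ x, e (d x) = x) ∧ ∀ x, d (e x) = x := by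
  obtain ⟨F, G, hF, hG, h1, h2, h3, h4, h5⟩ := hd
  refine ⟨fun x => G (1, x), ⟨G, F, hG, hF, h2, h1, fun x => ?_, fun x => rfl, fun t x hx => ?_⟩,
    fun x => ?_, fun x => ?_⟩
  · conv_lhs => rw [← h3 x]
    exact h1 0 x
  · conv_lhs => rw [← h5 t x hx]
    exact h1 t x
  · rw [← h4]; exact h1 1 x
  · rw [← h4]; exact h2 1 x

theorem contDiff (hd : IsotopicToIdRel A d) : ContDiff ℝ ∞ d := by
  obtain ⟨F, G, hF, hG, h1, h2, h3, h4, h5⟩ := hd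
  have : d = fun x => F (1, x) := funext fun x => (h4 x).symm
  rw [this]; exact hF.comp (contDiff_const.prodMk contDiff_id)

theorem bijective (hd : IsotopicToIdRel A d) : Bijective d := by
  obtain ⟨e, -, h1, h2⟩ := hd.exists_inverse
  exact ⟨LeftInverse.injective h1, RightInverse.surjective h2⟩

theorem conj (hd : IsotopicToIdRel A d) {P Q : E3 → E3} (hP : ContDiff ℝ ∞ P)
    (hQ : ContDiff ℝ ∞ Q) (hQP : ∀ x, Q (P x) = x) (hPQ : ∀ x, P (Q x) = x) :
    IsotopicToIdRel (P '' A) (P ∘ d ∘ Q) := by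
  obtain ⟨F, G, hF, hG, h1, h2, h3, h4, h5⟩ := hd
  refine ⟨fun p => P (F (p.1, Q p.2)), fun p => P (G (p.1, Q p.2)),
    hP.comp (hF.comp (contDiff_fst.prodMk (hQ.comp contDiff_snd))),
    hP.comp (hG.comp (contDiff_fst.prodMk (hQ.comp contDiff_snd))),
    fun t x => ?_, fun t x => ?_, fun x => ?_, fun x => ?_, ?_⟩
  · simp only [hQP, h1, hPQ]
  · simp only [hQP, h2, hPQ]
  · simp only [h3, hPQ]
  · simp only [h4, comp_apply]
  · rintro t _ ⟨x, hx, rfl⟩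
    simp only [hQP, h5 t x hx]

/-- A smooth family of bijections with injective derivatives, starting at the identity. -/
theorem of_bijective {F : ℝ × E3 → E3} (hF : ContDiff ℝ ∞ F)
    (hb : ∀ t, Bijective fun x => F (t, x))
    (hd : ∀ t x, Injective (fderiv ℝ (fun y => F (t, y)) x)) (h0 : ∀ x, F (0, x) = x)
    (hA : ∀ t, ∀ x ∈ A, F (t, x) = x) : IsotopicToIdRel A fun x => F (1, x) := by
  -- The track of the isotopy. Its derivative is block triangular, hence injective, and its global
  -- inverse supplies inverses that are jointly smooth in time and space.
  let T : ℝ × E3 → ℝ × E3 := fun p => (p.1, F p)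
  have hT : ContDiff ℝ ∞ T := contDiff_fst.prodMk hF
  have hTb : Bijective T := by
    constructor
    · rintro ⟨t, x⟩ ⟨t', x'⟩ h
      simp only [T, Prod.mk.injEq] at h
      obtain ⟨rfl, h⟩ := h
      rw [(hb t).1 h]
    · rintro ⟨t, x⟩
      obtain ⟨y, hy⟩ := (hb t).2 x
      exact ⟨(t, y), by simp only [T]; rw [← hy]⟩
  have hTd : ∀ p, Injective (fderiv ℝ T p) := by
    rintro ⟨t, x⟩
    have hFd : DifferentiableAt ℝ F (t, x) := (hF.differentiable (by simp)) _
    have e1 : fderiv ℝ T (t, x) =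
        (ContinuousLinearMap.fst ℝ ℝ E3).prod (fderiv ℝ F (t, x)) :=
      (hasFDerivAt_fst.prodMk hFd.hasFDerivAt).fderiv
    have e2 : fderiv ℝ (fun y => F (t, y)) x =
        (fderiv ℝ F (t, x)).comp (ContinuousLinearMap.inr ℝ ℝ E3) :=
      (hFd.hasFDerivAt.comp x (hasFDerivAt_prodMk_right t x)).fderiv
    rw [injective_iff_map_eq_zero]
    rintro ⟨s, v⟩ hsv
    rw [e1] at hsv
    simp only [ContinuousLinearMap.prod_apply, ContinuousLinearMap.coe_fst', Prod.mk_eq_zero] at hsv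
    obtain ⟨rfl, h2⟩ := hsv
    have := (injective_iff_map_eq_zero _).1 (hd t x) v (by rw [e2]; simpa using h2)
    simp [this]
  obtain ⟨S, hS, hST, hTS⟩ := exists_smooth_inverse_of_bijective hT hTb hTd
  have hS1 : ∀ p, (S p).1 = p.1 := fun p => by
    conv_rhs => rw [← hTS p]
  refine ⟨F, fun p => (S p).2, hF, contDiff_snd.comp hS, fun t x => ?_, fun t x => ?_, h0,
    fun _ => rfl, hA⟩
  · have := hST (t, x)
    simp only [T] at this
    simp [this]
  · have h := hTS (t, x)
    have h1 := hS1 (t, x)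
    simp only [T, Prod.mk.injEq] at h
    have : S (t, x) = (t, (S (t, x)).2) := by ext1 <;> simp [h1]
    rw [← this]; exact h.2

/-- Composing `f` with an ambient isotopy passes from the working notion of isotopy to that of the
theorem. Properness holds because the inverse track is continuous, so the preimage of a compact set
lies in a compact image. -/
theorem isotopicRel (f : E3 ≃ₘ[ℝ] E3) (hd : IsotopicToIdRel (f '' A) d) :
    ∃ g : E3 ≃ₘ[ℝ] E3, (∀ x, g x = d (f x)) ∧ IsotopicRel A f g := by
  obtain ⟨F, G, hF, hG, h1, h2, h3, h4, h5⟩ := hd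
  have hs : ∀ t : ℝ, ContDiff ℝ ∞ fun x => F (t, x) :=
    fun t => hF.comp (contDiff_const.prodMk contDiff_id)
  have hs' : ∀ t : ℝ, ContDiff ℝ ∞ fun x => G (t, x) :=
    fun t => hG.comp (contDiff_const.prodMk contDiff_id)
  let D : ℝ → (E3 ≃ₘ[ℝ] E3) := fun t =>
    { toFun := fun x => F (t, x)
      invFun := fun x => G (t, x)
      left_inv := h1 t
      right_inv := h2 t
      contMDiff_toFun := (hs t).contMDiff
      contMDiff_invFun := (hs' t).contMDiff }
  have hD : ∀ t x, D t x = F (t, x) := fun _ _ => rfl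
  let K : ℝ → (E3 ≃ₘ[ℝ] E3) := fun t => f.trans (D t)
  have hK : ∀ t x, K t x = F (t, f x) := fun _ _ => rfl
  have hf : ContDiff ℝ ∞ f := f.contMDiff.contDiff
  have hfs : ContDiff ℝ ∞ f.symm := f.symm.contMDiff.contDiff
  refine ⟨K 1, fun x => by rw [hK, h4], K, ?_, ?_, ?_, rfl, ?_⟩
  · simp only [hK]
    exact (hF.comp (contDiff_fst.prodMk (hf.comp contDiff_snd))).contDiffOn
  · have hcont : Continuous fun p : Icc (0 : ℝ) 1 × E3 => K p.1 p.2 := by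
      simp only [hK]
      exact hF.continuous.comp ((continuous_subtype_val.comp continuous_fst).prodMk
        (hf.continuous.comp continuous_snd))
    rw [isProperMap_iff_isCompact_preimage]
    refine ⟨hcont, fun C hC => ?_⟩
    have hm : Continuous fun p : Icc (0 : ℝ) 1 × E3 => (p.1, f.symm (G (p.1, p.2))) :=
      continuous_fst.prodMk (hfs.continuous.comp
        (hG.continuous.comp ((continuous_subtype_val.comp continuous_fst).prodMk continuous_snd)))
    refine ((isCompact_univ.prod hC).image hm).of_isClosed_subset (hC.isClosed.preimage hcont) ?_
    rintro ⟨t, x⟩ hx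
    refine ⟨(t, K t x), ⟨trivial, hx⟩, ?_⟩
    simp [hK, h1]
  · ext1 x; rw [hK, h3]
  · intro t _ x hx
    rw [hK]; exact h5 t _ ⟨x, hx, rfl⟩

end IsotopicToIdRel

/-! ### Small perturbations of the identity -/

theorem bijective_id_add {E : Type*} [NormedAddCommGroup E] [CompleteSpace E] {w : E → E}
    (hw : LipschitzWith (1 / 2) w) : Bijective fun x => x + w x := by
  constructor
  · intro x y h
    have h1 : ‖w x - w y‖ ≤ 1 / 2 * ‖x - y‖ := by
      simpa [dist_eq_norm] using hw.dist_le_mul x y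
    have h2 : x - y = w y - w x := by
      have : x + w x = y + w y := h
      rw [sub_eq_sub_iff_add_eq_add, this, add_comm]
    rw [norm_sub_rev, ← h2] at h1
    have := norm_nonneg (x - y)
    exact sub_eq_zero.1 (norm_eq_zero.1 (by linarith))
  · intro y
    -- A preimage of `y` is a fixed point of this contraction.
    have hc : ContractingWith (1 / 2) fun x => y - w x := by
      refine ⟨by norm_num, ?_⟩
      intro a b
      simpa [edist_sub_left] using hw a b
    refine ⟨hc.fixedPoint _, ?_⟩
    have := hc.fixedPoint_isFixedPt (f := fun x => y - w x)
    have h : y - w (hc.fixedPoint _) = hc.fixedPoint _ := this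
    show hc.fixedPoint _ + w (hc.fixedPoint _) = y
    nth_rewrite 1 [← h]
    abel

theorem lipschitzWith_half_of_fderiv {E : Type*} [NormedAddCommGroup E] [NormedSpace ℝ E]
    {w : E → E} (hw : Differentiable ℝ w) (hd : ∀ x, ‖fderiv ℝ w x‖ ≤ 1 / 2) :
    LipschitzWith (1 / 2) w :=
  lipschitzWith_of_nnnorm_fderiv_le hw fun x => by
    rw [← NNReal.coe_le_coe, coe_nnnorm]; simpa using hd x

theorem injective_id_add_of_norm_le {E : Type*} [NormedAddCommGroup E] [NormedSpace ℝ E]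
    {L : E →L[ℝ] E} (hL : ‖L‖ ≤ 1 / 2) : Injective (ContinuousLinearMap.id ℝ E + L) := by
  rw [injective_iff_map_eq_zero]
  intro v hv
  have h1 : v = -L v := by
    simpa [add_eq_zero_iff_eq_neg] using hv
  have h2 : ‖v‖ ≤ 1 / 2 * ‖v‖ := by
    calc ‖v‖ = ‖L v‖ := by conv_lhs => rw [h1, norm_neg]
      _ ≤ ‖L‖ * ‖v‖ := L.le_opNorm v
      _ ≤ _ := by gcongr
  have := norm_nonneg v
  exact norm_eq_zero.1 (by linarith)

namespace IsotopicToIdRel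

/-- Scaling the displacement by a factor in `[0, 1]` preserves the derivative bound 1/2, so every
stage is a bijective immersion by the contraction principle; zeros of `w` never move. -/
theorem id_add {w : E3 → E3} (hw : ContDiff ℝ ∞ w) (hd : ∀ x, ‖fderiv ℝ w x‖ ≤ 1 / 2) :
    IsotopicToIdRel {x | w x = 0} fun x => x + w x := by
  have hst : ∀ t x, ‖fderiv ℝ (fun y => Real.smoothTransition t • w y) x‖ ≤ 1 / 2 := by
    intro t x
    rw [fderiv_fun_const_smul ((hw.differentiable (by simp)) x), norm_smul]
    have h0 := Real.smoothTransition.nonneg t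
    have h1 := Real.smoothTransition.le_one t
    rw [Real.norm_of_nonneg h0]
    calc _ ≤ 1 * ‖fderiv ℝ w x‖ := by gcongr
      _ ≤ _ := by rw [one_mul]; exact hd x
  have hsm : ∀ t, ContDiff ℝ ∞ fun y => Real.smoothTransition t • w y :=
    fun t => hw.const_smul _
  have := of_bijective (A := {x | w x = 0})
    (F := fun p => p.2 + Real.smoothTransition p.1 • w p.2)
    (contDiff_snd.add ((Real.smoothTransition.contDiff.comp contDiff_fst).smul
      (hw.comp contDiff_snd)))
    (fun t => bijective_id_add
      (lipschitzWith_half_of_fderiv ((hsm t).differentiable (by simp)) (hst t)))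
    (fun t x => ?_) (fun x => by simp) (fun t x hx => by
      have : w x = 0 := hx
      simp [this])
  · simpa using this
  · have h : fderiv ℝ (fun y => y + Real.smoothTransition t • w y) x =
        ContinuousLinearMap.id ℝ E3 + fderiv ℝ (fun y => Real.smoothTransition t • w y) x :=
      ((hasFDerivAt_id x).add (((hsm t).differentiable (by simp)) x).hasFDerivAt).fderiv
    simp only [h]
    exact injective_id_add_of_norm_le (hst t x)

end IsotopicToIdRel

/-! ### Vertical and horizontal parts -/

/-- The vertical unit vector. -/
noncomputable def vert : E3 := EuclideanSpace.single 2 1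

/-- The height function. -/
noncomputable def hgt : E3 →L[ℝ] ℝ := EuclideanSpace.proj 2

/-- The orthogonal projection to the horizontal plane. -/
noncomputable def flat : E3 →L[ℝ] E3 := ContinuousLinearMap.id ℝ E3 - hgt.smulRight vert

theorem hgt_apply (p : E3) : hgt p = p 2 := rfl

theorem flat_apply (p : E3) : flat p = p - hgt p • vert := rfl

@[simp] theorem hgt_vert : hgt vert = 1 := by simp [hgt, vert]

@[simp] theorem norm_vert : ‖vert‖ = 1 := by simp [vert]

@[simp] theorem flat_vert : flat vert = 0 := by simp [flat_apply]

@[simp] theorem hgt_flat (p : E3) : hgt (flat p) = 0 := by simp [flat_apply]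

@[simp] theorem flat_flat (p : E3) : flat (flat p) = flat p := by
  rw [flat_apply (flat p)]; simp

theorem flat_add_hgt (p : E3) : flat p + hgt p • vert = p := by simp [flat_apply]

theorem flat_eq_self {p : E3} (h : hgt p = 0) : flat p = p := by simp [flat_apply, h]

theorem ext_flat_hgt {p q : E3} (h1 : flat p = flat q) (h2 : hgt p = hgt q) : p = q := by
  rw [← flat_add_hgt p, ← flat_add_hgt q, h1, h2]

@[simp] theorem flat_zero_apply (p : E3) : flat p 0 = p 0 := by simp [flat_apply, vert]

@[simp] theorem flat_one_apply (p : E3) : flat p 1 = p 1 := by simp [flat_apply, vert]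

theorem norm_sq_flat_add_hgt (p : E3) : ‖p‖ ^ 2 = ‖flat p‖ ^ 2 + hgt p ^ 2 := by
  have h : flat p 2 = 0 := hgt_flat p
  simp [EuclideanSpace.norm_sq_eq, Fin.sum_univ_three, h, hgt_apply]

theorem norm_flat_le (p : E3) : ‖flat p‖ ≤ ‖p‖ := by
  have := norm_sq_flat_add_hgt p
  exact le_of_sq_le_sq (by nlinarith [sq_nonneg (hgt p)]) (norm_nonneg _)

theorem abs_hgt_le (p : E3) : |hgt p| ≤ ‖p‖ := by
  have := norm_sq_flat_add_hgt p
  exact abs_le_of_sq_le_sq (by nlinarith [sq_nonneg (‖flat p‖)]) (norm_nonneg _)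

theorem upperHalfSpace3_eq : upperHalfSpace3 = {p | 0 ≤ hgt p} := rfl

theorem flat_eq_zero_iff (p : E3) : flat p = 0 ↔ p 0 = 0 ∧ p 1 = 0 := by
  constructor
  · intro h
    rw [← flat_zero_apply, ← flat_one_apply p, h]; simp
  · rintro ⟨h0, h1⟩
    ext i
    fin_cases i
    · simpa using h0
    · simpa using h1
    · exact hgt_flat p

theorem zetaRay_eq : zetaRay = {p | flat p = 0 ∧ 1 ≤ hgt p} := by
  ext p
  simp [zetaRay, flat_eq_zero_iff, hgt_apply, and_assoc]

theorem hasDerivAt_vertical {a : E3 → ℝ} (ha : Differentiable ℝ a) (c : ℝ) (q : E3) (z : ℝ) :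
    HasDerivAt (fun z : ℝ => z + c * a (q + z • vert))
      (1 + c * fderiv ℝ a (q + z • vert) vert) z := by
  have h1 : HasDerivAt (fun z : ℝ => q + z • vert) vert z := by
    simpa using ((hasDerivAt_id z).smul_const vert).const_add q
  have h2 := (ha (q + z • vert)).hasFDerivAt.comp_hasDerivAt z h1
  exact (hasDerivAt_id z).add (h2.const_mul _)

/-- A vertical displacement which moves the graph of `f` to the graph of `g` moves the region above
the former to the region above the latter. -/
theorem image_vertical {a f g : E3 → ℝ} (ha : Differentiable ℝ a)
    (hd : ∀ p, -1 < fderiv ℝ a p vert) (hsurj : Surjective fun p => p + a p • vert)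
    (hf : ∀ p, f (flat p) = f p) (hg : ∀ p, g (flat p) = g p)
    (hfg : ∀ p, hgt p = f p → f p + a p = g p) :
    (fun p => p + a p • vert) '' {p | f p ≤ hgt p} = {p | g p ≤ hgt p} := by
  -- The displacement is increasing on every vertical line, so it suffices that it takes the level
  -- `f` to the level `g` there.
  have hm : ∀ q, StrictMono (fun z : ℝ => z + 1 * a (q + z • vert)) := fun q =>
    strictMono_of_deriv_pos fun z => by
      rw [(hasDerivAt_vertical ha 1 q z).deriv]; linarith [hd (q + z • vert)]
  have hgr : ∀ p, f p + 1 * a (flat p + f p • vert) = g p := fun p => by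
    have h1 := hfg (flat p + f p • vert)
    have h2 : f (flat p + f p • vert) = f p := by rw [← hf, ← hf p]; simp
    have h3 : g (flat p + f p • vert) = g p := by rw [← hg, ← hg p]; simp
    rw [h2, h3] at h1
    rw [one_mul]; exact h1 (by simp)
  have hval : ∀ p, hgt (p + a p • vert) = hgt p + 1 * a (flat p + hgt p • vert) := fun p => by
    rw [flat_add_hgt]; simp
  have hgp : ∀ p, g (p + a p • vert) = g p := fun p => by rw [← hg, ← hg p]; simp
  apply Subset.antisymm
  · rintro _ ⟨p, hp, rfl⟩
    show g (p + a p • vert) ≤ hgt (p + a p • vert)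
    rw [hgp, hval, ← hgr p]
    exact (hm (flat p)).monotone hp
  · intro q hq
    obtain ⟨p, rfl⟩ := hsurj q
    refine ⟨p, ?_, rfl⟩
    have h1 : g (p + a p • vert) ≤ hgt (p + a p • vert) := hq
    rw [hgp, hval, ← hgr p] at h1
    exact (hm (flat p)).le_iff_le.1 h1

namespace IsotopicToIdRel

/-- Vertical displacement by a function which is bounded on vertical lines and has vertical
derivative larger than `-1`. -/
theorem vertical {a : E3 → ℝ} (ha : ContDiff ℝ ∞ a) (hd : ∀ p, -1 < fderiv ℝ a p vert)
    (hb : ∀ q, ∃ K, ∀ z : ℝ, |a (q + z • vert)| ≤ K) :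
    IsotopicToIdRel {p | a p = 0} fun p => p + a p • vert := by
  have had := ha.differentiable (by simp)
  have hs0 := Real.smoothTransition.nonneg
  have hs1 := Real.smoothTransition.le_one
  have hpos : ∀ t p, 0 < 1 + Real.smoothTransition t * fderiv ℝ a p vert := by
    intro t p
    rcases (hs0 t).eq_or_lt with h | h
    · rw [← h]; simp
    · nlinarith [hd p, hs1 t, mul_lt_mul_of_pos_left (hd p) h]
  have hder := fun t : ℝ => hasDerivAt_vertical had (Real.smoothTransition t)
  have := of_bijective (A := {p | a p = 0})
    (F := fun p => p.2 + (Real.smoothTransition p.1 * a p.2) • vert)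
    (contDiff_snd.add (((Real.smoothTransition.contDiff.comp contDiff_fst).mul
      (ha.comp contDiff_snd)).smul contDiff_const))
    (fun t => ?_) (fun t x => ?_) (fun x => by simp) (fun t x hx => by
      have : a x = 0 := hx
      simp [this])
  · simpa using this
  · constructor
    · intro p q h
      have hf : flat p = flat q := by simpa using congrArg flat h
      have hh : hgt p + Real.smoothTransition t * a p = hgt q + Real.smoothTransition t * a q := by
        simpa using congrArg hgt h
      have hm : StrictMono (fun z : ℝ => z + Real.smoothTransition t * a (flat p + z • vert)) :=
        strictMono_of_deriv_pos fun z => by rw [(hder t _ z).deriv]; exact hpos _ _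
      refine ext_flat_hgt hf (hm.injective ?_)
      show hgt p + Real.smoothTransition t * a (flat p + hgt p • vert) =
        hgt q + Real.smoothTransition t * a (flat p + hgt q • vert)
      conv_rhs => rw [hf]
      rw [flat_add_hgt, flat_add_hgt, hh]
    · intro p
      -- Monotonicity gives injectivity; boundedness on the line gives surjectivity by the
      -- intermediate value theorem.
      obtain ⟨K, hK⟩ := hb (flat p)
      have hcont : Continuous (fun z : ℝ => z + Real.smoothTransition t * a (flat p + z • vert)) :=
        continuous_iff_continuousAt.2 fun z => (hder t _ z).continuousAt
      have hK' : ∀ z : ℝ, |Real.smoothTransition t * a (flat p + z • vert)| ≤ K := fun z => by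
        rw [abs_mul, abs_of_nonneg (hs0 t)]
        calc _ ≤ 1 * |a (flat p + z • vert)| := by gcongr; exact hs1 t
          _ ≤ K := by rw [one_mul]; exact hK z
      have h1 := abs_le.1 (hK' (hgt p - K))
      have h2 := abs_le.1 (hK' (hgt p + K))
      obtain ⟨z, hz⟩ := mem_range_of_exists_le_of_exists_ge hcont
        ⟨hgt p - K, show _ ≤ hgt p by linarith⟩ ⟨hgt p + K, show hgt p ≤ _ by linarith⟩
      refine ⟨flat p + z • vert, ext_flat_hgt (by simp) ?_⟩
      simpa using hz
  · have h : fderiv ℝ (fun y => y + (Real.smoothTransition t * a y) • vert) x =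
        ContinuousLinearMap.id ℝ E3 + (Real.smoothTransition t • fderiv ℝ a x).smulRight vert :=
      ((hasFDerivAt_id x).add (((had x).hasFDerivAt.const_mul _).smul_const vert)).fderiv
    simp only [h]
    rw [injective_iff_map_eq_zero]
    intro v hv
    have hv' : v + (Real.smoothTransition t * fderiv ℝ a x v) • vert = 0 := hv
    have h1 : v = hgt v • vert := by
      have : flat v = 0 := by simpa using congrArg flat hv'
      conv_lhs => rw [← flat_add_hgt v, this, zero_add]
    have h2 : hgt v + Real.smoothTransition t * fderiv ℝ a x v = 0 := by
      simpa using congrArg hgt hv'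
    rw [h1] at h2
    simp only [map_smul, hgt_vert, smul_eq_mul, mul_one] at h2
    have h3 : hgt v * (1 + Real.smoothTransition t * fderiv ℝ a x vert) = 0 := by linarith
    rcases mul_eq_zero.1 h3 with h4 | h4
    · rw [h1, h4, zero_smul]
    · exact absurd h4 (hpos t x).ne'

end IsotopicToIdRel

/-! ### Transplanting isotopies through open embeddings -/

section Transplant

variable {Z : Type} (Φ : Z → E3 → E3) (U : Z → Set E3)

open Classical in
/-- The map of `ℝ³` which is conjugate to `S z` on the image of `U z` under `Φ z`, for all `z`, and
the identity elsewhere. -/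
noncomputable def transplant (S : Z → E3 → E3) (y : E3) : E3 :=
  if h : ∃ z, ∃ x ∈ U z, Φ z x = y then Φ h.choose (S h.choose h.choose_spec.choose) else y

variable {Φ U}

theorem transplant_apply
    (hinj : ∀ z z' x x', x ∈ U z → x' ∈ U z' → Φ z x = Φ z' x' → z = z' ∧ x = x')
    (S : Z → E3 → E3) {z : Z} {x : E3} (hx : x ∈ U z) :
    transplant Φ U S (Φ z x) = Φ z (S z x) := by
  have h : ∃ z', ∃ x' ∈ U z', Φ z' x' = Φ z x := ⟨z, x, hx, rfl⟩
  rw [transplant, dif_pos h]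
  have h1 := h.choose_spec.choose_spec
  obtain ⟨h2, h3⟩ := hinj _ _ _ _ h1.1 hx h1.2
  rw [h3, h2]

theorem transplant_of_notMem
    (hinj : ∀ z z' x x', x ∈ U z → x' ∈ U z' → Φ z x = Φ z' x' → z = z' ∧ x = x')
    {S : Z → E3 → E3} {C : Z → Set E3} (hS : ∀ z, ∀ x ∉ C z, S z x = x) {y : E3}
    (hy : y ∉ ⋃ z, Φ z '' C z) : transplant Φ U S y = y := by
  by_cases h : ∃ z, ∃ x ∈ U z, Φ z x = y
  · obtain ⟨z, x, hx, rfl⟩ := h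
    rw [transplant_apply hinj S hx, hS z x fun hxC => hy (mem_iUnion.2 ⟨z, x, hxC, rfl⟩)]
  · rw [transplant, dif_neg h]

/-- On the open images of the `U z` the map is conjugate to a smooth one. At any other point it is
the identity nearby because the union of the supports is closed; for infinite families this
closedness is the essential hypothesis. -/
theorem contDiff_transplant (hU : ∀ z, IsOpen (U z)) (hs : ∀ z, ContDiffOn ℝ ∞ (Φ z) (U z))
    (hd : ∀ z, ∀ x ∈ U z, Injective (fderiv ℝ (Φ z) x))
    (hinj : ∀ z z' x x', x ∈ U z → x' ∈ U z' → Φ z x = Φ z' x' → z = z' ∧ x = x')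
    {C : Z → Set E3} (hCU : ∀ z, C z ⊆ U z) (hC : IsClosed (⋃ z, Φ z '' C z)) {F : Z → ℝ × E3 → E3}
    (hF : ∀ z, ContDiff ℝ ∞ (F z)) (hFU : ∀ z t, ∀ x ∈ U z, F z (t, x) ∈ U z)
    (hFC : ∀ z t, ∀ x ∉ C z, F z (t, x) = x) :
    ContDiff ℝ ∞ fun p : ℝ × E3 => transplant Φ U (fun z x => F z (p.1, x)) p.2 := by
  rw [contDiff_iff_contDiffAt]
  rintro ⟨t, y⟩
  by_cases hy : y ∈ ⋃ z, Φ z '' U z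
  · obtain ⟨z, x, hx, rfl⟩ := mem_iUnion.1 hy
    obtain ⟨hop, g, hg, hgΦ⟩ := isOpen_image_and_exists_smooth_inverse (hU z) (hs z)
      (fun x hx x' hx' h => (hinj z z x x' hx hx' h).2) (hd z)
    have hopen := hop _ subset_rfl (hU z)
    have hg' : ContDiffAt ℝ ∞ g (Φ z x) := hg.contDiffAt (hopen.mem_nhds ⟨x, hx, rfl⟩)
    have h1 : ContDiffAt ℝ ∞ (fun p : ℝ × E3 => Φ z (F z (p.1, g p.2))) (t, Φ z x) := by
      have h2 : ContDiffAt ℝ ∞ (fun p : ℝ × E3 => F z (p.1, g p.2)) (t, Φ z x) :=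
        (hF z).contDiffAt.comp (t, Φ z x)
          (contDiffAt_fst.prodMk (hg'.comp (t, Φ z x) contDiffAt_snd))
      refine ContDiffAt.comp (t, Φ z x) ((hs z).contDiffAt ((hU z).mem_nhds ?_)) h2
      exact hFU z t _ (by rw [hgΦ x hx]; exact hx)
    refine h1.congr_of_eventuallyEq ?_
    have h3 : ∀ᶠ p : ℝ × E3 in 𝓝 (t, Φ z x), p.2 ∈ Φ z '' U z :=
      continuous_snd.continuousAt.eventually (hopen.mem_nhds ⟨x, hx, rfl⟩)
    filter_upwards [h3]
    rintro ⟨s, _⟩ ⟨x', hx', rfl⟩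
    simp only
    rw [transplant_apply hinj _ hx', hgΦ x' hx']
  · have hyC : y ∉ ⋃ z, Φ z '' C z := fun h =>
      hy (iUnion_mono (fun z => image_mono (hCU z)) h)
    refine contDiffAt_snd.congr_of_eventuallyEq ?_
    have h3 : ∀ᶠ p : ℝ × E3 in 𝓝 (t, y), p.2 ∈ (⋃ z, Φ z '' C z)ᶜ :=
      continuous_snd.continuousAt.eventually (hC.isOpen_compl.mem_nhds hyC)
    filter_upwards [h3] with p hp
    exact transplant_of_notMem hinj (fun z x hx => hFC z p.1 x hx) hp

/-- The device that performs model isotopies in all components at once. A point of ℝ³ is kept fixed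
when all its model coordinates, if any, are. -/
theorem IsotopicToIdRel.transplant (hU : ∀ z, IsOpen (U z))
    (hs : ∀ z, ContDiffOn ℝ ∞ (Φ z) (U z))
    (hd : ∀ z, ∀ x ∈ U z, Injective (fderiv ℝ (Φ z) x))
    (hinj : ∀ z z' x x', x ∈ U z → x' ∈ U z' → Φ z x = Φ z' x' → z = z' ∧ x = x')
    {C : Z → Set E3} (hCU : ∀ z, C z ⊆ U z) (hC : IsClosed (⋃ z, Φ z '' C z))
    {B : Z → Set E3} (hCB : ∀ z, ∀ x ∉ C z, x ∈ B z)
    {d : Z → E3 → E3} (h : ∀ z, IsotopicToIdRel (B z) (d z)) :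
    ∃ D, IsotopicToIdRel {y | ∀ z, ∀ x ∈ U z, Φ z x = y → x ∈ B z} D ∧
      ∀ z, ∀ x ∈ U z, D (Φ z x) = Φ z (d z x) := by
  choose F G hF hG h1 h2 h3 h4 h5B using h
  have h5 : ∀ z t, ∀ x ∉ C z, F z (t, x) = x := fun z t x hx => h5B z t x (hCB z x hx)
  have h5' : ∀ z t, ∀ x ∉ C z, G z (t, x) = x := fun z t x hx => by
    conv_lhs => rw [← h5 z t x hx]
    exact h1 z t x
  -- A point that left `U z` would arrive outside the support, where the stage is the identity; by
  -- injectivity it would have been there from the start.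
  have hFU : ∀ z t, ∀ x ∈ U z, F z (t, x) ∈ U z := by
    intro z t x hx
    by_contra hn
    have : F z (t, F z (t, x)) = F z (t, x) := h5 z t _ fun hc => hn (hCU z hc)
    have h6 := congrArg (fun y => G z (t, y)) this
    simp only [h1] at h6
    exact hn (by rw [h6]; exact hx)
  have hGU : ∀ z t, ∀ x ∈ U z, G z (t, x) ∈ U z := by
    intro z t x hx
    by_contra hn
    have : G z (t, G z (t, x)) = G z (t, x) := h5' z t _ fun hc => hn (hCU z hc)
    have h6 := congrArg (fun y => F z (t, y)) this
    simp only [h2] at h6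
    exact hn (by rw [h6]; exact hx)
  have hcomp : ∀ {A B : Z → ℝ × E3 → E3}, (∀ z t, ∀ x ∈ U z, A z (t, x) ∈ U z) →
      (∀ z t x, B z (t, A z (t, x)) = x) → ∀ t y,
      _root_.transplant Φ U (fun z x => B z (t, x))
        (_root_.transplant Φ U (fun z x => A z (t, x)) y) = y := by
    intro A B hA hBA t y
    by_cases hy : ∃ z, ∃ x ∈ U z, Φ z x = y
    · obtain ⟨z, x, hx, rfl⟩ := hy
      rw [transplant_apply hinj _ hx, transplant_apply hinj _ (hA z t x hx), hBA]
    · have : ∀ S, _root_.transplant Φ U S y = y := fun S => by rw [_root_.transplant, dif_neg hy]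
      rw [this, this]
  have hid : ∀ y, _root_.transplant Φ U (fun _ x => x) y = y := fun y =>
    transplant_of_notMem hinj (C := fun _ => ∅) (fun _ _ _ => rfl) (by simp)
  refine ⟨_root_.transplant Φ U d,
    ⟨fun p => _root_.transplant Φ U (fun z x => F z (p.1, x)) p.2,
      fun p => _root_.transplant Φ U (fun z x => G z (p.1, x)) p.2,
      contDiff_transplant hU hs hd hinj hCU hC hF hFU h5,
      contDiff_transplant hU hs hd hinj hCU hC hG hGU h5',
      hcomp hFU h1, hcomp hGU h2, fun x => ?_, fun x => ?_, fun t x hx => ?_⟩,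
    fun z x hx => transplant_apply hinj _ hx⟩
  · simp only [h3, hid]
  · simp only [h4]
  · by_cases hy : ∃ z, ∃ x' ∈ U z, Φ z x' = x
    · obtain ⟨z, x, hxU, rfl⟩ := hy
      simp only [transplant_apply hinj _ hxU, h5B z t x (hx z x hxU rfl)]
    · simp only [_root_.transplant, dif_neg hy]

end Transplant

/-! ### Small smooth functions -/

section Small

variable {E : Type*} [NormedAddCommGroup E] [InnerProductSpace ℝ E] [FiniteDimensional ℝ E]

/-- Partitions of unity: a pointwise convex condition that constants solve locally is solved by a
smooth function. -/
theorem exists_contDiff_forall_mem_of_local {F : Type*} [NormedAddCommGroup F] [NormedSpace ℝ F]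
    {T : E → Set F} (hT : ∀ x, Convex ℝ (T x)) (hloc : ∀ x, ∃ c, ∀ᶠ y in 𝓝 x, c ∈ T y) :
    ∃ g : E → F, ContDiff ℝ ∞ g ∧ ∀ x, g x ∈ T x := by
  obtain ⟨g, hg⟩ := exists_contMDiffMap_forall_mem_convex_of_local_const (n := (⊤ : ℕ∞)) 𝓘(ℝ, E) hT hloc
  exact ⟨g, g.contMDiff.contDiff, hg⟩

/-- Partitions of unity control values but not derivatives. A smooth `v` of one variable is
therefore chosen below the minimum of `δ / (2 (1 + ‖x‖))` over growing balls and averaged over `[t,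
t + 1]`: the derivative of the average is `v (t + 1) - v t`, again small. Composing with `‖x‖ ^ 2`
costs a factor `2 ‖x‖`, which the denominator absorbs. -/
theorem exists_contDiff_pos_le_and_norm_fderiv_le {δ : E → ℝ} (hδ : Continuous δ)
    (hpos : ∀ x, 0 < δ x) :
    ∃ ε : E → ℝ, ContDiff ℝ ∞ ε ∧ ∀ x, 0 < ε x ∧ ε x ≤ δ x ∧ ‖fderiv ℝ ε x‖ ≤ δ x := by
  have hq : ∀ x : E, 0 < δ x / (2 * (1 + ‖x‖)) := fun x => by have := hpos x; positivity
  obtain ⟨v, hv, hvT⟩ := exists_contDiff_forall_mem_of_local (E := ℝ) (F := ℝ)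
    (T := fun t => {c | 0 < c ∧ ∀ x : E, ‖x‖ ^ 2 ≤ t → c ≤ δ x / (2 * (1 + ‖x‖))}) (by
      intro t a ha b hb r s hr hs hrs
      simp only [smul_eq_mul]
      refine ⟨?_, fun x hx => ?_⟩
      · rcases hr.eq_or_lt with h | h
        · have : s = 1 := by linarith
          rw [← h, this]; linarith [hb.1]
        · have := mul_pos h ha.1
          have := mul_nonneg hs hb.1.le
          linarith
      · have h1 := mul_le_mul_of_nonneg_left (ha.2 x hx) hr
        have h2 := mul_le_mul_of_nonneg_left (hb.2 x hx) hs
        calc _ ≤ r * (δ x / (2 * (1 + ‖x‖))) + s * (δ x / (2 * (1 + ‖x‖))) := by linarith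
          _ = _ := by rw [← add_mul, hrs, one_mul]) (by
      intro t
      have hK : IsCompact (Metric.closedBall (0 : E) (|t| + 1)) := isCompact_closedBall _ _
      have hc : ContinuousOn (fun x : E => δ x / (2 * (1 + ‖x‖)))
          (Metric.closedBall (0 : E) (|t| + 1)) := by
        refine Continuous.continuousOn (hδ.div (by fun_prop) fun x => ?_)
        positivity
      obtain ⟨x₀, -, hx₀⟩ := hK.exists_isMinOn ⟨0, by simp; positivity⟩ hc
      refine ⟨δ x₀ / (2 * (1 + ‖x₀‖)), ?_⟩
      filter_upwards [Iio_mem_nhds (show t < t + 1 by linarith)] with s hs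
      refine ⟨hq x₀, fun x hx => hx₀ ?_⟩
      have hs' : s < t + 1 := hs
      rw [mem_closedBall_zero_iff]
      nlinarith [norm_nonneg x, le_abs_self t, abs_nonneg t])
  have hvc : Continuous v := hv.continuous
  let V : ℝ → ℝ := fun t => ∫ s in (0 : ℝ)..t, v s
  have hVd : ∀ t, HasDerivAt V (v t) t := fun t =>
    intervalIntegral.integral_hasDerivAt_right (hvc.intervalIntegrable _ _)
      (hvc.stronglyMeasurableAtFilter _ _) hvc.continuousAt
  have hV : ContDiff ℝ ∞ V := by
    rw [contDiff_infty_iff_deriv]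
    refine ⟨fun t => (hVd t).differentiableAt, ?_⟩
    rw [show deriv V = v from funext fun t => (hVd t).deriv]; exact hv
  let e : ℝ → ℝ := fun t => V (t + 1) - V t
  have he : ContDiff ℝ ∞ e := (hV.comp (contDiff_id.add contDiff_const)).sub hV
  have hed : ∀ t, HasDerivAt e (v (t + 1) - v t) t := fun t => by
    have := (hVd (t + 1)).comp_add_const t 1
    exact this.sub (hVd t)
  have hei : ∀ t, ∃ s, t ≤ s ∧ e t = v s := by
    intro t
    obtain ⟨c, hc, hc'⟩ := exists_hasDerivAt_eq_slope V v (show t < t + 1 by linarith)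
      hV.continuous.continuousOn fun x _ => hVd x
    refine ⟨c, hc.1.le, ?_⟩
    rw [hc']; simp [e]
  refine ⟨fun x => e (‖x‖ ^ 2), he.comp (contDiff_norm_sq ℝ), fun x => ?_⟩
  have hle : ∀ s, ‖x‖ ^ 2 ≤ s → v s ≤ δ x / (2 * (1 + ‖x‖)) := fun s hs => (hvT s).2 x hs
  have hqle : δ x / (2 * (1 + ‖x‖)) ≤ δ x :=
    div_le_self (hpos x).le (by linarith [norm_nonneg x])
  obtain ⟨s, hs, hes⟩ := hei (‖x‖ ^ 2)
  refine ⟨hes.symm.subst (motive := fun u => 0 < u) (hvT s).1, hes.le.trans ((hle s hs).trans hqle), ?_⟩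
  have h1 : HasFDerivAt (fun x : E => ‖x‖ ^ 2) (2 • (innerSL ℝ x)) x :=
    (hasStrictFDerivAt_norm_sq x).hasFDerivAt
  have h2 := (hed (‖x‖ ^ 2)).comp_hasFDerivAt x h1
  rw [show fderiv ℝ (fun x => e (‖x‖ ^ 2)) x = _ from h2.fderiv, norm_smul]
  have h3 : ‖v (‖x‖ ^ 2 + 1) - v (‖x‖ ^ 2)‖ ≤ δ x / (2 * (1 + ‖x‖)) := by
    rw [Real.norm_eq_abs, abs_le]
    have a1 := (hvT (‖x‖ ^ 2 + 1)).1
    have a2 := (hvT (‖x‖ ^ 2)).1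
    have a3 := hle (‖x‖ ^ 2 + 1) (by linarith)
    have a4 := hle (‖x‖ ^ 2) le_rfl
    constructor <;> linarith
  have h4 : ‖(2 • innerSL ℝ x : E →L[ℝ] ℝ)‖ ≤ 2 * ‖x‖ := by
    rw [← Nat.cast_smul_eq_nsmul ℝ, norm_smul]; simp
  calc _ ≤ δ x / (2 * (1 + ‖x‖)) * (2 * ‖x‖) := mul_le_mul h3 h4 (norm_nonneg _) (hq x).le
    _ = δ x * (‖x‖ / (1 + ‖x‖)) := by field_simp
    _ ≤ δ x * 1 := by
      gcongr
      · exact (hpos x).le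
      · rw [div_le_one (by positivity)]; linarith
    _ = δ x := mul_one _

/-- A smooth positive function which is, with its derivative, as small as prescribed locally. -/
theorem exists_contDiff_pos_small {P : E → ℝ → Prop}
    (hP : ∀ x₀, ∃ c > 0, ∀ᶠ x in 𝓝 x₀, ∀ s, 0 < s → s ≤ c → P x s) :
    ∃ ε : E → ℝ, ContDiff ℝ ∞ ε ∧
      ∀ x, 0 < ε x ∧ ∃ c, ε x ≤ c ∧ ‖fderiv ℝ ε x‖ ≤ c ∧ ∀ s, 0 < s → s ≤ c → P x s := by
  obtain ⟨δ, hδ, hδT⟩ := exists_contDiff_forall_mem_of_local (E := E) (F := ℝ)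
    (T := fun x => {c | 0 < c ∧ ∀ s, 0 < s → s ≤ c → P x s}) (by
      intro x a ha b hb r s hr hs hrs
      -- Admissible bounds are closed under passing to smaller positive numbers, so a convex
      -- combination inherits admissibility from the larger of the two.
      have hmax : r • a + s • b ≤ max a b := by
        have h1 := mul_le_mul_of_nonneg_left (le_max_left a b) hr
        have h2 := mul_le_mul_of_nonneg_left (le_max_right a b) hs
        simp only [smul_eq_mul]
        calc _ ≤ r * max a b + s * max a b := add_le_add h1 h2
          _ = _ := by rw [← add_mul, hrs, one_mul]
      refine ⟨?_, fun u hu hu' => ?_⟩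
      · simp only [smul_eq_mul]
        rcases hr.eq_or_lt with h | h
        · have : s = 1 := by linarith
          rw [← h, this]; linarith [hb.1]
        · have := mul_pos h ha.1
          have := mul_nonneg hs hb.1.le
          linarith
      · rcases le_max_iff.1 (hu'.trans hmax) with h | h
        · exact ha.2 u hu h
        · exact hb.2 u hu h) (by
      intro x
      obtain ⟨c, hc, h⟩ := hP x
      exact ⟨c, h.mono fun y hy => ⟨hc, hy⟩⟩)
  obtain ⟨ε, hε, h⟩ := exists_contDiff_pos_le_and_norm_fderiv_le hδ.continuous
    fun x => (hδT x).1
  exact ⟨ε, hε, fun x => ⟨(h x).1, δ x, (h x).2.1, (h x).2.2, (hδT x).2⟩⟩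

end Small

/-! ### Proper embeddings of half-spaces -/

theorem convex_upperHalfSpace3 : Convex ℝ upperHalfSpace3 :=
  convex_halfSpace_ge hgt.isLinear 0

theorem isOpen_hgt_pos : IsOpen {p : E3 | 0 < hgt p} :=
  isOpen_lt continuous_const hgt.continuous

theorem isClosed_upperHalfSpace3 : IsClosed upperHalfSpace3 :=
  isClosed_le continuous_const hgt.continuous

theorem hgt_pos_subset : {p : E3 | 0 < hgt p} ⊆ upperHalfSpace3 := fun p hp =>
  show 0 ≤ hgt p from le_of_lt hp

theorem uniqueDiffOn_upperHalfSpace3 : UniqueDiffOn ℝ upperHalfSpace3 :=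
  uniqueDiffOn_convex convex_upperHalfSpace3
    ⟨vert, interior_maximal hgt_pos_subset isOpen_hgt_pos (by simp)⟩

theorem upperHalfSpace3_mem_nhds {p : E3} (hp : 0 < hgt p) : upperHalfSpace3 ∈ 𝓝 p :=
  mem_of_superset (isOpen_hgt_pos.mem_nhds hp) hgt_pos_subset

theorem flat_mem (p : E3) : flat p ∈ upperHalfSpace3 := by
  rw [upperHalfSpace3_eq]; simp

theorem zetaRay_subset : zetaRay ⊆ {p : E3 | 0 < hgt p} := by
  rw [zetaRay_eq]; rintro p ⟨-, hp⟩; exact lt_of_lt_of_le one_pos hp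

theorem isClosed_zetaRay : IsClosed zetaRay := by
  rw [zetaRay_eq]
  exact (isClosed_eq flat.continuous continuous_const).inter
    (isClosed_le continuous_const hgt.continuous)

theorem vert_mem_zetaRay : vert ∈ zetaRay := by simp [zetaRay_eq]

namespace IsProperSmoothEmbedding

variable {Z : Type} [TopologicalSpace Z] [DiscreteTopology Z] {φ : Z → E3 → E3}

/-- Proper maps are closed and the index space is discrete, so closed pieces may be chosen
independently in each component. This is the local finiteness used for every transplanted isotopy.
-/
theorem isClosed_iUnion_image (hφ : IsProperSmoothEmbedding upperHalfSpace3 φ) {C : Z → Set E3}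
    (hC : ∀ z, IsClosed (C z)) (hCH : ∀ z, C z ⊆ upperHalfSpace3) :
    IsClosed (⋃ z, φ z '' C z) := by
  have h1 : IsClosed {p : Z × upperHalfSpace3 | (p.2 : E3) ∈ C p.1} := by
    have : {p : Z × upperHalfSpace3 | (p.2 : E3) ∈ C p.1}ᶜ =
        ⋃ z, {p : Z × upperHalfSpace3 | p.1 ∈ ({z} : Set Z) ∧ (p.2 : E3) ∈ (C z)ᶜ} := by
      ext p; simp
    rw [← isOpen_compl_iff, this]
    refine isOpen_iUnion fun z => ?_
    exact ((isOpen_discrete {z}).preimage continuous_fst).inter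
      ((hC z).isOpen_compl.preimage (continuous_subtype_val.comp continuous_snd))
  have h2 := hφ.proper.isClosedMap _ h1
  refine isClosed_of_closure_subset ?_
  have h3 : ⋃ z, φ z '' C z =
      (fun p : Z × upperHalfSpace3 => φ p.1 p.2) '' {p | (p.2 : E3) ∈ C p.1} := by
    refine Subset.antisymm ?_ ?_
    · refine iUnion_subset fun z => ?_
      rintro _ ⟨x, hx, rfl⟩
      exact ⟨(z, ⟨x, hCH z hx⟩), hx, rfl⟩
    · rintro _ ⟨p, hp, rfl⟩
      exact mem_iUnion.2 ⟨p.1, p.2, hp, rfl⟩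
  rw [h3]
  exact h2.closure_subset

theorem eq_of_apply_eq (hφ : IsProperSmoothEmbedding upperHalfSpace3 φ) {z z' : Z} {x x' : E3}
    (hx : x ∈ upperHalfSpace3) (hx' : x' ∈ upperHalfSpace3) (h : φ z x = φ z' x') :
    z = z' ∧ x = x' := by
  have := @hφ.injective (z, ⟨x, hx⟩) (z', ⟨x', hx'⟩) h
  simpa using this

/-- Continuity of the inverse on the image, including the component index: parameters far from `(z,
x)` fill a closed set that misses `φ z x`. -/
theorem eventually_mem (hφ : IsProperSmoothEmbedding upperHalfSpace3 φ) {z : Z} {x : E3}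
    (hx : x ∈ upperHalfSpace3) {V : Set E3} (hV : V ∈ 𝓝 x) :
    ∀ᶠ y in 𝓝 (φ z x), ∀ z' x', x' ∈ upperHalfSpace3 → φ z' x' = y → z' = z ∧ x' ∈ V := by
  classical
  have hcl : IsClosed (⋃ z', φ z' '' (if z' = z then upperHalfSpace3 \ interior V
      else upperHalfSpace3)) := by
    refine hφ.isClosed_iUnion_image (fun z' => ?_) fun z' => ?_
    · split_ifs
      · exact isClosed_upperHalfSpace3.sdiff isOpen_interior
      · exact isClosed_upperHalfSpace3
    · split_ifs
      · exact sdiff_subset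
      · exact subset_rfl
  have hn : φ z x ∈ (⋃ z', φ z' '' (if z' = z then upperHalfSpace3 \ interior V
      else upperHalfSpace3))ᶜ := by
    intro h
    obtain ⟨z', x', hx', h'⟩ := mem_iUnion.1 h
    split_ifs at hx' with hz
    · obtain ⟨-, rfl⟩ := hφ.eq_of_apply_eq hx'.1 hx h'
      exact hx'.2 (mem_interior_iff_mem_nhds.2 hV)
    · exact hz (hφ.eq_of_apply_eq hx' hx h').1
  filter_upwards [hcl.isOpen_compl.mem_nhds hn]
  rintro y hy z' x' hx' rfl
  by_contra hcon
  refine hy (mem_iUnion.2 ⟨z', x', ?_, rfl⟩)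
  split_ifs with hz
  · exact ⟨hx', fun h => hcon ⟨hz, interior_subset h⟩⟩
  · exact hx'

theorem contDiffOn_pos (hφ : IsProperSmoothEmbedding upperHalfSpace3 φ) (z : Z) :
    ContDiffOn ℝ ∞ (φ z) {p | 0 < hgt p} := (hφ.smooth z).mono hgt_pos_subset

theorem injective_fderiv (hφ : IsProperSmoothEmbedding upperHalfSpace3 φ) (z : Z) {p : E3}
    (hp : 0 < hgt p) : Injective (fderiv ℝ (φ z) p) := by
  have := hφ.immersion z p (hgt_pos_subset hp)
  rwa [fderivWithin_of_mem_nhds (upperHalfSpace3_mem_nhds hp)] at this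

theorem isOpen_image (hφ : IsProperSmoothEmbedding upperHalfSpace3 φ) (z : Z) {V : Set E3}
    (hV : IsOpen V) (hVp : V ⊆ {p | 0 < hgt p}) : IsOpen (φ z '' V) :=
  (isOpen_image_and_exists_smooth_inverse isOpen_hgt_pos (hφ.contDiffOn_pos z)
    (fun _ hx _ hx' h => (hφ.eq_of_apply_eq (hgt_pos_subset hx) (hgt_pos_subset hx') h).2)
    (fun _ hx => hφ.injective_fderiv z hx)).1 V hVp hV

theorem comp_diffeomorph (hφ : IsProperSmoothEmbedding upperHalfSpace3 φ) (g : E3 ≃ₘ[ℝ] E3) :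
    IsProperSmoothEmbedding upperHalfSpace3 fun z x => g (φ z x) := by
  have hg : ContDiff ℝ ∞ g := g.contMDiff.contDiff
  have hgs : ContDiff ℝ ∞ g.symm := g.symm.contMDiff.contDiff
  refine ⟨fun z => hg.comp_contDiffOn (hφ.smooth z), fun z x hx => ?_,
    fun p q h => hφ.injective (g.injective h), ?_⟩
  · have h1 : HasFDerivWithinAt (fun x => g (φ z x))
        ((fderiv ℝ g (φ z x)).comp (fderivWithin ℝ (φ z) upperHalfSpace3 x)) upperHalfSpace3 x :=
      ((hg.differentiable (by simp)) _).hasFDerivAt.comp_hasFDerivWithinAt x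
        (((hφ.smooth z).differentiableOn (by simp)) x hx).hasFDerivWithinAt
    rw [h1.fderivWithin (uniqueDiffOn_upperHalfSpace3 x hx)]
    refine Injective.comp (g := fderiv ℝ g (φ z x)) ?_ (hφ.immersion z x hx)
    have h2 : (fderiv ℝ g.symm (g (φ z x))).comp (fderiv ℝ g (φ z x)) =
        ContinuousLinearMap.id ℝ E3 := by
      have h3 := (((hgs.differentiable (by simp)) (g (φ z x))).hasFDerivAt.comp (φ z x)
        ((hg.differentiable (by simp)) (φ z x)).hasFDerivAt)
      have h4 : g.symm ∘ g = id := by ext1 x; simp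
      rw [h4] at h3
      exact h3.unique (hasFDerivAt_id _)
    intro v w hvw
    have := congrArg (fderiv ℝ g.symm (g (φ z x))) hvw
    rwa [← ContinuousLinearMap.comp_apply, ← ContinuousLinearMap.comp_apply, h2] at this
  · exact g.toHomeomorph.isProperMap.comp hφ.proper

theorem comp_equiv {Z' : Type} [TopologicalSpace Z'] [DiscreteTopology Z']
    (hφ : IsProperSmoothEmbedding upperHalfSpace3 φ) (s : Z' ≃ Z) :
    IsProperSmoothEmbedding upperHalfSpace3 fun z => φ (s z) := by
  refine ⟨fun z => hφ.smooth _, fun z => hφ.immersion _, fun p q h => ?_, ?_⟩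
  · have := @hφ.injective (s p.1, p.2) (s q.1, q.2) h
    simp only [Prod.mk.injEq, EmbeddingLike.apply_eq_iff_eq] at this
    exact Prod.ext this.1 this.2
  · let S : Z' ≃ₜ Z := ⟨s, continuous_of_discreteTopology, continuous_of_discreteTopology⟩
    exact hφ.proper.comp (S.prodCongr (Homeomorph.refl upperHalfSpace3)).isProperMap

/-- The mean value inequality on a convex half-ball. A two-point estimate is needed because strict
differentiability is the input of the inverse function theorem. -/
theorem strict_estimate (hφ : IsProperSmoothEmbedding upperHalfSpace3 φ) (z : Z) {p : E3}
    (hp : p ∈ upperHalfSpace3) {c : ℝ} (hc : 0 < c) :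
    ∃ r > 0, ∀ x ∈ upperHalfSpace3, ∀ y ∈ upperHalfSpace3, ‖x - p‖ < r → ‖y - p‖ < r →
      ‖φ z x - φ z y - fderivWithin ℝ (φ z) upperHalfSpace3 p (x - y)‖ ≤ c * ‖x - y‖ := by
  have hcont : ContinuousOn (fderivWithin ℝ (φ z) upperHalfSpace3) upperHalfSpace3 :=
    (hφ.smooth z).continuousOn_fderivWithin uniqueDiffOn_upperHalfSpace3 (by simp)
  obtain ⟨r, hr, h⟩ := Metric.continuousOn_iff.1 hcont p hp c hc
  refine ⟨r, hr, fun x hx y hy hxr hyr => ?_⟩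
  have hconv : Convex ℝ (upperHalfSpace3 ∩ Metric.ball p r) :=
    convex_upperHalfSpace3.inter (convex_ball p r)
  refine hconv.norm_image_sub_le_of_norm_hasFDerivWithin_le'
    (f' := fderivWithin ℝ (φ z) upperHalfSpace3) (fun q hq => ?_) (fun q hq => ?_)
    ⟨hy, by rwa [mem_ball_iff_norm]⟩ ⟨hx, by rwa [mem_ball_iff_norm]⟩
  · exact (((hφ.smooth z).differentiableOn (by simp)) q hq.1).hasFDerivWithinAt.mono
      inter_subset_left
  · rw [← dist_eq_norm]
    exact (h q hq.1 hq.2).le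

open Classical in
/-- The extension of `φ z` across the boundary of the half-space by odd reflection. -/
noncomputable def _root_.reflectExtend (f : E3 → E3) (p : E3) : E3 :=
  if 0 ≤ hgt p then f p else (2 : ℝ) • f (flat p) - f (flat p - hgt p • vert)

/-- Odd reflection matches values and first derivatives across the plane. That suffices for strict
differentiability at boundary points, although higher derivatives need not match. -/
theorem hasStrictFDerivAt_reflectExtend (hφ : IsProperSmoothEmbedding upperHalfSpace3 φ) (z : Z)
    {p : E3} (hp : hgt p = 0) : HasStrictFDerivAt (reflectExtend (φ z))
      (fderivWithin ℝ (φ z) upperHalfSpace3 p) p := by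
  set L := fderivWithin ℝ (φ z) upperHalfSpace3 p
  have hpH : p ∈ upperHalfSpace3 := by rw [upperHalfSpace3_eq]; exact hp.ge
  refine .of_isLittleO ?_
  rw [Asymptotics.isLittleO_iff]
  intro c hc
  -- A fifth of `c` leaves room for the three increments into which each difference is split below.
  obtain ⟨r, hr, hest⟩ := hφ.strict_estimate z hpH (c := c / 5) (by positivity)
  have hball : ∀ᶠ q : E3 × E3 in 𝓝 (p, p), ‖q.1 - p‖ < r ∧ ‖q.2 - p‖ < r := by
    have h1 : ∀ᶠ q : E3 in 𝓝 p, ‖q - p‖ < r := by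
      filter_upwards [Metric.ball_mem_nhds p hr] with q hq
      rwa [← dist_eq_norm]
    exact ((continuous_fst.tendsto (p, p)).eventually h1).and
      ((continuous_snd.tendsto (p, p)).eventually h1)
  have hfp : flat p = p := flat_eq_self hp
  -- the points used in the reflection stay in the half-ball
  have hfl : ∀ q, ‖q - p‖ < r → ‖flat q - p‖ < r := fun q hq => by
    refine lt_of_le_of_lt ?_ hq
    have := norm_flat_le (q - p)
    rwa [map_sub, hfp] at this
  have hre : ∀ q, ‖q - p‖ < r → ‖flat q - hgt q • vert - p‖ < r := fun q hq => by
    have h1 : ‖flat q - hgt q • vert - p‖ ^ 2 = ‖q - p‖ ^ 2 := by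
      rw [norm_sq_flat_add_hgt, norm_sq_flat_add_hgt (q - p)]
      simp [hfp, hp]
    have h2 := norm_nonneg (q - p)
    have h3 := norm_nonneg (flat q - hgt q • vert - p)
    have : ‖flat q - hgt q • vert - p‖ = ‖q - p‖ := (sq_eq_sq₀ h3 h2).1 h1
    rwa [this]
  have hreH : ∀ q, hgt q ≤ 0 → flat q - hgt q • vert ∈ upperHalfSpace3 := fun q hq => by
    rw [upperHalfSpace3_eq]; simpa using hq
  have hnf : ∀ q : E3, ‖flat q - hgt q • vert - flat q‖ = |hgt q| := fun q => by
    simp [norm_smul]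
  -- estimate for a pair on opposite sides
  have hcross : ∀ x y, ‖x - p‖ < r → ‖y - p‖ < r → 0 ≤ hgt x → hgt y < 0 →
      ‖φ z x - ((2 : ℝ) • φ z (flat y) - φ z (flat y - hgt y • vert)) - L (x - y)‖ ≤
        c * ‖x - y‖ := by
    intro x y hx hy hx0 hy0
    have e1 := hest x hx0 (flat x) (flat_mem x) hx (hfl x hx)
    have e2 := hest (flat x) (flat_mem x) (flat y) (flat_mem y) (hfl x hx) (hfl y hy)
    have e3 := hest (flat y - hgt y • vert) (hreH y hy0.le) (flat y) (flat_mem y) (hre y hy)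
      (hfl y hy)
    have k1 : ‖x - flat x‖ ≤ ‖x - y‖ := by
      have : x - flat x = hgt x • vert := by rw [flat_apply]; abel
      rw [this, norm_smul, norm_vert, mul_one, Real.norm_eq_abs, abs_of_nonneg hx0]
      have := abs_hgt_le (x - y)
      rw [map_sub] at this
      linarith [le_abs_self (hgt x - hgt y)]
    have k2 : ‖flat x - flat y‖ ≤ ‖x - y‖ := by
      rw [← map_sub]; exact norm_flat_le _
    have k3 : ‖flat y - hgt y • vert - flat y‖ ≤ ‖x - y‖ := by
      rw [hnf, abs_of_neg hy0]
      have := abs_hgt_le (x - y)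
      rw [map_sub] at this
      linarith [le_abs_self (hgt x - hgt y)]
    have hsum : φ z x - ((2 : ℝ) • φ z (flat y) - φ z (flat y - hgt y • vert)) - L (x - y) =
        (φ z x - φ z (flat x) - L (x - flat x)) +
        (φ z (flat x) - φ z (flat y) - L (flat x - flat y)) +
        (φ z (flat y - hgt y • vert) - φ z (flat y) - L (flat y - hgt y • vert - flat y)) := by
      have : L (x - y) = L (x - flat x) + L (flat x - flat y) +
          L (flat y - hgt y • vert - flat y) := by
        rw [← map_add, ← map_add]
        congr 1
        nth_rewrite 3 [flat_apply y]
        rw [flat_apply y]; abel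
      rw [this, two_smul]; abel
    rw [hsum]
    refine (norm_add₃_le).trans ?_
    have h0 := norm_nonneg (x - y)
    have m1 := mul_le_mul_of_nonneg_left k1 (show 0 ≤ c / 5 by positivity)
    have m2 := mul_le_mul_of_nonneg_left k2 (show 0 ≤ c / 5 by positivity)
    have m3 := mul_le_mul_of_nonneg_left k3 (show 0 ≤ c / 5 by positivity)
    nlinarith
  filter_upwards [hball]
  rintro ⟨x, y⟩ ⟨hx, hy⟩
  simp only at hx hy ⊢
  rcases le_or_gt 0 (hgt x) with hx0 | hx0 <;> rcases le_or_gt 0 (hgt y) with hy0 | hy0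
  · rw [reflectExtend, if_pos hx0, reflectExtend, if_pos hy0]
    refine (hest x hx0 y hy0 hx hy).trans ?_
    gcongr
    linarith
  · rw [reflectExtend, if_pos hx0, reflectExtend, if_neg hy0.not_ge]
    exact hcross x y hx hy hx0 hy0
  · rw [reflectExtend, if_neg hx0.not_ge, reflectExtend, if_pos hy0]
    have := hcross y x hy hx hy0 hx0
    rw [norm_sub_rev x y]
    refine le_of_eq_of_le ?_ this
    rw [← norm_neg, ← neg_sub y x, map_neg]
    congr 1
    abel
  · rw [reflectExtend, if_neg hx0.not_ge, reflectExtend, if_neg hy0.not_ge]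
    have e1 := hest (flat x) (flat_mem x) (flat y) (flat_mem y) (hfl x hx) (hfl y hy)
    have e2 := hest (flat x - hgt x • vert) (hreH x hx0.le) (flat y - hgt y • vert)
      (hreH y hy0.le) (hre x hx) (hre y hy)
    have k1 : ‖flat x - flat y‖ ≤ ‖x - y‖ := by
      rw [← map_sub]; exact norm_flat_le _
    have k2 : ‖flat x - hgt x • vert - (flat y - hgt y • vert)‖ ≤ ‖x - y‖ := by
      have h1 : ‖flat x - hgt x • vert - (flat y - hgt y • vert)‖ ^ 2 = ‖x - y‖ ^ 2 := by
        rw [norm_sq_flat_add_hgt, norm_sq_flat_add_hgt (x - y)]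
        simp only [map_sub, map_smul, flat_flat, flat_vert, hgt_flat, hgt_vert, smul_zero,
          sub_zero, smul_eq_mul, mul_one]
        ring
      exact ((sq_eq_sq₀ (norm_nonneg _) (norm_nonneg _)).1 h1).le
    have hsum : (2 : ℝ) • φ z (flat x) - φ z (flat x - hgt x • vert) -
        ((2 : ℝ) • φ z (flat y) - φ z (flat y - hgt y • vert)) - L (x - y) =
        (φ z (flat x) - φ z (flat y) - L (flat x - flat y)) +
        (φ z (flat x) - φ z (flat y) - L (flat x - flat y)) -
        (φ z (flat x - hgt x • vert) - φ z (flat y - hgt y • vert) -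
          L (flat x - hgt x • vert - (flat y - hgt y • vert))) := by
      have : L (x - y) = L (flat x - flat y) + L (flat x - flat y) -
          L (flat x - hgt x • vert - (flat y - hgt y • vert)) := by
        rw [← map_add, ← map_sub]
        congr 1
        nth_rewrite 1 [← flat_add_hgt x]
        nth_rewrite 1 [← flat_add_hgt y]
        abel
      rw [this, two_smul, two_smul]; abel
    rw [hsum]
    refine (norm_sub_le _ _).trans ((add_le_add_left (norm_add_le _ _) _).trans ?_)
    have h0 := norm_nonneg (x - y)
    have m1 := mul_le_mul_of_nonneg_left k1 (show 0 ≤ c / 5 by positivity)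
    have m2 := mul_le_mul_of_nonneg_left k2 (show 0 ≤ c / 5 by positivity)
    nlinarith

/-- Near a boundary point, `φ z` is the restriction of a local homeomorphism whose inverse is
strictly differentiable. -/
theorem exists_boundary_chart (hφ : IsProperSmoothEmbedding upperHalfSpace3 φ) (z : Z) {p : E3}
    (hp : hgt p = 0) : ∃ (e : OpenPartialHomeomorph E3 E3) (L : E3 ≃L[ℝ] E3), p ∈ e.source ∧
      (∀ x ∈ upperHalfSpace3, e x = φ z x) ∧
      (L : E3 →L[ℝ] E3) = fderivWithin ℝ (φ z) upperHalfSpace3 p ∧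
      HasStrictFDerivAt e.symm (L.symm : E3 →L[ℝ] E3) (φ z p) := by
  have hpH : p ∈ upperHalfSpace3 := by rw [upperHalfSpace3_eq]; exact hp.ge
  obtain ⟨L, hL⟩ := exists_equiv_of_injective _ (hφ.immersion z p hpH)
  have h := hφ.hasStrictFDerivAt_reflectExtend z hp
  rw [← hL] at h
  have hx : ∀ x ∈ upperHalfSpace3, reflectExtend (φ z) x = φ z x := fun x hx => if_pos hx
  refine ⟨h.toOpenPartialHomeomorph _, L, h.mem_toOpenPartialHomeomorph_source, hx, hL, ?_⟩
  have := h.to_localInverse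
  rw [hx p hpH] at this
  exact this

end IsProperSmoothEmbedding

/-! ### Interior and frontier of the image, and inward directions -/

namespace IsProperSmoothEmbedding

variable {Z : Type} [TopologicalSpace Z] [DiscreteTopology Z] {φ : Z → E3 → E3}

/-- An invariance of the boundary, obtained from the local extension `exists_boundary_chart`. If a
boundary point were interior, the extended chart would put points with parameter just below the
plane into the image, contradicting its injectivity. -/
theorem interior_iUnion_image (hφ : IsProperSmoothEmbedding upperHalfSpace3 φ) :
    interior (⋃ z, φ z '' upperHalfSpace3) = ⋃ z, φ z '' {p | 0 < hgt p} := by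
  refine Subset.antisymm ?_ (interior_maximal (iUnion_mono fun z => image_mono hgt_pos_subset)
    (isOpen_iUnion fun z => hφ.isOpen_image z isOpen_hgt_pos subset_rfl))
  intro y hy
  obtain ⟨z, p, hpH, rfl⟩ := mem_iUnion.1 (interior_subset hy)
  rcases (show 0 ≤ hgt p from hpH).eq_or_lt with hp | hp
  · exfalso
    obtain ⟨e, L, hpe, he, -, -⟩ := hφ.exists_boundary_chart z hp.symm
    have hc : Tendsto (fun s : ℝ => p - s • vert) (𝓝[>] 0) (𝓝 p) := by
      have : Continuous (fun s : ℝ => p - s • vert) := by fun_prop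
      have := (this.tendsto 0).mono_left (nhdsWithin_le_nhds (s := Ioi 0))
      simpa using this
    have hec : Tendsto e (𝓝 p) (𝓝 (φ z p)) := by
      have := e.continuousAt hpe
      rwa [ContinuousAt, he p hpH] at this
    have h1 := hc.eventually (e.open_source.mem_nhds hpe)
    have h2 := (hec.comp hc).eventually (mem_interior_iff_mem_nhds.1 hy)
    have h3 := (hec.comp hc).eventually (hφ.eventually_mem (z := z) hpH
      (e.open_source.mem_nhds hpe))
    obtain ⟨s, hs1, hs2, hs3, hs⟩ := (h1.and (h2.and (h3.and self_mem_nhdsWithin))).exists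
    obtain ⟨z', x', hx', hzx⟩ := mem_iUnion.1 hs2
    obtain ⟨rfl, hx's⟩ := hs3 z' x' hx' hzx
    have h4 : x' = p - s • vert := by
      refine e.injOn hx's hs1 ?_
      rw [he x' hx']; exact hzx
    have h5 : 0 ≤ hgt x' := hx'
    rw [h4] at h5
    have hs' : 0 < s := hs
    simp only [map_sub, map_smul, hgt_vert, smul_eq_mul, mul_one] at h5
    linarith
  · exact mem_iUnion.2 ⟨z, p, hp, rfl⟩

theorem isClosed_range (hφ : IsProperSmoothEmbedding upperHalfSpace3 φ) :
    IsClosed (⋃ z, φ z '' upperHalfSpace3) :=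
  hφ.isClosed_iUnion_image (fun _ => isClosed_upperHalfSpace3) fun _ => subset_rfl

theorem boundary_subset : {p : E3 | hgt p = 0} ⊆ upperHalfSpace3 := fun p hp =>
  show 0 ≤ hgt p from (show hgt p = 0 from hp).ge

theorem isClosed_boundary (hφ : IsProperSmoothEmbedding upperHalfSpace3 φ) :
    IsClosed (⋃ z, φ z '' {p | hgt p = 0}) :=
  hφ.isClosed_iUnion_image (fun _ => isClosed_eq hgt.continuous continuous_const)
    fun _ => boundary_subset

theorem frontier_iUnion_image (hφ : IsProperSmoothEmbedding upperHalfSpace3 φ) :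
    frontier (⋃ z, φ z '' upperHalfSpace3) = ⋃ z, φ z '' {p | hgt p = 0} := by
  rw [hφ.isClosed_range.frontier_eq, hφ.interior_iUnion_image]
  ext y
  constructor
  · rintro ⟨h1, h2⟩
    obtain ⟨z, p, hp, rfl⟩ := mem_iUnion.1 h1
    refine mem_iUnion.2 ⟨z, p, ?_, rfl⟩
    by_contra h
    exact h2 (mem_iUnion.2 ⟨z, p, lt_of_le_of_ne hp (Ne.symm h), rfl⟩)
  · intro h
    obtain ⟨z, p, hp, rfl⟩ := mem_iUnion.1 h
    refine ⟨mem_iUnion.2 ⟨z, p, boundary_subset hp, rfl⟩, fun h' => ?_⟩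
    obtain ⟨z', p', hp', h''⟩ := mem_iUnion.1 h'
    obtain ⟨-, rfl⟩ := hφ.eq_of_apply_eq (hgt_pos_subset hp') (boundary_subset hp) h''
    exact (ne_of_gt hp') hp

theorem _root_.exists_pos_forall_of_eventually_nhds_prod {E : Type*} [TopologicalSpace E]
    {R : ℝ → E → Prop} {q₀ : E} (h : ∀ᶠ x : ℝ × E in 𝓝 (0, q₀), R x.1 x.2) :
    ∃ c > (0 : ℝ), ∀ᶠ q in 𝓝 q₀, ∀ s : ℝ, 0 < s → s ≤ c → R s q := by
  rw [nhds_prod_eq, eventually_prod_iff] at h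
  obtain ⟨pa, ha, pb, hb, hab⟩ := h
  obtain ⟨r, hr, har⟩ := Metric.eventually_nhds_iff.1 ha
  refine ⟨r / 2, by positivity, hb.mono fun q hq s hs hsr => hab (har ?_) hq⟩
  rw [dist_zero_right, Real.norm_eq_abs, abs_of_pos hs]; linarith

/-- A vector which points from a boundary point into the half-space moves it inside. -/
theorem eventually_exists_add_smul (hφ : IsProperSmoothEmbedding upperHalfSpace3 φ) (z : Z)
    {p₀ u : E3} (hp₀ : hgt p₀ = 0) (hu : 0 < hgt u) {w : E3 → E3} (hw : Continuous w)
    (hwu : fderivWithin ℝ (φ z) upperHalfSpace3 p₀ u = w (φ z p₀)) {V : Set E3}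
    (hV : V ∈ 𝓝 p₀) :
    ∃ c > (0 : ℝ), ∀ᶠ q in 𝓝 (φ z p₀), ∀ s : ℝ, 0 < s → s ≤ c → (∃ p, hgt p = 0 ∧ φ z p = q) →
      ∃ y ∈ V, 0 < hgt y ∧ φ z y = q + s • w q := by
  have hpH : p₀ ∈ upperHalfSpace3 := boundary_subset hp₀
  obtain ⟨e, L, hpe, he, hL, hes⟩ := hφ.exists_boundary_chart z hp₀
  set q₀ := φ z p₀
  let ℓ : E3 →L[ℝ] ℝ := hgt.comp (L.symm : E3 →L[ℝ] E3)
  have hh : HasStrictFDerivAt (fun q => hgt (e.symm q)) ℓ q₀ := hgt.hasStrictFDerivAt.comp q₀ hes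
  have hα : ℓ (w q₀) = hgt u := by
    rw [← hwu, ← hL]; simp [ℓ]
  set α := hgt u
  set K := ‖w q₀‖ + 1
  have hK : 0 < K := by positivity
  have hq₀ : e p₀ = q₀ := he p₀ hpH
  have hq₀t : q₀ ∈ e.target := hq₀ ▸ e.map_source hpe
  have hsq₀ : e.symm q₀ = p₀ := by rw [← hq₀]; exact e.left_inv hpe
  have hmap : Tendsto (fun x : ℝ × E3 => x.2 + x.1 • w x.2) (𝓝 (0, q₀)) (𝓝 q₀) := by
    have : Continuous (fun x : ℝ × E3 => x.2 + x.1 • w x.2) := by fun_prop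
    simpa using this.tendsto (0, q₀)
  have hsnd : Tendsto (fun x : ℝ × E3 => x.2) (𝓝 (0, q₀)) (𝓝 q₀) := continuous_snd.tendsto _
  -- With this constant the linearization error is at most `s * α / 4`, while the linear term
  -- exceeds `s * α / 2`; the height therefore becomes positive.
  have hlit := (Asymptotics.isLittleO_iff.1 hh.isLittleO) (show 0 < α / (4 * K) by positivity)
  have h1 := (hmap.prodMk_nhds hsnd).eventually hlit
  have h2 := hmap.eventually (e.open_target.mem_nhds hq₀t)
  have h3 : ∀ᶠ x : ℝ × E3 in 𝓝 (0, q₀), e.symm (x.2 + x.1 • w x.2) ∈ V := by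
    have := e.continuousAt_symm hq₀t
    rw [ContinuousAt, hsq₀] at this
    exact (this.comp hmap).eventually hV
  have h4 := hsnd.eventually (hφ.eventually_mem (z := z) hpH (e.open_source.mem_nhds hpe))
  have h5 : ∀ᶠ x : ℝ × E3 in 𝓝 (0, q₀), ‖w x.2‖ < K :=
    ((hw.norm.tendsto q₀).comp hsnd).eventually (Iio_mem_nhds (by simp [K]))
  have h6 : ∀ᶠ x : ℝ × E3 in 𝓝 (0, q₀), α / 2 < ℓ (w x.2) :=
    (((ℓ.continuous.comp hw).tendsto q₀).comp hsnd).eventually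
      (Ioi_mem_nhds (by simp only [comp_apply, hα]; linarith))
  refine exists_pos_forall_of_eventually_nhds_prod
    (R := fun s q => 0 < s → (∃ p, hgt p = 0 ∧ φ z p = q) →
      ∃ y ∈ V, 0 < hgt y ∧ φ z y = q + s • w q) ?_ |>.imp fun c hc =>
        ⟨hc.1, hc.2.mono fun q hq s hs hsc => hq s hs hsc hs⟩
  filter_upwards [h1, h2, h3, h4, h5, h6]
  rintro ⟨s, q⟩ h1 h2 h3 h4 h5 h6 hs ⟨p, hp, hpq⟩
  simp only at h1 h2 h3 h4 h5 h6 hs hpq ⊢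
  have hp' := (h4 z p (boundary_subset hp) hpq).2
  have hsq : e.symm q = p := by
    rw [← hpq, ← he p (boundary_subset hp)]; exact e.left_inv hp'
  rw [hsq, hp, add_sub_cancel_left, map_smul, smul_eq_mul, norm_smul, sub_zero, Real.norm_eq_abs,
    Real.norm_eq_abs, abs_of_pos hs] at h1
  have hpos : 0 < hgt (e.symm (q + s • w q)) := by
    have h7 := (abs_le.1 h1).1
    have h8 : α / (4 * K) * (s * ‖w q‖) ≤ s * (α / 4) := by
      calc _ ≤ α / (4 * K) * (s * K) := by gcongr
        _ = _ := by field_simp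
    have h9 : s * (α / 2) < s * ℓ (w q) := mul_lt_mul_of_pos_left h6 hs
    have : 0 < s * (α / 4) := by positivity
    linarith
  refine ⟨_, h3, hpos, ?_⟩
  rw [← he _ (hgt_pos_subset hpos), e.right_inv h2]

theorem continuousOn_fderivWithin (hφ : IsProperSmoothEmbedding upperHalfSpace3 φ) (z : Z) :
    ContinuousOn (fderivWithin ℝ (φ z) upperHalfSpace3) upperHalfSpace3 :=
  (hφ.smooth z).continuousOn_fderivWithin uniqueDiffOn_upperHalfSpace3 (by simp)

end IsProperSmoothEmbedding

/-! ### Pushing half-spaces inward onto regions above graphs -/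

/-- If `A ∘ M = T` with `A` close to an invertible `A₀` and `T` close to `A₀ ∘ flat`, then `M` is
close to `flat`. -/
theorem exists_norm_sub_flat_le (A₀ : E3 ≃L[ℝ] E3) : ∃ r > 0, ∀ A M T : E3 →L[ℝ] E3,
    ‖A - A₀‖ < r → ‖T - (A₀ : E3 →L[ℝ] E3).comp flat‖ < r → A.comp M = T → ‖M - flat‖ ≤ 1 / 2 := by
  set β := ‖(A₀.symm : E3 →L[ℝ] E3)‖
  have hβ : 0 ≤ β := norm_nonneg _
  -- Since `β * r ≤ 1 / 6`, the implicit estimate `h2` gives `x ≤ 1 / 3 + x / 6` for `x = ‖M -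
  -- flat‖`.
  refine ⟨1 / (6 * (β + 1)), by positivity, fun A M T hA hT h => ?_⟩
  set r := 1 / (6 * (β + 1))
  have hr : β * r ≤ 1 / 6 := by
    simp only [r]
    rw [mul_one_div, div_le_div_iff₀ (by positivity) (by positivity)]; linarith
  have h1 : M - flat = (A₀.symm : E3 →L[ℝ] E3).comp
      ((T - (A₀ : E3 →L[ℝ] E3).comp flat) - (A - A₀).comp (M - flat) - (A - A₀).comp flat) := by
    rw [← h]
    ext1 v
    simp
    abel
  have hfl : ‖flat‖ ≤ 1 := ContinuousLinearMap.opNorm_le_bound _ zero_le_one fun v => by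
    rw [one_mul]; exact norm_flat_le v
  have hm := norm_nonneg (M - flat)
  have hr0 : 0 < r := by positivity
  have h2 : ‖M - flat‖ ≤ β * (r + r * ‖M - flat‖ + r * 1) := by
    conv_lhs => rw [h1]
    refine (ContinuousLinearMap.opNorm_comp_le _ _).trans ?_
    refine mul_le_mul_of_nonneg_left ?_ hβ
    refine (norm_sub_le _ _).trans (add_le_add ((norm_sub_le _ _).trans (add_le_add hT.le ?_)) ?_)
    · exact (ContinuousLinearMap.opNorm_comp_le _ _).trans (by gcongr)
    · exact (ContinuousLinearMap.opNorm_comp_le _ _).trans (by gcongr)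
  nlinarith

/-- A surface `K`, parametrized by the horizontal plane, which is close to the plane is the graph of
a positive function. -/
theorem exists_graph {K : E3 → E3} (hK : ContDiff ℝ ∞ K) (hKf : ∀ p, K (flat p) = K p)
    (hd : ∀ p, ‖fderiv ℝ K p - flat‖ ≤ 1 / 2) :
    ∃ (k k' : E3 → E3) (σ : E3 → ℝ), ContDiff ℝ ∞ k ∧ ContDiff ℝ ∞ k' ∧ ContDiff ℝ ∞ σ ∧
      (∀ p, k' (k p) = p) ∧ (∀ p, k (k' p) = p) ∧ (∀ p, flat (k p) = k (flat p)) ∧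
      (∀ p, flat (k' p) = k' (flat p)) ∧
      (∀ p, hgt (k p) = hgt p) ∧ (∀ p, σ (flat p) = σ p) ∧ (∀ p, σ p = hgt (K (k' p))) ∧
      ∀ p, K p = flat (k p) + σ (k p) • vert := by
  have hfl : ‖flat‖ ≤ 1 := ContinuousLinearMap.opNorm_le_bound _ zero_le_one fun v => by
    rw [one_mul]; exact norm_flat_le v
  have hKd := hK.differentiable (by simp)
  -- Moving `p` by `w p` puts it vertically in line with `K p`. This is a diffeomorphism `k`, and
  -- the height of `K` read through its inverse is the function whose graph is the surface.
  let w : E3 → E3 := fun p => flat (K p - p)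
  have hw : ContDiff ℝ ∞ w := flat.contDiff.comp (hK.sub contDiff_id)
  have hwd : ∀ p, ‖fderiv ℝ w p‖ ≤ 1 / 2 := by
    intro p
    have h1 : HasFDerivAt w (flat.comp (fderiv ℝ K p - ContinuousLinearMap.id ℝ E3)) p :=
      flat.hasFDerivAt.comp p ((hKd p).hasFDerivAt.sub (hasFDerivAt_id p))
    have h2 : flat.comp (fderiv ℝ K p - ContinuousLinearMap.id ℝ E3) =
        flat.comp (fderiv ℝ K p - flat) := by
      ext1 v; simp
    rw [h1.fderiv, h2]
    calc _ ≤ ‖flat‖ * ‖fderiv ℝ K p - flat‖ := ContinuousLinearMap.opNorm_comp_le _ _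
      _ ≤ 1 * (1 / 2) := by gcongr; exact hd p
      _ = _ := one_mul _
  have hiso := IsotopicToIdRel.id_add hw hwd
  obtain ⟨k', hk', hk'k, hkk'⟩ := hiso.exists_inverse
  set k : E3 → E3 := fun x => x + w x with hkdef
  have hkf : ∀ p, flat (k p) = flat (K p) := fun p => by simp [hkdef, w]
  have hkc : ∀ p, flat (k p) = k (flat p) := fun p => by
    rw [hkf]; simp [hkdef, w, hKf]
  have hk'c : ∀ p, flat (k' p) = k' (flat p) := fun p => by
    conv_rhs => rw [← hkk' p, hkc, hk'k]
  refine ⟨k, k', fun p => hgt (K (k' p)), hiso.contDiff, hk'.contDiff,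
    hgt.contDiff.comp (hK.comp hk'.contDiff), hk'k, hkk', hkc, hk'c, fun p => ?_, fun p => ?_,
    fun p => rfl, fun p => ?_⟩
  · simp [hkdef, w]
  · simp only; rw [← hk'c, hKf]
  · change K p = flat (k p) + hgt (K (k' (k p))) • vert
    rw [show k' (k p) = p from hk'k p, hkf, flat_add_hgt]

theorem norm_flat_clm_le : ‖flat‖ ≤ 1 :=
  ContinuousLinearMap.opNorm_le_bound _ zero_le_one fun v => by
    rw [one_mul]; exact norm_flat_le v

/-- A connected set which misses the frontier of `Y` and meets `Y` lies in `Y`. -/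
theorem IsPreconnected.subset_of_disjoint_of_isClosed {X : Type*} [TopologicalSpace X]
    {S Y G : Set X} (hS : IsPreconnected S) (hY : IsOpen Y) (hYG : IsClosed (Y ∪ G))
    (hSG : ∀ x ∈ S, x ∉ G) (hSY : (S ∩ Y).Nonempty) : S ⊆ Y := by
  refine hS.subset_left_of_subset_union hY hYG.isOpen_compl ?_ ?_ hSY
  · exact disjoint_left.2 fun x hx hx' => hx' (Or.inl hx)
  · intro x hx
    by_cases h : x ∈ Y
    · exact Or.inl h
    · exact Or.inr fun h' => h'.elim h (hSG x hx)

theorem isPreconnected_above_graph {σ : E3 → ℝ} (hσ : Continuous σ)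
    (hσf : ∀ p, σ (flat p) = σ p) : IsPreconnected {p | σ p < hgt p} := by
  have h1 : IsPreconnected {p : E3 | 0 < hgt p} :=
    (convex_halfSpace_gt hgt.isLinear 0).isPreconnected
  have h2 := h1.image (fun p => p + σ p • vert) (by fun_prop)
  have hs : ∀ p (c : ℝ), σ (p + c • vert) = σ p := fun p c => by
    rw [← hσf, ← hσf p]; simp
  convert h2
  ext p
  constructor
  · intro hp
    refine ⟨p - σ p • vert, ?_, ?_⟩
    · have : σ p < hgt p := hp
      simpa using this
    · have := hs p (-σ p)
      rw [neg_smul, ← sub_eq_add_neg] at this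
      simp [this]
  · rintro ⟨q, hq, rfl⟩
    have : 0 < hgt q := hq
    simpa [hs] using this

namespace IsProperSmoothEmbedding

variable {Z : Type} [TopologicalSpace Z] [DiscreteTopology Z] {φ : Z → E3 → E3}

/-- Smooth maps into the image of the interior of the half-space lift. -/
theorem exists_lift (hφ : IsProperSmoothEmbedding upperHalfSpace3 φ) (z : Z) {ψ : E3 → E3}
    (hψ : ContDiff ℝ ∞ ψ) (h : ∀ p, ∃ y, 0 < hgt y ∧ φ z y = ψ p) :
    ∃ K : E3 → E3, ContDiff ℝ ∞ K ∧ ∀ p, 0 < hgt (K p) ∧ φ z (K p) = ψ p ∧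
      (fderiv ℝ (φ z) (K p)).comp (fderiv ℝ K p) = fderiv ℝ ψ p := by
  obtain ⟨hop, g, hg, hgφ⟩ := isOpen_image_and_exists_smooth_inverse isOpen_hgt_pos
    (hφ.contDiffOn_pos z)
    (fun _ hx _ hx' h => (hφ.eq_of_apply_eq (hgt_pos_subset hx) (hgt_pos_subset hx') h).2)
    (fun _ hx => hφ.injective_fderiv z hx)
  have hKs : ContDiff ℝ ∞ fun p => g (ψ p) := by
    refine hg.comp_contDiff hψ fun p => ?_
    obtain ⟨y, hy, hyp⟩ := h p
    exact ⟨y, hy, hyp⟩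
  have hK : ∀ p, 0 < hgt (g (ψ p)) ∧ φ z (g (ψ p)) = ψ p := fun p => by
    obtain ⟨y, hy, hyp⟩ := h p
    rw [← hyp, hgφ y hy]; exact ⟨hy, rfl⟩
  refine ⟨fun p => g (ψ p), hKs, fun p => ⟨(hK p).1, (hK p).2, ?_⟩⟩
  have h1 : HasFDerivAt (fun p => φ z (g (ψ p)))
      ((fderiv ℝ (φ z) (g (ψ p))).comp (fderiv ℝ (fun p => g (ψ p)) p)) p :=
    HasFDerivAt.comp (g := φ z) p
      ((((hφ.contDiffOn_pos z).contDiffAt (isOpen_hgt_pos.mem_nhds (hK p).1)).differentiableAt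
        (by simp)).hasFDerivAt) ((hKs.differentiable (by simp)) p).hasFDerivAt
  rw [← h1.fderiv]
  congr 1
  exact funext fun p => (hK p).2

theorem contDiff_comp_flat (hφ : IsProperSmoothEmbedding upperHalfSpace3 φ) (z : Z) :
    ContDiff ℝ ∞ fun p => φ z (flat p) :=
  (hφ.smooth z).comp_contDiff flat.contDiff flat_mem

theorem hasFDerivAt_comp_flat (hφ : IsProperSmoothEmbedding upperHalfSpace3 φ) (z : Z) (p : E3) :
    HasFDerivAt (fun p => φ z (flat p))
      ((fderivWithin ℝ (φ z) upperHalfSpace3 (flat p)).comp flat) p :=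
  ((((hφ.smooth z).differentiableOn (by simp)) _ (flat_mem p)).hasFDerivWithinAt).comp_hasFDerivAt
    p flat.hasFDerivAt (Eventually.of_forall flat_mem)

/-- There is a smooth vector field on `ℝ³` which points inwards along the boundary. -/
theorem exists_inward_field (hφ : IsProperSmoothEmbedding upperHalfSpace3 φ) :
    ∃ w : E3 → E3, ContDiff ℝ ∞ w ∧ ∀ z p, hgt p = 0 →
      ∃ u, 0 < hgt u ∧ fderivWithin ℝ (φ z) upperHalfSpace3 p u = w (φ z p) := by
  obtain ⟨w, hw, hwT⟩ := exists_contDiff_forall_mem_of_local (E := E3) (F := E3)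
    (T := fun q => {v | ∀ z p, hgt p = 0 → φ z p = q →
      ∃ u, 0 < hgt u ∧ fderivWithin ℝ (φ z) upperHalfSpace3 p u = v}) (by
      intro q v hv v' hv' r s hr hs hrs z p hp hpq
      obtain ⟨u, hu, rfl⟩ := hv z p hp hpq
      obtain ⟨u', hu', rfl⟩ := hv' z p hp hpq
      refine ⟨r • u + s • u', ?_, by simp⟩
      simp only [map_add, map_smul, smul_eq_mul]
      rcases hr.eq_or_lt with h | h
      · have : s = 1 := by linarith
        rw [← h, this]; linarith
      · have := mul_pos h hu
        have := mul_nonneg hs hu'.le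
        linarith) (by
      intro q
      by_cases hq : q ∈ ⋃ z, φ z '' {p | hgt p = 0}
      · obtain ⟨z, p, hp, rfl⟩ := mem_iUnion.1 hq
        have hpH := boundary_subset hp
        obtain ⟨L, hL⟩ := exists_equiv_of_injective _ (hφ.immersion z p hpH)
        -- A constant vector works locally: at nearby boundary points its preimage under the
        -- derivative is close to `vert`, so still has positive height.
        refine ⟨L vert, ?_⟩
        have hc := hφ.continuousOn_fderivWithin z p hpH
        have h1 : ∀ᶠ B in 𝓝 (L : E3 →L[ℝ] E3), ∃ u, 0 < hgt u ∧ B u = L vert := by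
          have hi : ContinuousAt (ContinuousLinearMap.inverse : (E3 →L[ℝ] E3) → _)
              (L : E3 →L[ℝ] E3) :=
            (contDiffAt_map_inverse (n := 0) L).continuousAt
          have hi2 : Tendsto (fun B : E3 →L[ℝ] E3 => hgt (B.inverse (L vert)))
              (𝓝 (L : E3 →L[ℝ] E3)) (𝓝 1) := by
            have h3 : ContinuousAt (fun B : E3 →L[ℝ] E3 => hgt (B.inverse (L vert)))
                (L : E3 →L[ℝ] E3) :=
              hgt.continuous.continuousAt.comp (hi.clm_apply continuousAt_const)
            have h4 : hgt ((L : E3 →L[ℝ] E3).inverse (L vert)) = 1 := by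
              rw [ContinuousLinearMap.inverse_equiv]; simp
            rw [ContinuousAt, h4] at h3; exact h3
          filter_upwards [hi2.eventually (lt_mem_nhds one_pos), L.nhds] with B hB hB'
          obtain ⟨B', rfl⟩ := hB'
          refine ⟨_, hB, ?_⟩
          rw [ContinuousLinearMap.inverse_equiv]; simp
        rw [ContinuousWithinAt, ← hL] at hc
        have h2 := hc.eventually h1
        rw [eventually_nhdsWithin_iff] at h2
        filter_upwards [hφ.eventually_mem hpH h2] with q hq z' p' hp' hpq
        obtain ⟨rfl, h5⟩ := hq z' p' (boundary_subset hp') hpq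
        exact h5 (boundary_subset hp')
      · refine ⟨0, ?_⟩
        filter_upwards [hφ.isClosed_boundary.isOpen_compl.mem_nhds hq] with y hy z p hp hpy
        exact (hy (mem_iUnion.2 ⟨z, p, hp, hpy⟩)).elim)
  exact ⟨w, hw, fun z p hp => hwT _ z p hp rfl⟩

/-- The smallness used by `exists_push`. Here `κ` will bound `‖v‖` plus the norm of its derivative,
so `c * κ` bounds the derivative of `ε • v`. The condition on `M` makes the pushed boundary, lifted
to the half-space, nearly horizontal and hence a graph. -/
theorem exists_small_displacement (hφ : IsProperSmoothEmbedding upperHalfSpace3 φ) {v : E3 → E3}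
    (hv : Continuous v) (hvin : ∀ z p, hgt p = 0 →
      ∃ u, 0 < hgt u ∧ fderivWithin ℝ (φ z) upperHalfSpace3 p u = v (φ z p))
    {κ : E3 → ℝ} (hκ : Continuous κ) (hκ0 : ∀ q, 0 ≤ κ q) :
    ∃ ε : E3 → ℝ, ContDiff ℝ ∞ ε ∧ ∀ q, 0 < ε q ∧ ∃ c, ε q ≤ c ∧ ‖fderiv ℝ ε q‖ ≤ c ∧
      c * κ q ≤ 1 / 2 ∧ ∀ z p, hgt p = 0 → φ z p = q → ∃ y, 0 < hgt y ∧ hgt y < 1 / 2 ∧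
        φ z y = q + ε q • v q ∧ ∀ B M : E3 →L[ℝ] E3, ‖B‖ ≤ c * κ q →
          (fderiv ℝ (φ z) y).comp M = ((ContinuousLinearMap.id ℝ E3 + B).comp
            (fderivWithin ℝ (φ z) upperHalfSpace3 p)).comp flat → ‖M - flat‖ ≤ 1 / 2 := by
  obtain ⟨ε, hε, hεP⟩ := exists_contDiff_pos_small (E := E3)
    (P := fun q c => c * κ q ≤ 1 / 2 ∧ ∀ s, 0 < s → s ≤ c → ∀ z p, hgt p = 0 → φ z p = q →
      ∃ y, 0 < hgt y ∧ hgt y < 1 / 2 ∧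
        φ z y = q + s • v q ∧ ∀ B M : E3 →L[ℝ] E3, ‖B‖ ≤ c * κ q →
          (fderiv ℝ (φ z) y).comp M = ((ContinuousLinearMap.id ℝ E3 + B).comp
            (fderivWithin ℝ (φ z) upperHalfSpace3 p)).comp flat → ‖M - flat‖ ≤ 1 / 2) (by
      intro q₀
      have hκb : ∀ b > 0, ∃ c > 0, ∀ᶠ q in 𝓝 q₀, ∀ s, 0 < s → s ≤ c → s * κ q < b := by
        intro b hb
        refine ⟨b / (κ q₀ + 1) / 2, by have := hκ0 q₀; positivity, ?_⟩
        filter_upwards [(hκ.tendsto q₀).eventually (gt_mem_nhds (lt_add_one (κ q₀)))] with q hq s hs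
          hsc
        have h0 := hκ0 q₀
        calc s * κ q ≤ b / (κ q₀ + 1) / 2 * (κ q₀ + 1) := by
              have := hκ0 q
              gcongr
          _ = b / 2 := by field_simp
          _ < b := by linarith
      by_cases hq : q₀ ∈ ⋃ z, φ z '' {p | hgt p = 0}
      · obtain ⟨z, p₀, hp₀, rfl⟩ := mem_iUnion.1 hq
        have hpH := boundary_subset hp₀
        obtain ⟨L, hL⟩ := exists_equiv_of_injective _ (hφ.immersion z p₀ hpH)
        obtain ⟨r, hr, hrL⟩ := exists_norm_sub_flat_le L
        have hcA := hφ.continuousOn_fderivWithin z p₀ hpH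
        rw [ContinuousWithinAt, ← hL] at hcA
        set β := ‖(L : E3 →L[ℝ] E3)‖ + r with hβ
        have hβ0 : 0 < β := by positivity
        have hV0 : ∀ᶠ y in 𝓝 p₀, y ∈ upperHalfSpace3 →
            ‖fderivWithin ℝ (φ z) upperHalfSpace3 y - L‖ < r / 2 := by
          rw [← eventually_nhdsWithin_iff]
          filter_upwards [hcA.eventually (Metric.ball_mem_nhds _ (half_pos hr))] with y hy
          rwa [← dist_eq_norm]
        have hV1 : ∀ᶠ y in 𝓝 p₀, hgt y < 1 / 2 :=
          (hgt.continuous.tendsto p₀).eventually (gt_mem_nhds (by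
            rw [show hgt p₀ = 0 from hp₀]; norm_num))
        have hV := hV0.and hV1
        obtain ⟨u, hu, huv⟩ := hvin z p₀ hp₀
        obtain ⟨c₁, hc₁, h₁⟩ := hφ.eventually_exists_add_smul z hp₀ hu hv huv hV
        obtain ⟨c₂, hc₂, h₂⟩ := hκb (1 / 2) (by norm_num)
        obtain ⟨c₃, hc₃, h₃⟩ := hκb (r / (2 * β)) (by positivity)
        refine ⟨min c₁ (min c₂ c₃), by positivity, ?_⟩
        filter_upwards [h₁, h₂, h₃, hφ.eventually_mem hpH hV] with q k₁ k₂ k₃ k₄ c hc hcc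
        have hcc₁ := hcc.trans (min_le_left _ _)
        have hcc₂ := hcc.trans ((min_le_right _ _).trans (min_le_left _ _))
        have hcc₃ := hcc.trans ((min_le_right _ _).trans (min_le_right _ _))
        refine ⟨(k₂ c hc hcc₂).le, fun s hs hsc z' p hp hpq => ?_⟩
        obtain ⟨rfl, hpV⟩ := k₄ z' p (boundary_subset hp) hpq
        obtain ⟨y, hyV, hy, hyq⟩ := k₁ s hs (hsc.trans hcc₁) ⟨p, hp, hpq⟩
        refine ⟨y, hy, hyV.2, hyq, fun B M hB hM => ?_⟩
        have e1 := hyV.1 (hgt_pos_subset hy)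
        rw [fderivWithin_of_mem_nhds (upperHalfSpace3_mem_nhds hy)] at e1
        have e2 := hpV.1 (boundary_subset hp)
        refine hrL _ M _ (by linarith) ?_ hM
        set Ap := fderivWithin ℝ (φ z') upperHalfSpace3 p
        have e3 : ((ContinuousLinearMap.id ℝ E3 + B).comp Ap).comp flat -
            (L : E3 →L[ℝ] E3).comp flat = (Ap - L + B.comp Ap).comp flat := by
          ext1 x; simp; abel
        have e4 : ‖Ap‖ ≤ β := by
          have := norm_add_le (L : E3 →L[ℝ] E3) (Ap - L)
          rw [add_sub_cancel] at this
          linarith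
        have e5 : ‖B‖ < r / (2 * β) := hB.trans_lt (k₃ c hc hcc₃)
        rw [e3]
        calc _ ≤ ‖Ap - L + B.comp Ap‖ * ‖flat‖ := ContinuousLinearMap.opNorm_comp_le _ _
          _ ≤ ‖Ap - L + B.comp Ap‖ * 1 := by gcongr; exact norm_flat_clm_le
          _ ≤ ‖Ap - L‖ + ‖B‖ * ‖Ap‖ := by
              rw [mul_one]
              exact (norm_add_le _ _).trans (by gcongr; exact ContinuousLinearMap.opNorm_comp_le _ _)
          _ < r / 2 + r / (2 * β) * β := by
              refine add_lt_add_of_lt_of_le e2 ?_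
              gcongr
          _ = r := by field_simp; ring
      · obtain ⟨c, hc, h⟩ := hκb (1 / 2) (by norm_num)
        refine ⟨c, hc, ?_⟩
        filter_upwards [h, hφ.isClosed_boundary.isOpen_compl.mem_nhds hq] with q h hq' s hs hsc
        exact ⟨(h s hs hsc).le, fun s _ _ z p hp hpq =>
          (hq' (mem_iUnion.2 ⟨z, p, hp, hpq⟩)).elim⟩)
  refine ⟨ε, hε, fun q => ⟨(hεP q).1, ?_⟩⟩
  obtain ⟨hε0, c, hc1, hc2, hP⟩ := hεP q
  obtain ⟨h1, h2⟩ := hP c (hε0.trans_le hc1) le_rfl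
  exact ⟨c, hc1, hc2, h1, h2 (ε q) hε0 hc1⟩

/-- The image of a half-space can be pushed inside itself by an ambient isotopy, to the region
above a graph, keeping fixed a closed set disjoint from the boundary. -/
theorem exists_push (hφ : IsProperSmoothEmbedding upperHalfSpace3 φ) {A : Set E3}
    (hA : IsClosed A) (hAd : ∀ z p, hgt p = 0 → φ z p ∉ A) (hv : ∀ z, φ z vert ∈ A) :
    ∃ (D : E3 → E3) (σ : Z → E3 → ℝ), IsotopicToIdRel A D ∧ ∀ z, ContDiff ℝ ∞ (σ z) ∧
      (∀ p, σ z (flat p) = σ z p) ∧ (∀ p, 0 < σ z p ∧ σ z p < 1 / 2) ∧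
      D '' (φ z '' upperHalfSpace3) = φ z '' {p | σ z p ≤ hgt p} := by
  obtain ⟨w, hw, hwin⟩ := hφ.exists_inward_field
  -- A nonnegative function whose zero set is exactly `A`: it freezes `A` and leaves the field
  -- inward along the boundary, which misses `A`.
  obtain ⟨χ, hχs, hχ, hχr⟩ := hA.isOpen_compl.exists_contDiff_support_eq (n := ⊤)
  have hχ0 : ∀ x, χ x = 0 ↔ x ∈ A := fun x => by
    have : x ∈ χ.support ↔ x ∈ Aᶜ := by rw [hχs]
    rw [mem_support, mem_compl_iff, not_iff_not] at this; exact this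
  have hχn : ∀ x, 0 ≤ χ x := fun x => (hχr (mem_range_self x)).1
  let v : E3 → E3 := fun x => χ x • w x
  have hvs : ContDiff ℝ ∞ v := hχ.smul hw
  have hvin : ∀ z p, hgt p = 0 →
      ∃ u, 0 < hgt u ∧ fderivWithin ℝ (φ z) upperHalfSpace3 p u = v (φ z p) := fun z p hp => by
    obtain ⟨u, hu, huw⟩ := hwin z p hp
    refine ⟨χ (φ z p) • u, ?_, by rw [map_smul, huw]⟩
    rw [map_smul, smul_eq_mul]
    exact mul_pos ((hχn _).lt_of_ne fun h => hAd z p hp ((hχ0 _).1 h.symm)) hu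
  let κ : E3 → ℝ := fun q => ‖fderiv ℝ v q‖ + ‖v q‖
  have hκ : Continuous κ :=
    (hvs.continuous_fderiv (by simp)).norm.add hvs.continuous.norm
  have hκ0 : ∀ q, 0 ≤ κ q := fun q => by positivity
  obtain ⟨ε, hε, hεP⟩ := hφ.exists_small_displacement hvs.continuous hvin hκ hκ0
  choose hε0 c hc1 hc2 hc3 hP using hεP
  let W : E3 → E3 := fun q => ε q • v q
  have hW : ContDiff ℝ ∞ W := hε.smul hvs
  have hWd : ∀ q, ‖fderiv ℝ W q‖ ≤ c q * κ q := by
    intro q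
    have h1 : HasFDerivAt W (ε q • fderiv ℝ v q + (fderiv ℝ ε q).smulRight (v q)) q :=
      ((hε.differentiable (by simp)) q).hasFDerivAt.smul
        ((hvs.differentiable (by simp)) q).hasFDerivAt
    rw [h1.fderiv]
    calc _ ≤ ‖ε q • fderiv ℝ v q‖ + ‖(fderiv ℝ ε q).smulRight (v q)‖ := norm_add_le _ _
      _ = ε q * ‖fderiv ℝ v q‖ + ‖fderiv ℝ ε q‖ * ‖v q‖ := by
          rw [norm_smul, ContinuousLinearMap.norm_smulRight_apply, Real.norm_of_nonneg (hε0 q).le]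
      _ ≤ c q * ‖fderiv ℝ v q‖ + c q * ‖v q‖ := by
          gcongr
          · exact hc1 q
          · exact hc2 q
      _ = _ := by simp only [κ]; ring
  have hD := IsotopicToIdRel.id_add hW fun q => (hWd q).trans (hc3 q)
  set D : E3 → E3 := fun x => x + W x with hDdef
  have hDA : IsotopicToIdRel A D := hD.mono fun x hx => by
    have := (hχ0 x).2 hx
    show ε x • χ x • w x = 0
    rw [this]; simp
  have hmain : ∀ z, ∃ σ : E3 → ℝ, ContDiff ℝ ∞ σ ∧ (∀ p, σ (flat p) = σ p) ∧
      (∀ p, 0 < σ p ∧ σ p < 1 / 2) ∧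
      D '' (φ z '' upperHalfSpace3) = φ z '' {p | σ p ≤ hgt p} := by
    intro z
    have hψ : ContDiff ℝ ∞ fun p => D (φ z (flat p)) := hDA.contDiff.comp (hφ.contDiff_comp_flat z)
    have hlift : ∀ p, ∃ y, 0 < hgt y ∧ φ z y = D (φ z (flat p)) := fun p => by
      obtain ⟨y, hy, -, hyq, -⟩ := hP _ z (flat p) (hgt_flat p) rfl
      exact ⟨y, hy, hyq⟩
    obtain ⟨K, hK, hKp⟩ := hφ.exists_lift z hψ hlift
    have hKy : ∀ p, hgt (K p) < 1 / 2 ∧ ‖fderiv ℝ K p - flat‖ ≤ 1 / 2 := by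
      intro p
      obtain ⟨y, hy, hy2, hyq, hM⟩ := hP _ z (flat p) (hgt_flat p) rfl
      obtain ⟨h1, h2, h3⟩ := hKp p
      obtain ⟨-, rfl⟩ := hφ.eq_of_apply_eq (hgt_pos_subset h1) (hgt_pos_subset hy)
        (h2.trans hyq.symm)
      refine ⟨hy2, hM _ _ (hWd _) ?_⟩
      rw [h3]
      have h4 : HasFDerivAt D (ContinuousLinearMap.id ℝ E3 + fderiv ℝ W (φ z (flat p)))
          (φ z (flat p)) :=
        (hasFDerivAt_id _).add ((hW.differentiable (by simp)) _).hasFDerivAt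
      exact (h4.comp p (hφ.hasFDerivAt_comp_flat z p)).fderiv
    have hKf : ∀ p, K (flat p) = K p := fun p => by
      refine (hφ.eq_of_apply_eq (z := z) (z' := z) (hgt_pos_subset (hKp _).1)
        (hgt_pos_subset (hKp _).1) ?_).2
      rw [(hKp _).2.1, (hKp _).2.1, flat_flat]
    obtain ⟨k, k', σ, hk, hk', hσ, hk'k, hkk', hkf, hk'f, hkh, hσf, hσK, hKk⟩ :=
      exists_graph hK hKf fun p => (hKy p).2
    have hσb : ∀ p, 0 < σ p ∧ σ p < 1 / 2 := fun p => by
      rw [hσK]; exact ⟨(hKp _).1, (hKy _).1⟩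
    refine ⟨σ, hσ, hσf, hσb, ?_⟩
    have hsub1 : {p | σ p < hgt p} ⊆ {p | 0 < hgt p} := fun p hp => (hσb p).1.trans hp
    have hsub2 : {p | σ p ≤ hgt p} ⊆ {p | 0 < hgt p} := fun p hp => (hσb p).1.trans_le hp
    have hH : upperHalfSpace3 = {p | 0 < hgt p} ∪ {p | hgt p = 0} := by
      ext p
      show 0 ≤ hgt p ↔ 0 < hgt p ∨ hgt p = 0
      rw [le_iff_lt_or_eq, eq_comm (a := (0 : ℝ))]
    have hle : {p : E3 | σ p ≤ hgt p} = {p | σ p < hgt p} ∪ {p | σ p = hgt p} := by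
      ext p; exact le_iff_lt_or_eq (a := σ p) (b := hgt p)
    set G := φ z '' {p | σ p = hgt p} with hG
    have hDG : D '' (φ z '' {p | hgt p = 0}) = G := by
      apply Subset.antisymm
      · rintro _ ⟨_, ⟨p, hp, rfl⟩, rfl⟩
        refine ⟨K p, ?_, by rw [(hKp p).2.1, flat_eq_self hp]⟩
        show σ (K p) = hgt (K p)
        rw [hKk p]
        have : σ (flat (k p) + σ (k p) • vert) = σ (k p) := by
          rw [← hσf, ← hσf (k p)]; simp
        rw [this]; simp
      · rintro _ ⟨p, hp, rfl⟩
        refine ⟨_, ⟨flat (k' p), hgt_flat _, rfl⟩, ?_⟩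
        rw [← (hKp _).2.1]
        congr 1
        rw [hKk, hkk', (show σ p = hgt p from hp), flat_add_hgt]
    have hDc : Continuous D := hDA.contDiff.continuous
    obtain ⟨D', hD', hD'D, hDD'⟩ := hDA.exists_inverse
    have hDop : ∀ U : Set E3, IsOpen U → IsOpen (D '' U) := fun U hU => by
      rw [image_eq_preimage_of_inverse hD'D hDD']
      exact hU.preimage hD'.contDiff.continuous
    have hDcl : ∀ U : Set E3, IsClosed U → IsClosed (D '' U) := fun U hU => by
      rw [image_eq_preimage_of_inverse hD'D hDD']
      exact hU.preimage hD'.contDiff.continuous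
    have hφcl : ∀ C : Set E3, IsClosed C → C ⊆ upperHalfSpace3 → IsClosed (φ z '' C) := by
      classical
      intro C hC hCH
      have := hφ.isClosed_iUnion_image (C := fun z' => if z' = z then C else ∅)
        (fun z' => by split_ifs <;> simp [hC]) (fun z' => by split_ifs <;> simp [hCH])
      convert this
      ext y
      simp only [mem_iUnion]
      constructor
      · intro h; exact ⟨z, by simpa using h⟩
      · rintro ⟨z', h⟩
        split_ifs at h with hz
        · rwa [hz] at h
        · simp at h
    -- `X` and `Y` are open and connected, become closed when `G` is added, miss `G`, and share the
    -- point `φ z vert`. Each therefore contains the other.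
    set X := φ z '' {p | σ p < hgt p} with hX
    set Y := D '' (φ z '' {p | 0 < hgt p}) with hY
    have hXo : IsOpen X := hφ.isOpen_image z (isOpen_lt hσ.continuous hgt.continuous) hsub1
    have hXG : IsClosed (X ∪ G) := by
      rw [hX, hG, ← image_union, ← hle]
      exact hφcl _ (isClosed_le hσ.continuous hgt.continuous) (hsub2.trans hgt_pos_subset)
    have hYo : IsOpen Y := hDop _ (hφ.isOpen_image z isOpen_hgt_pos subset_rfl)
    have hYG : Y ∪ G = D '' (φ z '' upperHalfSpace3) := by
      rw [hY, ← hDG, ← image_union, ← image_union, ← hH]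
    have hYGc : IsClosed (Y ∪ G) := by
      rw [hYG]
      exact hDcl _ (hφcl _ isClosed_upperHalfSpace3 subset_rfl)
    have hXc : IsPreconnected X := (isPreconnected_above_graph hσ.continuous hσf).image _
      ((hφ.contDiffOn_pos z).continuousOn.mono hsub1)
    have hYc : IsPreconnected Y :=
      (((convex_halfSpace_gt hgt.isLinear 0).isPreconnected).image _
        (hφ.contDiffOn_pos z).continuousOn).image _ hDc.continuousOn
    have hmeet : φ z vert ∈ X ∧ φ z vert ∈ Y := by
      refine ⟨⟨vert, ?_, rfl⟩, ⟨φ z vert, ⟨vert, by simp, rfl⟩, hDA.apply_eq (hv z)⟩⟩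
      show σ vert < hgt vert
      rw [hgt_vert]; linarith [(hσb vert).2]
    have hXG' : ∀ x ∈ X, x ∉ G := by
      rintro _ ⟨p, hp, rfl⟩ ⟨p', hp', h⟩
      obtain ⟨-, rfl⟩ := hφ.eq_of_apply_eq (hgt_pos_subset (hsub2 (show σ p' = hgt p' from hp').le))
        (hgt_pos_subset (hsub1 hp)) h
      exact (ne_of_lt hp) hp'
    have hYG' : ∀ x ∈ Y, x ∉ G := by
      rw [← hDG]
      rintro _ ⟨_, ⟨p, hp, rfl⟩, rfl⟩ ⟨_, ⟨p', hp', rfl⟩, h⟩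
      obtain ⟨-, rfl⟩ := hφ.eq_of_apply_eq (boundary_subset hp') (hgt_pos_subset hp)
        (hDA.bijective.1 h)
      exact (ne_of_gt hp) hp'
    have hXY : X = Y := Subset.antisymm
      (hXc.subset_of_disjoint_of_isClosed hYo hYGc hXG' ⟨_, hmeet⟩)
      (hYc.subset_of_disjoint_of_isClosed hXo hXG hYG' ⟨_, hmeet.symm⟩)
    rw [← hYG, ← hXY, hX, hG, ← image_union, ← hle]
  choose σ hσ using hmain
  exact ⟨D, σ, hDA, hσ⟩

end IsProperSmoothEmbedding

/-! ### Vertical isotopies between graphs -/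

theorem exists_abs_deriv_smoothTransition_le :
    ∃ C > 0, ∀ x, 0 ≤ deriv Real.smoothTransition x ∧ deriv Real.smoothTransition x ≤ C := by
  have hc : ContDiff ℝ 1 Real.smoothTransition := Real.smoothTransition.contDiff
  have hd : Continuous (deriv Real.smoothTransition) := hc.continuous_deriv le_rfl
  have h0 : ∀ x, 0 ≤ deriv Real.smoothTransition x := fun x =>
    Real.smoothTransition.monotone.deriv_nonneg
  obtain ⟨x₀, -, hx₀⟩ := (isCompact_Icc (a := (0 : ℝ)) (b := 1)).exists_isMaxOn ⟨0, by simp⟩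
    hd.continuousOn
  refine ⟨deriv Real.smoothTransition x₀ + 1, by linarith [h0 x₀], fun x => ⟨h0 x, ?_⟩⟩
  by_cases hx : x ∈ Icc (0 : ℝ) 1
  · have : deriv Real.smoothTransition x ≤ deriv Real.smoothTransition x₀ := hx₀ hx
    linarith
  · have hz : deriv Real.smoothTransition x = 0 := by
      rw [mem_Icc, not_and_or, not_le, not_le] at hx
      rcases hx with hx | hx
      · have : Real.smoothTransition =ᶠ[𝓝 x] fun _ => 0 := by
          filter_upwards [Iio_mem_nhds hx] with y hy
          exact Real.smoothTransition.zero_of_nonpos (le_of_lt hy)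
        rw [this.deriv_eq, deriv_const]
      · have : Real.smoothTransition =ᶠ[𝓝 x] fun _ => 1 := by
          filter_upwards [Ioi_mem_nhds hx] with y hy
          exact Real.smoothTransition.one_of_one_le (le_of_lt hy)
        rw [this.deriv_eq, deriv_const]
    rw [hz]; linarith [h0 x₀]

theorem hasDerivAt_smoothTransition (x : ℝ) :
    HasDerivAt Real.smoothTransition (deriv Real.smoothTransition x) x :=
  ((Real.smoothTransition.contDiff (n := 1)).differentiable (by simp) x).hasDerivAt

theorem fderiv_vert_eq_of_hasDerivAt {a : E3 → ℝ} (ha : Differentiable ℝ a) {p : E3} {a' : ℝ}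
    (h : HasDerivAt (fun z : ℝ => a (p + z • vert)) a' 0) : fderiv ℝ a p vert = a' := by
  have h1 : HasDerivAt (fun z : ℝ => p + z • vert) vert 0 := by
    simpa using ((hasDerivAt_id (0 : ℝ)).smul_const vert).const_add p
  have h2 := (ha (p + (0 : ℝ) • vert)).hasFDerivAt.comp_hasDerivAt 0 h1
  rw [zero_smul, add_zero] at h2
  exact h2.unique h

theorem comp_flat_add_smul_vert {X : Type*} {f : E3 → X} (hf : ∀ p, f (flat p) = f p) (p : E3)
    (c : ℝ) : f (p + c • vert) = f p := by
  rw [← hf, ← hf p]; simp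

/-- A vertical isotopy which moves the region above the graph of `ψ` to the region above the graph
of `σ < ψ`; it is the identity above the graph of `θ > ψ`, and far below. -/
theorem exists_vertical_isotopy {σ ψ θ : E3 → ℝ} (hσ : ContDiff ℝ ∞ σ) (hψ : ContDiff ℝ ∞ ψ)
    (hθ : ContDiff ℝ ∞ θ) (hσf : ∀ p, σ (flat p) = σ p) (hψf : ∀ p, ψ (flat p) = ψ p)
    (hθf : ∀ p, θ (flat p) = θ p) (hσψ : ∀ p, σ p < ψ p) (hψθ : ∀ p, ψ p < θ p) :
    ∃ (d : E3 → E3) (b : E3 → ℝ), Continuous b ∧ (∀ p, b (flat p) = b p) ∧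
      IsotopicToIdRel {p | hgt p ≤ b p ∨ θ p ≤ hgt p} d ∧
      d '' {p | ψ p ≤ hgt p} = {p | σ p ≤ hgt p} := by
  obtain ⟨C, hC, hC'⟩ := exists_abs_deriv_smoothTransition_le
  set S := Real.smoothTransition
  have hS : ContDiff ℝ ∞ S := Real.smoothTransition.contDiff
  have hS0 := Real.smoothTransition.nonneg
  have hS1 := Real.smoothTransition.le_one
  set M := C + 1
  have hM : 0 < M := by positivity
  -- A downward displacement by the full gap at the graph of `ψ`. The first cutoff stops it above
  -- `θ` and contributes a nonnegative vertical derivative; the second stops it far below `σ`.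
  let a : E3 → ℝ := fun p => -((ψ p - σ p) * S ((θ p - hgt p) / (θ p - ψ p)) *
    S (1 + (hgt p - σ p) / (M * (ψ p - σ p))))
  have hD : ∀ p, 0 < ψ p - σ p := fun p => sub_pos.2 (hσψ p)
  have hT : ∀ p, 0 < θ p - ψ p := fun p => sub_pos.2 (hψθ p)
  have ha : ContDiff ℝ ∞ a := by
    refine (((hψ.sub hσ).mul (hS.comp ((hθ.sub hgt.contDiff).div (hθ.sub hψ)
      fun p => (hT p).ne'))).mul (hS.comp (contDiff_const.add ((hgt.contDiff.sub hσ).div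
      (contDiff_const.mul (hψ.sub hσ)) fun p => ?_)))).neg
    exact (mul_pos hM (hD p)).ne'
  have had : Differentiable ℝ a := ha.differentiable (by simp)
  have hdv : ∀ p, -1 < fderiv ℝ a p vert := by
    intro p
    set D := ψ p - σ p
    set T := θ p - ψ p
    have hDp : 0 < D := hD p
    have hTp : 0 < T := hT p
    set x := (θ p - hgt p) / T
    set y := 1 + (hgt p - σ p) / (M * D)
    have e1 : HasDerivAt (fun z : ℝ => (θ p - (hgt p + z)) / T) (-1 / T) 0 := by
      have := (((hasDerivAt_id (0 : ℝ)).const_add (hgt p)).const_sub (θ p)).div_const T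
      simpa using this
    have e2 : HasDerivAt (fun z : ℝ => 1 + (hgt p + z - σ p) / (M * D)) (1 / (M * D)) 0 := by
      have := ((((hasDerivAt_id (0 : ℝ)).const_add (hgt p)).sub_const (σ p)).div_const
        (M * D)).const_add 1
      simpa using this
    have e1' : HasDerivAt (fun z : ℝ => S ((θ p - (hgt p + z)) / T)) (deriv S x * (-1 / T)) 0 := by
      refine HasDerivAt.comp (h₂ := S) 0 ?_ e1
      rw [add_zero]; exact hasDerivAt_smoothTransition x
    have e2' : HasDerivAt (fun z : ℝ => S (1 + (hgt p + z - σ p) / (M * D)))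
        (deriv S y * (1 / (M * D))) 0 := by
      refine HasDerivAt.comp (h₂ := S) 0 ?_ e2
      rw [add_zero]; exact hasDerivAt_smoothTransition y
    have e3 : HasDerivAt (fun z : ℝ => a (p + z • vert))
        (-(D * (deriv S x * (-1 / T)) * S y + D * S x * (deriv S y * (1 / (M * D))))) 0 := by
      have := ((e1'.const_mul D).mul e2').neg
      simp only [add_zero] at this
      refine this.congr_of_eventuallyEq (Eventually.of_forall fun z => ?_)
      simp only [a, comp_flat_add_smul_vert hσf, comp_flat_add_smul_vert hψf,
        comp_flat_add_smul_vert hθf]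
      simp [D, T]
    rw [fderiv_vert_eq_of_hasDerivAt had e3]
    have k1 : 0 ≤ D * (deriv S x * (1 / T)) * S y := by
      have := (hC' x).1
      have := hS0 y
      positivity
    have k2 : D * S x * (deriv S y * (1 / (M * D))) ≤ C / M := by
      have k3 : D * S x * (deriv S y * (1 / (M * D))) = S x * deriv S y / M := by
        field_simp
      rw [k3]
      gcongr
      calc S x * deriv S y ≤ 1 * C := mul_le_mul (hS1 x) (hC' y).2 (hC' y).1 zero_le_one
        _ = C := one_mul C
    have k4 : C / M < 1 := by rw [div_lt_one hM]; simp [M]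
    have k5 : D * (deriv S x * (-1 / T)) * S y = -(D * (deriv S x * (1 / T)) * S y) := by ring
    linarith
  have hiso := IsotopicToIdRel.vertical ha hdv fun q => ⟨ψ q - σ q, fun z => by
    simp only [a, comp_flat_add_smul_vert hσf, comp_flat_add_smul_vert hψf, abs_neg]
    rw [abs_mul, abs_mul, abs_of_pos (hD q), abs_of_nonneg (hS0 _), abs_of_nonneg (hS0 _)]
    calc _ ≤ (ψ q - σ q) * 1 * 1 := by
          have := hD q
          gcongr
          · exact hS0 _
          · exact hS1 _
          · exact hS1 _
      _ = _ := by ring⟩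
  refine ⟨_, fun p => σ p - M * (ψ p - σ p), ?_, fun p => by simp only [hσf, hψf], hiso.mono ?_,
    image_vertical had hdv hiso.bijective.2 hψf hσf fun p hp => ?_⟩
  · have := hσ.continuous
    have := hψ.continuous
    fun_prop
  · rintro p (hp | hp)
    · have : S (1 + (hgt p - σ p) / (M * (ψ p - σ p))) = 0 := by
        refine Real.smoothTransition.zero_of_nonpos ?_
        have h1 : 0 < M * (ψ p - σ p) := mul_pos hM (hD p)
        have : (hgt p - σ p) / (M * (ψ p - σ p)) ≤ -1 := by
          rw [div_le_iff₀ h1]; linarith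
        linarith
      show a p = 0
      simp only [a, this]; simp
    · have : S ((θ p - hgt p) / (θ p - ψ p)) = 0 :=
        Real.smoothTransition.zero_of_nonpos (div_nonpos_of_nonpos_of_nonneg (by linarith) (hT p).le)
      show a p = 0
      simp only [a, this]; simp
  · have h1 : S ((θ p - hgt p) / (θ p - ψ p)) = 1 := by
      rw [hp, div_self (hT p).ne']; exact Real.smoothTransition.one
    have h2 : S (1 + (hgt p - σ p) / (M * (ψ p - σ p))) = 1 := by
      refine Real.smoothTransition.one_of_one_le ?_
      rw [hp]
      have := hD p
      have : 0 ≤ (ψ p - σ p) / (M * (ψ p - σ p)) := by positivity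
      linarith
    simp only [a, h1, h2]; ring

/-! ### Charts around rays -/

/-- The non-negative vertical axis. -/
def axisRay : Set E3 := {p | flat p = 0 ∧ 0 ≤ hgt p}

theorem mem_axisRay_iff {p : E3} : p ∈ axisRay ↔ ∃ t : ℝ, 0 ≤ t ∧ p = t • vert := by
  constructor
  · rintro ⟨h1, h2⟩
    refine ⟨hgt p, h2, ?_⟩
    conv_lhs => rw [← flat_add_hgt p, h1, zero_add]
  · rintro ⟨t, ht, rfl⟩
    exact ⟨by simp, by simpa using ht⟩

/-- Diffeomorphism of `ℝ³` onto the open upper half-space. -/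
noncomputable def expChart (p : E3) : E3 := flat p + Real.exp (hgt p) • vert

@[simp] theorem flat_expChart (p : E3) : flat (expChart p) = flat p := by simp [expChart]

@[simp] theorem hgt_expChart (p : E3) : hgt (expChart p) = Real.exp (hgt p) := by simp [expChart]

theorem hgt_expChart_pos (p : E3) : 0 < hgt (expChart p) := by
  rw [hgt_expChart]; exact Real.exp_pos _

theorem contDiff_expChart : ContDiff ℝ ∞ expChart :=
  flat.contDiff.add ((Real.contDiff_exp.comp hgt.contDiff).smul contDiff_const)

theorem injective_expChart : Injective expChart := fun p q h => by
  refine ext_flat_hgt (by simpa using congrArg flat h) ?_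
  have := congrArg hgt h
  rw [hgt_expChart, hgt_expChart] at this
  exact Real.exp_injective this

theorem injective_fderiv_expChart (p : E3) : Injective (fderiv ℝ expChart p) := by
  have h1 : HasFDerivAt expChart (flat + (Real.exp (hgt p) • hgt).smulRight vert) p :=
    flat.hasFDerivAt.add ((hgt.hasFDerivAt.exp).smul_const vert)
  rw [h1.fderiv, injective_iff_map_eq_zero]
  intro v hv
  refine ext_flat_hgt ?_ ?_
  · simpa using congrArg flat hv
  · simpa [Real.exp_ne_zero] using congrArg hgt hv

theorem exists_expChart_eq {p : E3} (hp : 0 < hgt p) :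
    expChart (flat p + Real.log (hgt p) • vert) = p :=
  ext_flat_hgt (by simp) (by simp [Real.exp_log hp])

theorem image_expChart_le {σ : E3 → ℝ} (hσf : ∀ p, σ (flat p) = σ p) (hσ : ∀ p, 0 < σ p) :
    expChart '' {p | Real.log (σ p) ≤ hgt p} = {p | σ p ≤ hgt p} := by
  apply Subset.antisymm
  · rintro _ ⟨p, hp, rfl⟩
    show σ (expChart p) ≤ hgt (expChart p)
    rw [← hσf, flat_expChart, hσf, hgt_expChart, ← Real.log_le_iff_le_exp (hσ p)]
    exact hp
  · intro p hp
    have h0 : 0 < hgt p := (hσ p).trans_le hp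
    refine ⟨_, ?_, exists_expChart_eq h0⟩
    show Real.log (σ (flat p + Real.log (hgt p) • vert)) ≤ _
    rw [comp_flat_add_smul_vert (f := σ) hσf, hσf]
    simpa using Real.log_le_log (hσ p) hp

theorem image_expChart_axisRay : expChart '' axisRay = zetaRay := by
  rw [zetaRay_eq]
  apply Subset.antisymm
  · rintro _ ⟨p, ⟨h1, h2⟩, rfl⟩
    exact ⟨by rw [flat_expChart, h1], by rw [hgt_expChart]; exact Real.one_le_exp h2⟩
  · rintro p ⟨h1, h2⟩
    exact ⟨_, ⟨by simpa using h1, by simpa using Real.log_nonneg h2⟩,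
      exists_expChart_eq (one_pos.trans_le h2)⟩

section RayChart

variable {Z : Type} [TopologicalSpace Z] [DiscreteTopology Z]

/-- A family of smooth open embeddings `ψ z : ℝ³ → ℝ³` which carries vertical half-axes to the
components of `τ` and such that the upper half-spaces bounded below by arbitrary levels are carried
to neighborhoods of `τ` that are isotopic to `N` relative to `τ`. -/
structure IsRayChart (τ N : Set E3) (ψ : Z → E3 → E3) : Prop where
  smooth : ∀ z, ContDiff ℝ ∞ (ψ z)
  immersion : ∀ z x, Injective (fderiv ℝ (ψ z) x)
  eq_of_apply_eq : ∀ z z' x x', ψ z x = ψ z' x' → z = z' ∧ x = x'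
  closed : ∀ c : Z → ℝ, IsClosed (⋃ z, ψ z '' {p | c z ≤ hgt p})
  ray : τ = ⋃ z, ψ z '' axisRay
  shrink : ∀ c : Z → ℝ, (∀ z, c z < 0) →
    ∃ d, IsotopicToIdRel τ d ∧ d '' N = ⋃ z, ψ z '' {p | c z ≤ hgt p}

/-- In logarithmic height the ray starts at height 0 and the boundary recedes to `-∞`. After the
neighborhood is pushed to the region above a negative graph, vertical isotopies supported below
height 0 carry that graph to any negative level without touching the ray. -/
theorem IsProperSmoothEmbedding.isRayChart {φ : Z → E3 → E3}
    (hφ : IsProperSmoothEmbedding upperHalfSpace3 φ) :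
    IsRayChart (⋃ z, φ z '' zetaRay) (⋃ z, φ z '' upperHalfSpace3)
      fun z p => φ z (expChart p) := by
  have hd' : ∀ z x, Injective (fderiv ℝ (fun p => φ z (expChart p)) x) := fun z x => by
    have h1 : HasFDerivAt (fun p => φ z (expChart p))
        ((fderiv ℝ (φ z) (expChart x)).comp (fderiv ℝ expChart x)) x :=
      HasFDerivAt.comp (g := φ z) x
        ((((hφ.contDiffOn_pos z).contDiffAt (isOpen_hgt_pos.mem_nhds
          (hgt_expChart_pos x))).differentiableAt (by simp)).hasFDerivAt)
        ((contDiff_expChart.differentiable (by simp)) x).hasFDerivAt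
    rw [h1.fderiv]
    exact (hφ.injective_fderiv z (hgt_expChart_pos x)).comp (injective_fderiv_expChart x)
  have hsm : ∀ z, ContDiff ℝ ∞ fun p => φ z (expChart p) := fun z =>
    (hφ.contDiffOn_pos z).comp_contDiff contDiff_expChart hgt_expChart_pos
  have hinj : ∀ z z' x x', φ z (expChart x) = φ z' (expChart x') → z = z' ∧ x = x' :=
    fun z z' x x' h => by
      obtain ⟨h1, h2⟩ := hφ.eq_of_apply_eq (hgt_pos_subset (hgt_expChart_pos x))
        (hgt_pos_subset (hgt_expChart_pos x')) h
      exact ⟨h1, injective_expChart h2⟩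
  have himg : ∀ z (S : Set E3), (fun p => φ z (expChart p)) '' S = φ z '' (expChart '' S) :=
    fun z S => by rw [image_image]
  have hclosed : ∀ b : Z → E3 → ℝ, (∀ z, Continuous (b z)) → (∀ z p, b z (flat p) = b z p) →
      IsClosed (⋃ z, (fun p => φ z (expChart p)) '' {p | b z p ≤ hgt p}) := fun b hb hbf => by
    have h1 : ∀ z, expChart '' {p | b z p ≤ hgt p} = {p | Real.exp (b z p) ≤ hgt p} := fun z => by
      have := image_expChart_le (σ := fun p => Real.exp (b z p)) (fun p => by rw [hbf])
        fun p => Real.exp_pos _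
      simpa using this
    simp only [himg, h1]
    exact hφ.isClosed_iUnion_image
      (fun z => isClosed_le (Real.continuous_exp.comp (hb z)) hgt.continuous)
      fun z p hp => (Real.exp_pos _).le.trans hp
  have hray : (⋃ z, φ z '' zetaRay) = ⋃ z, (fun p => φ z (expChart p)) '' axisRay := by
    simp only [himg, image_expChart_axisRay]
  have hmove : ∀ σ ψ : Z → E3 → ℝ, (∀ z, ContDiff ℝ ∞ (σ z)) → (∀ z, ContDiff ℝ ∞ (ψ z)) →
      (∀ z p, σ z (flat p) = σ z p) → (∀ z p, ψ z (flat p) = ψ z p) →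
      (∀ z p, σ z p < ψ z p) → (∀ z p, ψ z p < 0) →
      ∃ D, IsotopicToIdRel (⋃ z, φ z '' zetaRay) D ∧
        D '' (⋃ z, (fun p => φ z (expChart p)) '' {p | ψ z p ≤ hgt p}) =
          ⋃ z, (fun p => φ z (expChart p)) '' {p | σ z p ≤ hgt p} := by
    intro σ ψ hσ hψ hσf hψf hσψ hψ0
    choose d b hb hbf hd hdi using fun z => exists_vertical_isotopy (hσ z) (hψ z)
      (contDiff_const (c := (0 : ℝ))) (hσf z) (hψf z) (fun _ => rfl) (hσψ z) (hψ0 z)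
    obtain ⟨D, hD, hDΦ⟩ := IsotopicToIdRel.transplant (Φ := fun z p => φ z (expChart p))
      (U := fun _ => univ) (fun _ => isOpen_univ) (fun z => (hsm z).contDiffOn)
      (fun z x _ => hd' z x) (fun z z' x x' _ _ h => hinj z z' x x' h)
      (C := fun z => {p | b z p ≤ hgt p}) (fun _ => subset_univ _) (hclosed b hb hbf)
      (fun z x hx => Or.inl (not_le.1 hx).le) hd
    refine ⟨D, hD.mono ?_, ?_⟩
    · rw [hray]
      intro y hy z x _ hxy
      obtain ⟨z', x', hx', rfl⟩ := mem_iUnion.1 hy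
      obtain ⟨-, rfl⟩ := hinj _ _ _ _ hxy
      exact Or.inr hx'.2
    · rw [image_iUnion]
      refine iUnion_congr fun z => ?_
      rw [← hdi z, image_image, image_image]
      exact image_congr fun x _ => hDΦ z x trivial
  refine ⟨hsm, hd', hinj, fun c => hclosed (fun z _ => c z) (fun z => continuous_const)
    fun _ _ => rfl, hray, fun c hc => ?_⟩
  obtain ⟨D, σ, hD, hσ⟩ := hφ.exists_push
    (hφ.isClosed_iUnion_image (fun _ => isClosed_zetaRay)
      fun _ => zetaRay_subset.trans hgt_pos_subset) (fun z p hp h => by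
        obtain ⟨z', x', hx', h'⟩ := mem_iUnion.1 h
        obtain ⟨-, rfl⟩ := hφ.eq_of_apply_eq (hgt_pos_subset (zetaRay_subset hx'))
          (IsProperSmoothEmbedding.boundary_subset hp) h'
        exact (ne_of_gt (zetaRay_subset hx')) hp)
    fun z => mem_iUnion.2 ⟨z, vert, vert_mem_zetaRay, rfl⟩
  have hlog : ∀ z, ContDiff ℝ ∞ fun p => Real.log (σ z p) := fun z =>
    (hσ z).1.log fun p => ((hσ z).2.2.1 p).1.ne'
  have hlog0 : ∀ z p, Real.log (σ z p) < 0 := fun z p =>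
    Real.log_neg ((hσ z).2.2.1 p).1 (((hσ z).2.2.1 p).2.trans (by norm_num))
  -- Both `log σ` and `c` are negative, so their sum lies strictly below each. Both graphs are
  -- lowered to this common level, and one motion is then undone.
  obtain ⟨D₁, hD₁, hD₁i⟩ := hmove (fun z p => Real.log (σ z p) + c z)
    (fun z p => Real.log (σ z p)) (fun z => (hlog z).add contDiff_const) hlog
    (fun z p => by simp only [(hσ z).2.1]) (fun z p => by simp only [(hσ z).2.1])
    (fun z p => by linarith [hc z]) hlog0
  obtain ⟨D₂, hD₂, hD₂i⟩ := hmove (fun z p => Real.log (σ z p) + c z)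
    (fun z _ => c z) (fun z => (hlog z).add contDiff_const) (fun _ => contDiff_const)
    (fun z p => by simp only [(hσ z).2.1]) (fun _ _ => rfl)
    (fun z p => by linarith [hlog0 z p]) (fun z _ => hc z)
  obtain ⟨D₃, hD₃, hD₃D₂, -⟩ := hD₂.exists_inverse
  refine ⟨D₃ ∘ D₁ ∘ D, hD₃.comp (hD₁.comp hD), ?_⟩
  have hDN : D '' (⋃ z, φ z '' upperHalfSpace3) =
      ⋃ z, (fun p => φ z (expChart p)) '' {p | Real.log (σ z p) ≤ hgt p} := by
    rw [image_iUnion]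
    refine iUnion_congr fun z => ?_
    rw [(hσ z).2.2.2, himg, image_expChart_le (hσ z).2.1 fun p => ((hσ z).2.2.1 p).1]
  rw [image_comp, image_comp, hDN, hD₁i, ← hD₂i, image_image]
  simp only [hD₃D₂, image_id']

end RayChart

/-! ### Thin neighborhoods of the half-axis -/

theorem exists_tube_nhds {O : Set E3} (hO : IsOpen O) {t₀ : ℝ} (ht₀ : t₀ • vert ∈ O) :
    ∃ ρ > 0, ∀ p, |hgt p - t₀| < ρ → ‖flat p‖ < ρ → p ∈ O := by
  obtain ⟨r, hr, hrO⟩ := Metric.isOpen_iff.1 hO _ ht₀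
  refine ⟨r / 2, by positivity, fun p h1 h2 => hrO ?_⟩
  rw [mem_ball_iff_norm]
  have : p - t₀ • vert = flat p + (hgt p - t₀) • vert := by
    nth_rewrite 1 [← flat_add_hgt p]; rw [sub_smul]; abel
  rw [this]
  calc _ ≤ ‖flat p‖ + ‖(hgt p - t₀) • vert‖ := norm_add_le _ _
    _ < r / 2 + r / 2 := by
        rw [norm_smul, norm_vert, mul_one, Real.norm_eq_abs]
        exact add_lt_add h2 h1
    _ = r := add_halves r

theorem exists_axis_extension {O : Set E3} (hO : IsOpen O) (hax : axisRay ⊆ O) :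
    ∃ δ > 0, δ ≤ 1 / 2 ∧ ∀ t : ℝ, -δ ≤ t → t • vert ∈ O := by
  obtain ⟨ρ, hρ, h⟩ := exists_tube_nhds hO (t₀ := 0) (hax (mem_axisRay_iff.2 ⟨0, le_rfl, rfl⟩))
  refine ⟨min (ρ / 2) (1 / 2), by positivity, min_le_right _ _, fun t ht => ?_⟩
  rcases le_or_gt 0 t with h0 | h0
  · exact hax (mem_axisRay_iff.2 ⟨t, h0, rfl⟩)
  · refine h _ ?_ (by simpa using hρ)
    have := min_le_left (ρ / 2) (1 / 2)
    simp only [map_smul, hgt_vert, smul_eq_mul, mul_one, sub_zero]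
    rw [abs_of_neg h0]; linarith

/-- The radius varies with the height because `O` may narrow towards infinity; the bound on its
derivative is needed for cutoffs adapted to the tube. -/
theorem exists_tube {O : Set E3} (hO : IsOpen O) {δ : ℝ} (hδ : ∀ t : ℝ, -δ ≤ t → t • vert ∈ O)
    {b : ℝ} (hb : 0 < b) : ∃ e : ℝ → ℝ, ContDiff ℝ ∞ e ∧ ∀ t, 0 < e t ∧ e t ≤ b ∧
      |deriv e t| ≤ b ∧ (-δ ≤ t → ∀ p, hgt p = t → ‖flat p‖ ≤ e t → p ∈ O) := by
  obtain ⟨e, he, h⟩ := exists_contDiff_pos_small (E := ℝ)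
    (P := fun t s => s ≤ b ∧ (-δ ≤ t → ∀ p, hgt p = t → ‖flat p‖ ≤ s → p ∈ O)) (by
      intro t₀
      rcases lt_or_ge t₀ (-δ) with h0 | h0
      · refine ⟨b, hb, ?_⟩
        filter_upwards [Iio_mem_nhds h0] with t ht s _ hs
        exact ⟨hs, fun h => absurd h (not_le.2 ht)⟩
      · obtain ⟨ρ, hρ, h⟩ := exists_tube_nhds hO (hδ t₀ h0)
        refine ⟨min b (ρ / 2), by positivity, ?_⟩
        filter_upwards [Metric.ball_mem_nhds t₀ hρ] with t ht s _ hs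
        refine ⟨hs.trans (min_le_left _ _), fun _ p hp hps => h p ?_ ?_⟩
        · rw [hp]; exact ht
        · have := min_le_right b (ρ / 2)
          linarith)
  refine ⟨e, he, fun t => ?_⟩
  obtain ⟨h0, c, h1, h2, h3⟩ := h t
  rw [← norm_deriv_eq_norm_fderiv, Real.norm_eq_abs] at h2
  exact ⟨h0, (h3 _ h0 h1).1, h2.trans (h3 c (h0.trans_le h1) le_rfl).1, (h3 _ h0 h1).2⟩

/-- Contraction towards the vertical axis by a factor depending on the height. -/
theorem exists_squeeze {s : ℝ → ℝ} (hs : ContDiff ℝ ∞ s) (hs0 : ∀ t, 0 < s t) :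
    IsotopicToIdRel {p | flat p = 0 ∨ s (hgt p) = 1} fun p => s (hgt p) • flat p + hgt p • vert := by
  set S := Real.smoothTransition
  have hS : ContDiff ℝ ∞ S := Real.smoothTransition.contDiff
  let r : ℝ × E3 → ℝ := fun x => 1 + S x.1 * (s (hgt x.2) - 1)
  have hr : ContDiff ℝ ∞ r := contDiff_const.add ((hS.comp contDiff_fst).mul
    ((hs.comp (hgt.contDiff.comp contDiff_snd)).sub contDiff_const))
  have hr0 : ∀ x, 0 < r x := fun x => by
    have h0 := Real.smoothTransition.nonneg x.1
    have h1 := Real.smoothTransition.le_one x.1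
    have h2 := hs0 (hgt x.2)
    show 0 < 1 + Real.smoothTransition x.1 * (s (hgt x.2) - 1)
    rcases h0.eq_or_lt with h | h
    · rw [← h]; simp
    · have := mul_pos h h2
      nlinarith
  have hrf : ∀ t p q, hgt p = hgt q → r (t, p) = r (t, q) := fun t p q h => by simp [r, h]
  refine ⟨fun x => r x • flat x.2 + hgt x.2 • vert,
    fun x => (r x)⁻¹ • flat x.2 + hgt x.2 • vert,
    (hr.smul (flat.contDiff.comp contDiff_snd)).add
      ((hgt.contDiff.comp contDiff_snd).smul contDiff_const),
    ((hr.inv fun x => (hr0 x).ne').smul (flat.contDiff.comp contDiff_snd)).add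
      ((hgt.contDiff.comp contDiff_snd).smul contDiff_const),
    fun t x => ?_, fun t x => ?_, fun x => ?_, fun x => ?_, ?_⟩
  · have h := hrf t (r (t, x) • flat x + hgt x • vert) x (by simp)
    simp only [h]
    simp only [map_add, map_smul, flat_flat, flat_vert, smul_zero, add_zero, hgt_flat, hgt_vert,
      smul_eq_mul, mul_zero, mul_one, zero_add, smul_smul]
    rw [inv_mul_cancel₀ (hr0 _).ne', one_smul, flat_add_hgt]
  · have h := hrf t ((r (t, x))⁻¹ • flat x + hgt x • vert) x (by simp)
    simp only [h]
    simp only [map_add, map_smul, flat_flat, flat_vert, smul_zero, add_zero, hgt_flat, hgt_vert,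
      smul_eq_mul, mul_zero, mul_one, zero_add, smul_smul]
    rw [mul_inv_cancel₀ (hr0 _).ne', one_smul, flat_add_hgt]
  · simp [r, S, flat_add_hgt]
  · simp [r, S]
  · rintro t x (hx | hx)
    · simp only [hx, smul_zero, zero_add]
      rw [← zero_add (hgt x • vert), ← hx, flat_add_hgt]
    · simp [r, hx, flat_add_hgt]

/-- Half-spaces around the vertical half-axis can be isotoped into any neighborhood of it. -/
theorem exists_thin_isotopy {O : Set E3} (hO : IsOpen O) (hax : axisRay ⊆ O) :
    ∃ c < 0, ∃ d, IsotopicToIdRel (axisRay ∪ {p | hgt p ≤ -2}) d ∧ d '' {p | c ≤ hgt p} ⊆ O := by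
  obtain ⟨δ, hδ, hδ2, hδO⟩ := exists_axis_extension hO hax
  obtain ⟨e, he, heP⟩ := exists_tube hO hδO one_pos
  set S := Real.smoothTransition
  have hS : ContDiff ℝ ∞ S := Real.smoothTransition.contDiff
  have hS0 := Real.smoothTransition.nonneg
  have hS1 := Real.smoothTransition.le_one
  -- the vertical part
  let a : E3 → ℝ := fun p => ‖flat p‖ ^ 2 * S (hgt p + δ + 1)
  have ha : ContDiff ℝ ∞ a := (flat.contDiff.norm_sq ℝ).mul
    (hS.comp ((hgt.contDiff.add contDiff_const).add contDiff_const))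
  have had := ha.differentiable (by simp)
  have hda : ∀ p, -1 < fderiv ℝ a p vert := fun p => by
    have e1 : HasDerivAt (fun z : ℝ => hgt p + z + δ + 1) 1 0 :=
      (((hasDerivAt_id (0 : ℝ)).const_add (hgt p)).add_const δ).add_const 1
    have e2 : HasDerivAt (fun z : ℝ => a (p + z • vert))
        (‖flat p‖ ^ 2 * (deriv S (hgt p + δ + 1) * 1)) 0 := by
      have e3 : HasDerivAt (fun z : ℝ => S (hgt p + z + δ + 1))
          (deriv S (hgt p + δ + 1) * 1) 0 := by
        refine HasDerivAt.comp (h₂ := S) 0 ?_ e1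
        rw [add_zero]; exact hasDerivAt_smoothTransition _
      have := e3.const_mul (‖flat p‖ ^ 2)
      refine this.congr_of_eventuallyEq (Eventually.of_forall fun z => ?_)
      simp [a]
    rw [fderiv_vert_eq_of_hasDerivAt had e2]
    have : 0 ≤ deriv S (hgt p + δ + 1) := Real.smoothTransition.monotone.deriv_nonneg
    have : 0 ≤ ‖flat p‖ ^ 2 * (deriv S (hgt p + δ + 1) * 1) := by positivity
    linarith
  have hV := IsotopicToIdRel.vertical ha hda fun q => ⟨‖flat q‖ ^ 2, fun z => by
    simp only [a, map_add, map_smul, flat_vert, smul_zero, add_zero]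
    rw [abs_of_nonneg (mul_nonneg (by positivity) (hS0 _))]
    exact mul_le_of_le_one_right (by positivity) (hS1 _)⟩
  -- Bending the plane at height `-δ` into a paraboloid makes all horizontal slices of the region
  -- bounded, so that a contraction depending only on height can fit them into the tube.
  have hVi := image_vertical (f := fun _ => -δ) (g := fun p => -δ + ‖flat p‖ ^ 2) had hda
    hV.bijective.2 (fun _ => rfl) (fun p => by simp) fun p hp => by
      have : S (hgt p + δ + 1) = 1 := Real.smoothTransition.one_of_one_le (by rw [hp]; linarith)
      simp [a, this]
  -- the horizontal part
  let s₀ : ℝ → ℝ := fun t => e t / (1 + (t + 2) ^ 2)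
  have hs₀ : ContDiff ℝ ∞ s₀ := he.div (by fun_prop) fun t => by positivity
  have hs₀p : ∀ t, 0 < s₀ t := fun t => div_pos (heP t).1 (by positivity)
  let s : ℝ → ℝ := fun t => 1 + S (t + 2) * (s₀ t - 1)
  have hs : ContDiff ℝ ∞ s := contDiff_const.add ((hS.comp (contDiff_id.add contDiff_const)).mul
    (hs₀.sub contDiff_const))
  have hsp : ∀ t, 0 < s t := fun t => by
    have h0 := hS0 (t + 2)
    have h1 := hS1 (t + 2)
    have h2 := hs₀p t
    show 0 < 1 + Real.smoothTransition (t + 2) * (s₀ t - 1)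
    rcases h0.eq_or_lt with h | h
    · rw [← h]; simp
    · have := mul_pos h h2
      nlinarith
  have hQ := exists_squeeze hs hsp
  refine ⟨-δ, by linarith, _, (hQ.mono ?_).comp (hV.mono ?_), ?_⟩
  · rintro p (hp | hp)
    · exact Or.inl hp.1
    · right
      have hp' : hgt p ≤ -2 := hp
      have : S (hgt p + 2) = 0 := Real.smoothTransition.zero_of_nonpos (by linarith)
      simp [s, this]
  · rintro p (hp | hp)
    · show a p = 0
      simp [a, hp.1]
    · have hp' : hgt p ≤ -2 := hp
      have : S (hgt p + δ + 1) = 0 := Real.smoothTransition.zero_of_nonpos (by linarith)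
      show a p = 0
      simp [a, this]
  · rw [image_comp, hVi]
    rintro _ ⟨q, hq, rfl⟩
    have hq' : -δ + ‖flat q‖ ^ 2 ≤ hgt q := hq
    have ht : -δ ≤ hgt q := by nlinarith [sq_nonneg (‖flat q‖)]
    have hst : s (hgt q) = s₀ (hgt q) := by
      have : S (hgt q + 2) = 1 := Real.smoothTransition.one_of_one_le (by linarith)
      simp [s, this]
    refine (heP (hgt q)).2.2.2 ht _ (by simp) ?_
    simp only [hst, map_add, map_smul, flat_flat, flat_vert, smul_zero, add_zero, norm_smul]
    rw [Real.norm_of_nonneg (hs₀p _).le]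
    -- The slice of the paraboloid at height `t` has squared radius at most `t + δ`; this explains
    -- the denominator of `s₀`.
    have h3 : ‖flat q‖ ≤ 1 + (hgt q + 2) ^ 2 := by
      nlinarith [norm_nonneg (flat q), sq_nonneg (‖flat q‖ - 1), sq_nonneg (hgt q + 1)]
    calc s₀ (hgt q) * ‖flat q‖ ≤ s₀ (hgt q) * (1 + (hgt q + 2) ^ 2) := by
          gcongr
          exact (hs₀p _).le
      _ = e (hgt q) := by
          simp only [s₀]; field_simp

namespace IsRayChart

variable {Z : Type} [TopologicalSpace Z] [DiscreteTopology Z] {τ N : Set E3} {ψ : Z → E3 → E3}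

/-- Fixing everything below a level makes the supports closed in ℝ³, and fixing the half-axis in
each chart fixes all of `τ`. -/
theorem exists_transplant (hψ : IsRayChart τ N ψ) (c : Z → ℝ) {d : Z → E3 → E3}
    (h : ∀ z, IsotopicToIdRel (axisRay ∪ {p | hgt p ≤ c z}) (d z)) :
    ∃ D, IsotopicToIdRel τ D ∧ ∀ z x, D (ψ z x) = ψ z (d z x) := by
  obtain ⟨D, hD, hDψ⟩ := IsotopicToIdRel.transplant (Φ := ψ) (U := fun _ => univ)
    (B := fun z => axisRay ∪ {p | hgt p ≤ c z})
    (fun _ => isOpen_univ) (fun z => (hψ.smooth z).contDiffOn) (fun z x _ => hψ.immersion z x)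
    (fun z z' x x' _ _ h => hψ.eq_of_apply_eq z z' x x' h) (C := fun z => {p | c z ≤ hgt p})
    (fun _ => subset_univ _) (hψ.closed c) (fun z x hx => Or.inr (not_le.1 (show ¬ c z ≤ hgt x from hx)).le) h
  refine ⟨D, hD.mono ?_, fun z x => hDψ z x trivial⟩
  rw [hψ.ray]
  intro y hy z x _ hxy
  obtain ⟨z', x', hx', rfl⟩ := mem_iUnion.1 hy
  obtain ⟨-, rfl⟩ := hψ.eq_of_apply_eq _ _ _ _ hxy
  exact Or.inl hx'

theorem exists_shrink_to_image (hψ : IsRayChart τ N ψ) {c : Z → ℝ} (hc : ∀ z, c z < 0)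
    {d : Z → E3 → E3} (h : ∀ z, IsotopicToIdRel (axisRay ∪ {p | hgt p ≤ -2}) (d z)) :
    ∃ D, IsotopicToIdRel τ D ∧ D '' N = ⋃ z, ψ z '' (d z '' {p | c z ≤ hgt p}) := by
  obtain ⟨D₁, hD₁, hD₁N⟩ := hψ.shrink c hc
  obtain ⟨D₂, hD₂, hD₂ψ⟩ := hψ.exists_transplant (fun _ => -2) h
  refine ⟨D₂ ∘ D₁, hD₂.comp hD₁, ?_⟩
  rw [image_comp, hD₁N, image_iUnion]
  refine iUnion_congr fun z => ?_
  rw [image_image, image_image]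
  exact image_congr fun x _ => hD₂ψ z x

/-- Chart properties depend only on the half-axis and on the family of half-spaces above horizontal
planes, which such reparametrizations permute; negative levels must stay negative for `shrink` to
apply. -/
theorem reparam (hψ : IsRayChart τ N ψ) {w : Z → E3 → E3} {h : Z → ℝ → ℝ}
    (hw : ∀ z, ContDiff ℝ ∞ (w z)) (hwb : ∀ z, Bijective (w z))
    (hwd : ∀ z x, Injective (fderiv ℝ (w z) x))
    (hwh : ∀ z c, w z '' {p | c ≤ hgt p} = {p | h z c ≤ hgt p})
    (hh : ∀ z, ∀ c < 0, h z c < 0) (hwa : ∀ z, w z '' axisRay = axisRay) :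
    IsRayChart τ N fun z p => ψ z (w z p) := by
  have himg : ∀ z (S : Set E3), (fun p => ψ z (w z p)) '' S = ψ z '' (w z '' S) :=
    fun z S => by rw [image_image]
  refine ⟨fun z => (hψ.smooth z).comp (hw z), fun z x => ?_, fun z z' x x' hxx => ?_, fun c => ?_,
    ?_, fun c hc => ?_⟩
  · have h1 : HasFDerivAt (fun p => ψ z (w z p))
        ((fderiv ℝ (ψ z) (w z x)).comp (fderiv ℝ (w z) x)) x :=
      HasFDerivAt.comp (g := ψ z) x (((hψ.smooth z).differentiable (by simp)) _).hasFDerivAt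
        (((hw z).differentiable (by simp)) x).hasFDerivAt
    rw [h1.fderiv]
    exact (hψ.immersion z _).comp (hwd z x)
  · obtain ⟨rfl, h1⟩ := hψ.eq_of_apply_eq _ _ _ _ hxx
    exact ⟨rfl, (hwb z).1 h1⟩
  · simp only [himg, hwh]
    exact hψ.closed fun z => h z (c z)
  · simp only [himg, hwa]
    exact hψ.ray
  · simp only [himg, hwh]
    exact hψ.shrink (fun z => h z (c z)) fun z => hh z _ (hc z)

end IsRayChart

/-! ### Level-preserving maps and normalization along the axis -/

/-- The map of `ℝ³` which carries horizontal planes linearly to horizontal planes, with linear part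
`L t` at height `t`, and changes heights by `h`. -/
noncomputable def levelMap (L : ℝ → E3 →L[ℝ] E3) (h : ℝ → ℝ) (p : E3) : E3 :=
  flat (L (hgt p) (flat p)) + h (hgt p) • vert

section LevelMap

variable {L : ℝ → E3 →L[ℝ] E3} {h : ℝ → ℝ}

@[simp] theorem flat_levelMap (p : E3) : flat (levelMap L h p) = flat (L (hgt p) (flat p)) := by
  simp [levelMap]

@[simp] theorem hgt_levelMap (p : E3) : hgt (levelMap L h p) = h (hgt p) := by simp [levelMap]

theorem contDiff_levelMap (hL : ContDiff ℝ ∞ L) (hh : ContDiff ℝ ∞ h) :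
    ContDiff ℝ ∞ (levelMap L h) :=
  (flat.contDiff.comp ((hL.comp hgt.contDiff).clm_apply flat.contDiff)).add
    ((hh.comp hgt.contDiff).smul contDiff_const)

theorem fderiv_levelMap (hL : ContDiff ℝ ∞ L) (hh : ContDiff ℝ ∞ h) (p v : E3) :
    fderiv ℝ (levelMap L h) p v =
      (flat (L (hgt p) (flat v)) + hgt v • flat (deriv L (hgt p) (flat p))) +
      (deriv h (hgt p) * hgt v) • vert := by
  have h1 : HasFDerivAt (fun p => L (hgt p)) (hgt.smulRight (deriv L (hgt p))) p := by
    have := ((hL.differentiable (by simp)) (hgt p)).hasDerivAt.hasFDerivAt.comp p hgt.hasFDerivAt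
    refine this.congr_fderiv ?_
    ext; simp
  have h2 : HasFDerivAt (fun p => h (hgt p)) (deriv h (hgt p) • hgt) p :=
    ((hh.differentiable (by simp)) (hgt p)).hasDerivAt.comp_hasFDerivAt p hgt.hasFDerivAt
  have h3 := (flat.hasFDerivAt.comp p (h1.clm_apply flat.hasFDerivAt)).add (h2.smul_const vert)
  have h4 : HasFDerivAt (levelMap L h) _ p := h3
  rw [h4.fderiv]
  simp

theorem injective_fderiv_levelMap (hL : ContDiff ℝ ∞ L) (hh : ContDiff ℝ ∞ h)
    (hLi : ∀ t v, flat v = v → flat (L t v) = 0 → v = 0) (hh' : ∀ t, 0 < deriv h t) (p : E3) :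
    Injective (fderiv ℝ (levelMap L h) p) := by
  rw [injective_iff_map_eq_zero]
  intro v hv
  rw [fderiv_levelMap hL hh] at hv
  have h1 : hgt v = 0 := by
    have := congrArg hgt hv
    simpa [(hh' _).ne'] using this
  have h2 := congrArg flat hv
  simp only [h1, zero_smul, mul_zero, add_zero, map_zero, flat_flat] at h2
  rw [← flat_eq_self h1, hLi _ _ (flat_flat v) h2]

theorem bijective_levelMap (hLi : ∀ t v, flat v = v → flat (L t v) = 0 → v = 0)
    (hb : Bijective h) : Bijective (levelMap L h) := by
  constructor
  · intro p q hpq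
    have h1 : hgt p = hgt q := hb.1 (by simpa using congrArg hgt hpq)
    have h2 := congrArg flat hpq
    rw [flat_levelMap, flat_levelMap, h1, ← sub_eq_zero, ← map_sub, ← map_sub] at h2
    have h3 := hLi _ _ (by rw [map_sub, flat_flat, flat_flat]) h2
    exact ext_flat_hgt (sub_eq_zero.1 h3) h1
  · intro q
    obtain ⟨t, ht⟩ := hb.2 (hgt q)
    -- The horizontal linear part, completed by the identity in the vertical direction so as to be
    -- an endomorphism of ℝ³.
    obtain ⟨e, he⟩ := exists_equiv_of_injective (flat.comp ((L t).comp flat) + hgt.smulRight vert)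
      (by
        rw [injective_iff_map_eq_zero]
        intro v hv
        have h1 : hgt v = 0 := by simpa using congrArg hgt hv
        have h2 := congrArg flat hv
        simp only [add_apply, ContinuousLinearMap.comp_apply,
          ContinuousLinearMap.smulRight_apply, h1, zero_smul, add_zero, flat_flat, map_zero] at h2
        rw [← flat_eq_self h1, hLi _ _ (flat_flat v) h2])
    have h1 : flat (L t (flat (e.symm (flat q)))) = flat q := by
      have h2 : (e : E3 →L[ℝ] E3) (e.symm (flat q)) = flat q := e.apply_symm_apply _
      rw [he] at h2
      have := congrArg flat h2
      simpa using this
    refine ⟨flat (e.symm (flat q)) + t • vert, ext_flat_hgt ?_ ?_⟩ <;> simp [h1, ht]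

theorem image_levelMap_le (hLi : ∀ t v, flat v = v → flat (L t v) = 0 → v = 0)
    (hb : Bijective h) (hm : StrictMono h) (c : ℝ) :
    levelMap L h '' {p | c ≤ hgt p} = {p | h c ≤ hgt p} := by
  ext q
  constructor
  · rintro ⟨p, hp, rfl⟩
    show h c ≤ hgt (levelMap L h p)
    rw [hgt_levelMap]
    exact hm.monotone hp
  · intro hq
    obtain ⟨p, rfl⟩ := (bijective_levelMap hLi hb).2 q
    have hq' : h c ≤ hgt (levelMap L h p) := hq
    rw [hgt_levelMap, hm.le_iff_le] at hq'
    exact ⟨p, hq', rfl⟩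

theorem levelMap_smul_vert (t : ℝ) : levelMap L h (t • vert) = h t • vert := by
  simp [levelMap]

theorem image_levelMap_axisRay (hb : Bijective h) (hm : StrictMono h) (h0 : h 0 = 0) :
    levelMap L h '' axisRay = axisRay := by
  ext q
  rw [mem_axisRay_iff]
  constructor
  · rintro ⟨p, hp, rfl⟩
    obtain ⟨t, ht, rfl⟩ := mem_axisRay_iff.1 hp
    exact ⟨h t, by rw [← h0]; exact hm.monotone ht, levelMap_smul_vert t⟩
  · rintro ⟨t, ht, rfl⟩
    obtain ⟨s, rfl⟩ := hb.2 t
    rw [← h0, hm.le_iff_le] at ht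
    exact ⟨s • vert, mem_axisRay_iff.2 ⟨s, ht, rfl⟩, levelMap_smul_vert s⟩

end LevelMap

/-- A reparametrization of `ℝ³` which preserves the half-axis and the family of horizontal planes. -/
structure IsAxisReparam (w : E3 → E3) (h : ℝ → ℝ) : Prop where
  smooth : ContDiff ℝ ∞ w
  bijective : Bijective w
  immersion : ∀ p, Injective (fderiv ℝ w p)
  image_le : ∀ c, w '' {p | c ≤ hgt p} = {p | h c ≤ hgt p}
  neg : ∀ c < 0, h c < 0
  image_axisRay : w '' axisRay = axisRay

theorem isAxisReparam_levelMap {L : ℝ → E3 →L[ℝ] E3} {h : ℝ → ℝ} (hL : ContDiff ℝ ∞ L)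
    (hh : ContDiff ℝ ∞ h) (hLi : ∀ t v, flat v = v → flat (L t v) = 0 → v = 0)
    (hh' : ∀ t, 0 < deriv h t) (hs : Surjective h) (h0 : h 0 = 0) :
    IsAxisReparam (levelMap L h) h := by
  have hm : StrictMono h := strictMono_of_deriv_pos hh'
  have hb : Bijective h := ⟨hm.injective, hs⟩
  exact ⟨contDiff_levelMap hL hh, bijective_levelMap hLi hb,
    injective_fderiv_levelMap hL hh hLi hh', image_levelMap_le hLi hb hm,
    fun c hc => h0 ▸ hm hc, image_levelMap_axisRay hb hm h0⟩

theorem IsRayChart.comp_reparam {Z : Type} [TopologicalSpace Z] [DiscreteTopology Z]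
    {τ N : Set E3} {ψ : Z → E3 → E3} (hψ : IsRayChart τ N ψ) {w : Z → E3 → E3} {h : Z → ℝ → ℝ}
    (hw : ∀ z, IsAxisReparam (w z) (h z)) : IsRayChart τ N fun z p => ψ z (w z p) :=
  hψ.reparam (fun z => (hw z).smooth) (fun z => (hw z).bijective) (fun z => (hw z).immersion)
    (fun z => (hw z).image_le) (fun z => (hw z).neg) fun z => (hw z).image_axisRay

/-- The derivative of a map which preserves the vertical half-axis, along it. -/
theorem exists_axis_speed {O : Set E3} (hO : IsOpen O) (hax : axisRay ⊆ O) {m : E3 → E3}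
    (hm : ContDiffOn ℝ ∞ m O) (hmi : ∀ p ∈ axisRay, Injective (fderiv ℝ m p))
    (hma : m '' axisRay = axisRay) :
    (∀ t : ℝ, 0 ≤ t → m (t • vert) = hgt (m (t • vert)) • vert ∧
      fderiv ℝ m (t • vert) vert = hgt (fderiv ℝ m (t • vert) vert) • vert ∧
      0 < hgt (fderiv ℝ m (t • vert) vert)) ∧ m 0 = 0 ∧
      ∀ s, 0 ≤ s → ∃ t : ℝ, 0 ≤ t ∧ hgt (m (t • vert)) = s := by
  have hax' : ∀ t : ℝ, 0 ≤ t → t • vert ∈ axisRay := fun t ht => mem_axisRay_iff.2 ⟨t, ht, rfl⟩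
  have hd : ∀ t : ℝ, 0 ≤ t → HasDerivAt (fun t : ℝ => m (t • vert)) (fderiv ℝ m (t • vert) vert) t :=
    fun t ht => by
      have h1 := ((hm.contDiffAt (hO.mem_nhds (hax (hax' t ht)))).differentiableAt
        (by simp)).hasFDerivAt
      have h2 : HasDerivAt (fun t : ℝ => t • vert) vert t := by
        simpa using (hasDerivAt_id t).smul_const vert
      exact h1.comp_hasDerivAt t h2
  have hflat : ∀ t : ℝ, 0 ≤ t → flat (m (t • vert)) = 0 := fun t ht => by
    have : m (t • vert) ∈ axisRay := hma ▸ mem_image_of_mem m (hax' t ht)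
    obtain ⟨s, -, hs⟩ := mem_axisRay_iff.1 this
    rw [hs]; simp
  have hrange : ∀ t : ℝ, 0 ≤ t → 0 ≤ hgt (m (t • vert)) := fun t ht => by
    have : m (t • vert) ∈ axisRay := hma ▸ mem_image_of_mem m (hax' t ht)
    obtain ⟨s, hs0, hs⟩ := mem_axisRay_iff.1 this
    rw [hs]; simpa
  have hsurj : ∀ s, 0 ≤ s → ∃ t : ℝ, 0 ≤ t ∧ hgt (m (t • vert)) = s := fun s hs => by
    have : s • vert ∈ m '' axisRay := by rw [hma]; exact hax' s hs
    obtain ⟨p, hp, hps⟩ := this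
    obtain ⟨t, ht, rfl⟩ := mem_axisRay_iff.1 hp
    exact ⟨t, ht, by rw [hps]; simp⟩
  have hfd : ∀ t : ℝ, 0 ≤ t → flat (fderiv ℝ m (t • vert) vert) = 0 := fun t ht => by
    have h1 : HasDerivWithinAt (fun t : ℝ => flat (m (t • vert)))
        (flat (fderiv ℝ m (t • vert) vert)) (Ici 0) t :=
      (flat.hasFDerivAt.comp_hasDerivAt t (hd t ht)).hasDerivWithinAt
    have h2 : HasDerivWithinAt (fun t : ℝ => flat (m (t • vert))) 0 (Ici 0) t :=
      (hasDerivWithinAt_const t (Ici 0) (0 : E3)).congr (fun s hs => hflat s hs) (hflat t ht)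
    exact (uniqueDiffOn_Ici (0 : ℝ) t ht).eq_deriv _ h1 h2
  set a : ℝ → ℝ := fun t => hgt (m (t • vert))
  set a' : ℝ → ℝ := fun t => hgt (fderiv ℝ m (t • vert) vert)
  have hda : ∀ t : ℝ, 0 ≤ t → HasDerivAt a (a' t) t := fun t ht =>
    hgt.hasFDerivAt.comp_hasDerivAt t (hd t ht)
  have hne : ∀ t : ℝ, 0 ≤ t → a' t ≠ 0 := fun t ht h0 => by
    have h1 : fderiv ℝ m (t • vert) vert = 0 :=
      ext_flat_hgt (by rw [hfd t ht, map_zero]) (by rw [map_zero]; exact h0)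
    have h2 := (injective_iff_map_eq_zero _).1 (hmi _ (hax' t ht)) _ h1
    have := norm_vert
    rw [h2] at this; simp at this
  have hc : ContinuousOn a' (Ici 0) := by
    refine hgt.continuous.comp_continuousOn (ContinuousOn.clm_apply ?_ continuousOn_const)
    exact (hm.continuousOn_fderiv_of_isOpen hO (by simp)).comp
      (continuous_id.smul continuous_const).continuousOn fun t ht => hax (hax' t ht)
  have hcont : ContinuousOn a (Ici 0) := fun t ht => (hda t ht).continuousAt.continuousWithinAt
  -- The speed never vanishes, so it has constant sign. A negative sign would bound `a` by `a 0`,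
  -- but `a` maps onto `[0, ∞)`.
  have hpos : ∀ t : ℝ, 0 ≤ t → 0 < a' t := by
    by_contra! hcon
    obtain ⟨t₁, ht₁, h1⟩ := hcon
    have hneg : ∀ t : ℝ, 0 ≤ t → a' t < 0 := fun t ht => by
      by_contra! h2
      have hz : (0 : ℝ) ∈ a' '' Ici 0 := by
        have hcn := (isPreconnected_Ici (a := (0 : ℝ))).image a' hc
        exact hcn.ordConnected.out (mem_image_of_mem a' ht₁) (mem_image_of_mem a' ht) ⟨h1, h2⟩
      obtain ⟨s, hs, hs0⟩ := hz
      exact hne s hs hs0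
    have hanti : StrictAntiOn a (Ici 0) := by
      refine strictAntiOn_of_deriv_neg (convex_Ici 0) hcont fun x hx => ?_
      rw [interior_Ici] at hx
      rw [(hda x (le_of_lt hx)).deriv]
      exact hneg x (le_of_lt hx)
    obtain ⟨t, ht, hts⟩ := hsurj (a 0 + 1) (by have := hrange 0 le_rfl; positivity)
    have : a t ≤ a 0 := hanti.antitoneOn (mem_Ici.2 le_rfl) ht ht
    have h3 : a t = a 0 + 1 := hts
    linarith
  have hmono : StrictMonoOn a (Ici 0) := by
    refine strictMonoOn_of_deriv_pos (convex_Ici 0) hcont fun x hx => ?_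
    rw [interior_Ici] at hx
    rw [(hda x (le_of_lt hx)).deriv]
    exact hpos x (le_of_lt hx)
  refine ⟨fun t ht => ⟨?_, ?_, hpos t ht⟩, ?_, hsurj⟩
  · exact ext_flat_hgt (by rw [hflat t ht]; simp) (by simp)
  · exact ext_flat_hgt (by rw [hfd t ht]; simp) (by simp)
  · obtain ⟨t, ht, hts⟩ := hsurj 0 le_rfl
    have h1 : a 0 ≤ a t := hmono.monotoneOn (mem_Ici.2 le_rfl) ht ht
    have h2 : a t = 0 := hts
    have h3 := hrange 0 le_rfl
    have h4 := hflat 0 le_rfl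
    have h5 : a 0 = hgt (m 0) := by simp [a]
    rw [zero_smul] at h3 h4
    refine ext_flat_hgt (by rw [h4, map_zero]) ?_
    rw [map_zero]; linarith

/-- Along the axis the derivative of `m` sends `vert` to a positive multiple of itself. The map `w'`
reproduces this speed and the horizontal block of the derivative, so only a vertical shear of
horizontal vectors remains. Scaling the horizontal directions on both sides by the same small `s t`
leaves the diagonal blocks equal to the identity and multiplies the shear by `s t`. -/
theorem exists_axis_normalization {O : Set E3} (hO : IsOpen O) (hax : axisRay ⊆ O) {m : E3 → E3}
    (hm : ContDiffOn ℝ ∞ m O) (hmi : ∀ p ∈ axisRay, Injective (fderiv ℝ m p))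
    (hma : m '' axisRay = axisRay) {η : ℝ} (hη : 0 < η) :
    ∃ w h w' h' O' m', IsAxisReparam w h ∧ IsAxisReparam w' h' ∧ IsOpen O' ∧ axisRay ⊆ O' ∧
      ContDiffOn ℝ ∞ m' O' ∧
      (∀ p ∈ axisRay, m' p = p ∧ ‖fderiv ℝ m' p - ContinuousLinearMap.id ℝ E3‖ ≤ η) ∧
      ∀ p ∈ O', w p ∈ O ∧ w' (m' p) = m (w p) := by
  obtain ⟨hm1, hm0, hsurj⟩ := exists_axis_speed hO hax hm hmi hma
  have hax' : ∀ t : ℝ, 0 ≤ t → t • vert ∈ axisRay := fun t ht => mem_axisRay_iff.2 ⟨t, ht, rfl⟩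
  -- The horizontal block of a linear map, completed by the identity on the vertical direction.
  let T : (E3 →L[ℝ] E3) → (E3 →L[ℝ] E3) := fun M => flat.comp (M.comp flat) + hgt.smulRight vert
  have hT : Continuous T := by
    refine Continuous.add ?_ continuous_const
    exact continuous_const.clm_comp (continuous_id.clm_comp continuous_const)
  have hfd : ContinuousOn (fderiv ℝ m) O := hm.continuousOn_fderiv_of_isOpen hO (by simp)
  obtain ⟨δ, hδ, -, hδO⟩ := exists_axis_extension
    (O := O ∩ fderiv ℝ m ⁻¹' ({M | 0 < hgt (M vert)} ∩ T ⁻¹' {M | Injective M})) (by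
      refine hfd.isOpen_inter_preimage hO (IsOpen.inter ?_ ?_)
      · exact isOpen_lt continuous_const
          (hgt.continuous.comp (continuous_id.clm_apply continuous_const))
      · refine IsOpen.preimage hT ?_
        exact ContinuousLinearMap.isOpen_injective) (by
      intro p hp
      obtain ⟨t, ht, rfl⟩ := mem_axisRay_iff.1 hp
      obtain ⟨-, h2, h3⟩ := hm1 t ht
      refine ⟨hax hp, h3, ?_⟩
      show Injective (T (fderiv ℝ m (t • vert)))
      rw [injective_iff_map_eq_zero]
      intro v hv
      have h4 : hgt v = 0 := by simpa [T] using congrArg hgt hv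
      have h5 : flat (fderiv ℝ m (t • vert) v) = 0 := by
        have := congrArg flat hv
        simpa [T, h4, flat_eq_self h4] using this
      set M := fderiv ℝ m (t • vert)
      -- If the horizontal part of `M v` vanishes, then `M v` is a multiple of `M vert`; injectivity
      -- of `M` makes the horizontal vector `v` a multiple of `vert`, hence zero.
      have h6 : M (v - (hgt (M v) / hgt (M vert)) • vert) = 0 := by
        rw [map_sub, map_smul, h2]
        refine ext_flat_hgt (by simp [h5]) ?_
        simp [h3.ne']
      have h7 := (injective_iff_map_eq_zero _).1 (hmi _ hp) _ h6
      have h8 := congrArg flat h7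
      simpa [flat_eq_self h4] using h8)
  -- the clamped height
  let β : ℝ → ℝ := fun t => t * Real.smoothTransition (1 + t / δ)
  have hβ : ContDiff ℝ ∞ β := contDiff_id.mul (Real.smoothTransition.contDiff.comp
    (contDiff_const.add (contDiff_id.div_const δ)))
  have hβp : ∀ t, 0 ≤ t → β t = t := fun t ht => by
    have : Real.smoothTransition (1 + t / δ) = 1 :=
      Real.smoothTransition.one_of_one_le (by have : 0 ≤ t / δ := by positivity
                                              linarith)
    simp [β, this]
  have hβn : ∀ t, t ≤ -δ → β t = 0 := fun t ht => by
    have : Real.smoothTransition (1 + t / δ) = 0 :=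
      Real.smoothTransition.zero_of_nonpos (by
        have : t / δ ≤ -1 := by rw [div_le_iff₀ hδ]; linarith
        linarith)
    simp [β, this]
  have hβδ : ∀ t, -δ ≤ β t := fun t => by
    rcases le_total t (-δ) with h | h
    · rw [hβn t h]; linarith
    · have h0 := Real.smoothTransition.nonneg (1 + t / δ)
      have h1 := Real.smoothTransition.le_one (1 + t / δ)
      show -δ ≤ t * Real.smoothTransition (1 + t / δ)
      rcases le_total 0 t with h2 | h2
      · have := mul_nonneg h2 h0
        linarith
      · nlinarith
  let M : ℝ → E3 →L[ℝ] E3 := fun t => fderiv ℝ m (β t • vert)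
  have hM : ContDiff ℝ ∞ M := by
    refine ContDiffOn.comp_contDiff (s := O) (g := fderiv ℝ m)
      (hm.fderiv_of_isOpen hO (by simp)) (hβ.smul contDiff_const) fun t => ?_
    exact (hδO _ (hβδ t)).1
  have hMT : ∀ t, Injective (T (M t)) := fun t => (hδO _ (hβδ t)).2.2
  let v : ℝ → ℝ := fun t => hgt (M t vert)
  have hv0 : ∀ t, 0 < v t := fun t => (hδO _ (hβδ t)).2.1
  have hv : ContDiff ℝ ∞ v := hgt.contDiff.comp (hM.clm_apply contDiff_const)
  -- This primitive extends the height of `m` along the half-axis to all of ℝ. Below `-δ` the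
  -- clamped speed is a positive constant, so it is affine there and reaches arbitrarily negative
  -- heights.
  let h : ℝ → ℝ := fun t => ∫ u in (0 : ℝ)..t, v u
  have hhd : ∀ t, HasDerivAt h (v t) t := fun t =>
    intervalIntegral.integral_hasDerivAt_right (hv.continuous.intervalIntegrable _ _)
      (hv.continuous.stronglyMeasurableAtFilter _ _) hv.continuous.continuousAt
  have hhd' : deriv h = v := funext fun t => (hhd t).deriv
  have hh : ContDiff ℝ ∞ h := by
    rw [contDiff_infty_iff_deriv, hhd']
    exact ⟨fun t => (hhd t).differentiableAt, hv⟩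
  have h0 : h 0 = 0 := by simp [h]
  have hha : ∀ t, 0 ≤ t → h t = hgt (m (t • vert)) := fun t ht => by
    have h1 : ∀ u ∈ uIcc 0 t, HasDerivAt (fun t : ℝ => hgt (m (t • vert))) (v u) u := by
      intro u hu
      rw [uIcc_of_le ht] at hu
      have h1 := ((hm.contDiffAt (hO.mem_nhds (hax (hax' u hu.1)))).differentiableAt
        (by simp)).hasFDerivAt
      have h2 : HasDerivAt (fun t : ℝ => t • vert) vert u := by
        simpa using (hasDerivAt_id u).smul_const vert
      have h3 := hgt.hasFDerivAt.comp_hasDerivAt u (h1.comp_hasDerivAt u h2)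
      simp only [v, M, hβp u hu.1]
      exact h3
    have h2 := intervalIntegral.integral_eq_sub_of_hasDerivAt h1
      (hv.continuous.intervalIntegrable _ _)
    simp only [h, h2]
    simp [hm0]
  have hs : Surjective h := by
    intro s
    rcases le_total 0 s with hs | hs
    · obtain ⟨t, ht, hts⟩ := hsurj s hs
      exact ⟨t, by rw [hha t ht, hts]⟩
    · have hlin : ∀ t, t ≤ -δ → h t = h (-δ) + v (-δ) * (t + δ) := fun t ht => by
        have h1 := intervalIntegral.integral_add_adjacent_intervals
          (hv.continuous.intervalIntegrable 0 (-δ)) (hv.continuous.intervalIntegrable (-δ) t)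
          (μ := MeasureTheory.volume)
        have h2 : ∫ u in (-δ)..t, v u = ∫ u in (-δ)..t, v (-δ) := by
          refine intervalIntegral.integral_congr fun u hu => ?_
          rw [uIcc_of_ge ht] at hu
          simp only [v, M, hβn u hu.2, hβn (-δ) le_rfl]
        rw [h2, intervalIntegral.integral_const, smul_eq_mul] at h1
        show (∫ u in (0 : ℝ)..t, v u) = (∫ u in (0 : ℝ)..(-δ), v u) + _
        rw [← h1]; ring
      have h1 : ∃ t, t ≤ 0 ∧ h t ≤ s := by
        have hvd := hv0 (-δ)
        refine ⟨-δ - |s - h (-δ)| / v (-δ), by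
          have : 0 ≤ |s - h (-δ)| / v (-δ) := by positivity
          linarith, ?_⟩
        rw [hlin _ (by
          have : 0 ≤ |s - h (-δ)| / v (-δ) := by positivity
          linarith)]
        have : v (-δ) * (-δ - |s - h (-δ)| / v (-δ) + δ) = -|s - h (-δ)| := by
          field_simp; ring
        rw [this]
        linarith [neg_abs_le (s - h (-δ))]
      obtain ⟨t, ht, hts⟩ := h1
      obtain ⟨u, -, hu⟩ := intermediate_value_Icc ht hh.continuous.continuousOn
        ⟨hts, h0.symm ▸ hs⟩
      exact ⟨u, hu⟩
  -- Small enough that the remaining shear, bounded by `s t * ‖M t‖ / v t`, has norm at most `η`.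
  obtain ⟨s, hsm, hs1⟩ := exists_contDiff_pos_le_and_norm_fderiv_le
    (δ := fun t : ℝ => η * v t / (‖M t‖ + 1))
    ((continuous_const.mul hv.continuous).div (hM.continuous.norm.add continuous_const)
      fun t => by positivity)
    fun t => div_pos (mul_pos hη (hv0 t)) (by positivity)
  have hs0 : ∀ t, 0 < s t := fun t => (hs1 t).1
  have hsle : ∀ t, s t * ‖M t‖ ≤ η * v t := fun t => by
    have h1 := (le_div_iff₀ (by positivity)).1 (hs1 t).2.1
    have := hs0 t
    nlinarith [norm_nonneg (M t)]
  have hTs : ContDiff ℝ ∞ fun t => T (M t) := by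
    refine ContDiff.add ?_ contDiff_const
    exact contDiff_const.clm_comp (hM.clm_comp contDiff_const)
  have hL : ContDiff ℝ ∞ fun t => s t • ContinuousLinearMap.id ℝ E3 := hsm.smul contDiff_const
  have hw : IsAxisReparam (levelMap (fun t => s t • ContinuousLinearMap.id ℝ E3) id) id := by
    refine isAxisReparam_levelMap hL contDiff_id (fun t v hv h => ?_)
      (fun t => by simp) surjective_id rfl
    simpa [hv, (hs0 t).ne'] using h
  have hL' : ContDiff ℝ ∞ (fun t => s t • T (M t)) := hsm.smul hTs
  have hw' : IsAxisReparam (levelMap (fun t => s t • T (M t)) h) h := by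
    refine isAxisReparam_levelMap hL' hh (fun t v hv h => ?_)
      (fun t => by rw [hhd']; exact hv0 t) hs h0
    have hvh : hgt v = 0 := by rw [← hv]; simp
    have h1 : flat (T (M t) v) = 0 := by simpa [(hs0 t).ne'] using h
    refine (injective_iff_map_eq_zero _).1 (hMT t) v (ext_flat_hgt (by rw [h1, map_zero]) ?_)
    simp [T, hvh]
  set w := levelMap (fun t => s t • ContinuousLinearMap.id ℝ E3) id
  set w' := levelMap (fun t => s t • T (M t)) h
  obtain ⟨g, hg, hgw, hwg⟩ := exists_smooth_inverse_of_bijective hw'.smooth hw'.bijective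
    hw'.immersion
  have hO' : IsOpen (w ⁻¹' O) := hO.preimage hw.smooth.continuous
  have haxO' : axisRay ⊆ w ⁻¹' O := fun p hp =>
    hax (hw.image_axisRay ▸ mem_image_of_mem w hp)
  have hm' : ContDiffOn ℝ ∞ (fun p => g (m (w p))) (w ⁻¹' O) :=
    hg.comp_contDiffOn (hm.comp hw.smooth.contDiffOn fun p hp => hp)
  refine ⟨w, id, w', h, w ⁻¹' O, fun p => g (m (w p)), hw, hw', hO', haxO', hm', ?_,
    fun p hp => ⟨hp, hwg _⟩⟩
  intro p hp
  obtain ⟨t, ht, rfl⟩ := mem_axisRay_iff.1 hp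
  have hwt : w (t • vert) = t • vert := levelMap_smul_vert t
  have hgt' : g (m (w (t • vert))) = t • vert := by
    have : w' (t • vert) = h t • vert := levelMap_smul_vert t
    rw [hwt, (hm1 t ht).1, ← hha t ht, ← this, hgw]
  refine ⟨hgt', ?_⟩
  set X := fderiv ℝ (fun p => g (m (w p))) (t • vert)
  have hX : HasFDerivAt (fun p => g (m (w p))) X (t • vert) :=
    ((hm'.contDiffAt (hO'.mem_nhds (haxO' hp))).differentiableAt (by simp)).hasFDerivAt
  have hMt : M t = fderiv ℝ m (t • vert) := by simp only [M, hβp t ht]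
  have hchain : ∀ x, fderiv ℝ w' (t • vert) (X x) = M t (fderiv ℝ w (t • vert) x) := fun x => by
    have h1 : HasFDerivAt (fun p => w' (g (m (w p))))
        ((fderiv ℝ w' (t • vert)).comp X) (t • vert) := by
      refine HasFDerivAt.comp (g := w') (t • vert) ?_ hX
      rw [hgt']
      exact (hw'.smooth.differentiable (by simp) _).hasFDerivAt
    have h2 : HasFDerivAt (fun p => m (w p))
        ((M t).comp (fderiv ℝ w (t • vert))) (t • vert) := by
      refine HasFDerivAt.comp (g := m) (t • vert) ?_
        (hw.smooth.differentiable (by simp) _).hasFDerivAt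
      rw [hwt, hMt]
      exact ((hm.contDiffAt (hO.mem_nhds (hax hp))).differentiableAt (by simp)).hasFDerivAt
    simp only [hwg] at h1
    exact congrArg (fun A : E3 →L[ℝ] E3 => A x) (h1.unique h2)
  have hMv : M t vert = v t • vert := by
    simp only [v]
    rw [hMt]; exact (hm1 t ht).2.1
  refine ContinuousLinearMap.opNorm_le_bound _ hη.le fun x => ?_
  -- Only the vertical component of the image of a horizontal vector is not cancelled by `w'`.
  have hXx : X x = x + (s t * hgt (M t (flat x)) / v t) • vert := by
    apply hw'.immersion (t • vert)
    rw [hchain, fderiv_levelMap hL' hh, fderiv_levelMap hL contDiff_id]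
    refine ext_flat_hgt ?_ ?_
    · simp [T, hMv]
    · simp [T, hMv, hhd']
      have := (hv0 t).ne'
      field_simp
      ring
  have h1 : |hgt (M t (flat x))| ≤ ‖M t‖ * ‖x‖ :=
    (abs_hgt_le _).trans (((M t).le_opNorm _).trans (by gcongr; exact norm_flat_le x))
  rw [sub_apply, hXx, ContinuousLinearMap.id_apply, add_sub_cancel_left, norm_smul, norm_vert,
    mul_one, Real.norm_eq_abs, abs_div, abs_mul, abs_of_pos (hs0 t), abs_of_pos (hv0 t),
    div_le_iff₀ (hv0 t)]
  calc s t * |hgt (M t (flat x))| ≤ s t * (‖M t‖ * ‖x‖) := by have := hs0 t; gcongr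
    _ = s t * ‖M t‖ * ‖x‖ := by ring
    _ ≤ η * v t * ‖x‖ := mul_le_mul_of_nonneg_right (hsle t) (norm_nonneg x)
    _ = η * ‖x‖ * v t := by ring

/-! ### Interpolation with the identity near the axis -/

/-- A bound for the displacement of a map which fixes the vertical half-axis, in a tube around it. -/
theorem norm_sub_le_of_tube {O : Set E3} {u : E3 → E3} {K δ : ℝ} (hK : 0 ≤ K) (hδ : 0 ≤ δ)
    {e : ℝ → ℝ} (he : ∀ t, 0 < e t)
    (hO : ∀ p, -δ ≤ hgt p → ‖flat p‖ ≤ e (hgt p) → p ∈ O)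
    (hu : ∀ p ∈ O, DifferentiableAt ℝ u p) (hd : ∀ p ∈ O, ‖fderiv ℝ u p‖ ≤ K)
    (h0 : ∀ p ∈ axisRay, u p = 0) {p : E3} (hp : -δ ≤ hgt p) (hpe : ‖flat p‖ ≤ e (hgt p)) :
    ‖u p‖ ≤ K * (e (hgt p) + max 0 (-hgt p)) := by
  have h1 : ‖u p - u (hgt p • vert)‖ ≤ K * ‖p - hgt p • vert‖ := by
    have hc : Convex ℝ {q : E3 | hgt q = hgt p ∧ ‖flat q‖ ≤ e (hgt p)} := by
      have := ((convex_singleton (𝕜 := ℝ) (hgt p)).linear_preimage (hgt : E3 →ₗ[ℝ] ℝ)).inter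
        ((convex_closedBall (0 : E3) (e (hgt p))).linear_preimage (flat : E3 →ₗ[ℝ] E3))
      refine (congrArg (Convex ℝ) ?_).mp this
      ext q; simp
    have hs : ∀ q ∈ {q : E3 | hgt q = hgt p ∧ ‖flat q‖ ≤ e (hgt p)}, q ∈ O := fun q hq =>
      hO q (by rw [hq.1]; exact hp) (by rw [hq.1]; exact hq.2)
    exact hc.norm_image_sub_le_of_norm_fderiv_le (fun q hq => hu q (hs q hq))
      (fun q hq => hd q (hs q hq)) ⟨by simp, by simpa using (he _).le⟩ ⟨rfl, hpe⟩
  have h2 : ‖u (hgt p • vert)‖ ≤ K * max 0 (-hgt p) := by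
    rcases le_total 0 (hgt p) with h | h
    · rw [h0 _ (mem_axisRay_iff.2 ⟨_, h, rfl⟩), norm_zero]; positivity
    · have hc : Convex ℝ {q : E3 | -δ ≤ hgt q ∧ flat q = 0} := by
        have := ((convex_Ici (𝕜 := ℝ) (-δ)).linear_preimage (hgt : E3 →ₗ[ℝ] ℝ)).inter
          ((convex_singleton (𝕜 := ℝ) (0 : E3)).linear_preimage (flat : E3 →ₗ[ℝ] E3))
        refine (congrArg (Convex ℝ) ?_).mp this
        ext q; simp
      have hs : ∀ q ∈ {q : E3 | -δ ≤ hgt q ∧ flat q = 0}, q ∈ O := fun q hq =>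
        hO q hq.1 (by rw [hq.2, norm_zero]; exact (he _).le)
      have := hc.norm_image_sub_le_of_norm_fderiv_le (fun q hq => hu q (hs q hq))
        (fun q hq => hd q (hs q hq)) (x := 0) (y := hgt p • vert) ⟨by simpa, by simp⟩
        ⟨by simpa, by simp⟩
      rw [h0 0 (mem_axisRay_iff.2 ⟨0, le_rfl, by simp⟩), sub_zero, sub_zero, norm_smul, norm_vert,
        mul_one, Real.norm_eq_abs, abs_of_nonpos h] at this
      rwa [max_eq_right (by linarith)]
  have h3 : ‖p - hgt p • vert‖ ≤ e (hgt p) := by rw [← flat_apply]; exact hpe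
  calc ‖u p‖ = ‖u p - u (hgt p • vert) + u (hgt p • vert)‖ := by rw [sub_add_cancel]
    _ ≤ _ := norm_add_le _ _
    _ ≤ K * e (hgt p) + K * max 0 (-hgt p) := by gcongr; exact h1.trans (by gcongr)
    _ = _ := by ring

/-- A cutoff function for tubes around the vertical half-axis. -/
theorem exists_tube_cutoff {C : ℝ} (hC : 0 < C)
    (hC' : ∀ x, 0 ≤ deriv Real.smoothTransition x ∧ deriv Real.smoothTransition x ≤ C)
    {e : ℝ → ℝ} (he : ContDiff ℝ ∞ e) (he0 : ∀ t, 0 < e t) (he' : ∀ t, |deriv e t| ≤ 1 / 2) :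
    ∃ χ : E3 → ℝ, ContDiff ℝ ∞ χ ∧ (∀ p, 0 ≤ χ p ∧ χ p ≤ 1) ∧
      (∀ p, hgt p ≤ -e 0 ∨ e (hgt p) ≤ ‖flat p‖ → χ p = 0) ∧
      (∀ p, -(e 0 / 2) ≤ hgt p → 2 * ‖flat p‖ ^ 2 ≤ e (hgt p) ^ 2 → χ p = 1) ∧
      ∀ p, -e 0 ≤ hgt p → ‖flat p‖ ≤ e (hgt p) →
        max 0 (-hgt p) ≤ 2 * e (hgt p) ∧ ‖fderiv ℝ χ p‖ ≤ 9 * C / e (hgt p) := by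
  set S := Real.smoothTransition
  have hS : ContDiff ℝ ∞ S := Real.smoothTransition.contDiff
  have hS0 := Real.smoothTransition.nonneg
  have hS1 := Real.smoothTransition.le_one
  set δ := e 0 with hδ
  have hδ0 : 0 < δ := he0 0
  have hed := he.differentiable (by simp)
  -- Radial cutoff variable: nonpositive outside radius `e`, at least 1 where `2 ‖flat p‖ ^ 2 ≤ e ^
  -- 2`. The function `k` plays the same role for heights between `-δ` and `-δ / 2`.
  let g : E3 → ℝ := fun p => 2 - 2 * (‖flat p‖ ^ 2 * ((e (hgt p)) ^ 2)⁻¹)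
  let k : E3 → ℝ := fun p => 2 + 2 * hgt p / δ
  have hg : ContDiff ℝ ∞ g := contDiff_const.sub (contDiff_const.mul
    ((flat.contDiff.norm_sq ℝ).mul
      (((he.comp hgt.contDiff).pow 2).inv fun p => (pow_pos (he0 _) 2).ne')))
  have hk : ContDiff ℝ ∞ k := contDiff_const.add ((contDiff_const.mul hgt.contDiff).div_const δ)
  refine ⟨fun p => S (g p) * S (k p), (hS.comp hg).mul (hS.comp hk),
    fun p => ⟨mul_nonneg (hS0 _) (hS0 _), mul_le_one₀ (hS1 _) (hS0 _) (hS1 _)⟩, ?_, ?_, ?_⟩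
  · rintro p (hp | hp)
    · have : S (k p) = 0 := Real.smoothTransition.zero_of_nonpos (by
        have : 2 * hgt p / δ ≤ -2 := by rw [div_le_iff₀ hδ0]; linarith
        simp only [k]; linarith)
      simp [this]
    · have : S (g p) = 0 := Real.smoothTransition.zero_of_nonpos (by
        have h1 : 1 ≤ ‖flat p‖ ^ 2 * ((e (hgt p)) ^ 2)⁻¹ := by
          rw [← div_eq_mul_inv, one_le_div (pow_pos (he0 _) 2)]
          have := he0 (hgt p)
          gcongr
        simp only [g]; linarith)
      simp [this]
  · intro p hp hpe
    have h1 : S (k p) = 1 := Real.smoothTransition.one_of_one_le (by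
      have : -1 ≤ 2 * hgt p / δ := by rw [le_div_iff₀ hδ0]; linarith
      simp only [k]; linarith)
    have h2 : S (g p) = 1 := Real.smoothTransition.one_of_one_le (by
      have h1 : 2 * (‖flat p‖ ^ 2 * ((e (hgt p)) ^ 2)⁻¹) ≤ 1 := by
        rw [← mul_assoc, ← div_eq_mul_inv, div_le_one (pow_pos (he0 _) 2)]; exact hpe
      simp only [g]; linarith)
    simp [h1, h2]
  · intro p hp hpe
    set t := hgt p
    have het := he0 t
    have hlip : |e t - e 0| ≤ 1 / 2 * |t| := by
      have := (convex_univ (𝕜 := ℝ) (E := ℝ)).norm_image_sub_le_of_norm_deriv_le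
        (fun x _ => hed x) (fun x _ => he' x) (mem_univ 0) (mem_univ t)
      simpa using this
    -- Below height 0 the tube extends only down to `-δ`, and the slope bound 1/2 keeps its radius
    -- comparable to `δ` there.
    have hneg : t < 0 → δ ≤ 2 * e t ∧ e t ≤ 3 / 2 * δ := fun h => by
      rw [abs_of_neg h] at hlip
      have := abs_le.1 hlip
      constructor <;> linarith
    have hmax : max 0 (-t) ≤ 2 * e t := by
      rcases lt_or_ge t 0 with h | h
      · rw [max_eq_right (by linarith)]; linarith [(hneg h).1]
      · rw [max_eq_left (by linarith)]; linarith
    refine ⟨hmax, ?_⟩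
    have hgd : ‖fderiv ℝ g p‖ ≤ 6 / e t := by
      have h1 : HasFDerivAt (fun p => ((e (hgt p)) ^ 2)⁻¹)
          ((-(2 * e t * deriv e t) / (e t ^ 2) ^ 2) • hgt) p := by
        have h0 : HasDerivAt (fun t => (e t ^ 2)⁻¹) (-(2 * e t * deriv e t) / (e t ^ 2) ^ 2) t := by
          have h := ((hed t).hasDerivAt.fun_pow 2).fun_inv (pow_pos het 2).ne'
          simpa using h
        exact HasDerivAt.comp_hasFDerivAt (h₂ := fun t => (e t ^ 2)⁻¹) p h0 hgt.hasFDerivAt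
      have h2 := (flat.hasFDerivAt (x := p)).norm_sq.mul h1
      have h3 : HasFDerivAt g _ p := (h2.const_mul 2).const_sub 2
      rw [h3.fderiv]
      refine ContinuousLinearMap.opNorm_le_bound _ (by positivity) fun v => ?_
      have hin : |inner ℝ (flat p) (flat v)| ≤ e t * ‖v‖ :=
        (abs_real_inner_le_norm _ _).trans (mul_le_mul hpe (norm_flat_le v) (norm_nonneg _) het.le)
      have hv := abs_hgt_le v
      have e1 : ‖flat p‖ ^ 2 ≤ e t ^ 2 := by gcongr
      rw [Real.norm_eq_abs]
      have e2 : ∀ X Y : ℝ, |X| ≤ e t * ‖v‖ → |Y| ≤ ‖v‖ / 2 →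
          |2 * (‖flat p‖ ^ 2 * (2 * e t * Y / (e t ^ 2) ^ 2) - 2 * X / e t ^ 2)| ≤
            6 / e t * ‖v‖ := fun X Y hX hY => by
        have a1 : |‖flat p‖ ^ 2 * (2 * e t * Y / (e t ^ 2) ^ 2)| ≤ ‖v‖ / e t := by
          rw [abs_mul, abs_div, abs_mul, abs_mul, abs_of_nonneg (sq_nonneg (‖flat p‖)),
            abs_of_pos het, abs_of_pos (pow_pos (pow_pos het 2) 2), abs_two]
          calc _ ≤ e t ^ 2 * (2 * e t * (‖v‖ / 2) / (e t ^ 2) ^ 2) := by gcongr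
            _ = _ := by field_simp
        have a2 : |2 * X / e t ^ 2| ≤ 2 * ‖v‖ / e t := by
          rw [abs_div, abs_mul, abs_two, abs_of_pos (pow_pos het 2)]
          calc _ ≤ 2 * (e t * ‖v‖) / e t ^ 2 := by gcongr
            _ = _ := by field_simp
        rw [abs_mul, abs_two]
        calc _ ≤ 2 * (‖v‖ / e t + 2 * ‖v‖ / e t) := by
              gcongr
              exact (abs_sub _ _).trans (add_le_add a1 a2)
          _ = _ := by ring
      have e3 := e2 (inner ℝ (flat p) (flat v)) (deriv e t * hgt v) hin (by
        rw [abs_mul]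
        calc _ ≤ 1 / 2 * ‖v‖ := by gcongr; exact he' t
          _ = _ := by ring)
      refine (le_of_eq (congrArg _ ?_)).trans e3
      simp only [neg_apply, smul_apply, add_apply,
        ContinuousLinearMap.comp_apply, innerSL_apply_apply, smul_eq_mul, nsmul_eq_mul]
      push_cast
      simp only [t]
      ring
    have hkd : deriv S (k p) ≠ 0 → t < 0 := fun h => by
      by_contra! h0
      apply h
      have : S =ᶠ[𝓝 (k p)] fun _ => 1 := by
        have : 1 < k p := by
          have : 0 ≤ 2 * t / δ := by positivity
          simp only [k]; linarith
        filter_upwards [Ioi_mem_nhds this] with y hy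
        exact Real.smoothTransition.one_of_one_le (le_of_lt hy)
      rw [this.deriv_eq, deriv_const]
    have hkf : HasFDerivAt k ((2 / δ) • hgt) p := by
      have := ((hgt.hasFDerivAt (x := p)).const_mul (2 / δ)).const_add 2
      refine this.congr_of_eventuallyEq (Eventually.of_forall fun q => ?_)
      simp only [k]; ring
    have hSd := fun x => (hasDerivAt_smoothTransition x)
    have hd := ((hSd (g p)).comp_hasFDerivAt p ((hg.differentiable (by simp) p).hasFDerivAt)).mul
      ((hSd (k p)).comp_hasFDerivAt p hkf)
    have hd' : HasFDerivAt (fun p => S (g p) * S (k p)) _ p := hd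
    rw [hd'.fderiv]
    have hh : ‖hgt‖ ≤ 1 := ContinuousLinearMap.opNorm_le_bound _ zero_le_one fun v => by
      rw [one_mul]; exact abs_hgt_le v
    have hb1 : ‖S (k p) • deriv S (g p) • fderiv ℝ g p‖ ≤ C * (6 / e t) := by
      rw [norm_smul, norm_smul, Real.norm_of_nonneg (hS0 _), Real.norm_of_nonneg (hC' _).1]
      calc _ ≤ 1 * (C * (6 / e t)) := by
            gcongr
            · exact mul_nonneg (hC' _).1 (norm_nonneg _)
            · exact hS1 _
            · exact (hC' _).2
        _ = _ := one_mul _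
    have hb2 : ‖S (g p) • deriv S (k p) • (2 / δ) • hgt‖ ≤ C * (3 / e t) := by
      by_cases h : deriv S (k p) = 0
      · rw [h]; simp; positivity
      · have h2 := (hneg (hkd h)).2
        rw [norm_smul, norm_smul, norm_smul, Real.norm_of_nonneg (hS0 _),
          Real.norm_of_nonneg (hC' _).1, Real.norm_of_nonneg (by positivity)]
        have h3 : 2 / δ ≤ 3 / e t := by rw [div_le_div_iff₀ hδ0 het]; linarith
        calc _ ≤ 1 * (C * (3 / e t * 1)) := by
              refine mul_le_mul (hS1 _) ?_ (mul_nonneg (hC' _).1 (by positivity)) zero_le_one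
              exact mul_le_mul (hC' _).2 (mul_le_mul h3 hh (norm_nonneg _) (by positivity))
                (by positivity) hC.le
          _ = _ := by ring
    calc _ ≤ C * (3 / e t) + C * (6 / e t) := (norm_add_le _ _).trans (add_le_add hb2 hb1)
      _ = _ := by ring

/-- A map defined near the vertical half-axis which fixes it and has derivatives close to the
identity along it agrees near the axis with the end of an ambient isotopy. -/
theorem exists_axis_interpolation : ∃ η > 0, ∀ (O : Set E3) (m : E3 → E3), IsOpen O →
    axisRay ⊆ O → ContDiffOn ℝ ∞ m O →
    (∀ p ∈ axisRay, m p = p ∧ ‖fderiv ℝ m p - ContinuousLinearMap.id ℝ E3‖ ≤ η) →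
    ∃ d O', IsotopicToIdRel (axisRay ∪ {p | hgt p ≤ -1}) d ∧ IsOpen O' ∧ axisRay ⊆ O' ∧ O' ⊆ O ∧
      ∀ p ∈ O', d p = m p := by
  obtain ⟨C, hC, hC'⟩ := exists_abs_deriv_smoothTransition_le
  -- On the tube `‖u‖ ≤ 2η · 3e` and the cutoff has derivative at most `9C / e`. The product rule
  -- gives `2η (1 + 27C)` as derivative bound, and `η` makes this exactly 1/2.
  refine ⟨1 / (4 * (27 * C + 1)), by positivity, fun O m hO hax hm hma => ?_⟩
  set η := 1 / (4 * (27 * C + 1)) with hη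
  have hη0 : 0 < η := by positivity
  let u : E3 → E3 := fun p => m p - p
  have hu : ContDiffOn ℝ ∞ u O := hm.sub contDiffOn_id
  have hud : ∀ p ∈ O, fderiv ℝ u p = fderiv ℝ m p - ContinuousLinearMap.id ℝ E3 := fun p hp =>
    (((hm.contDiffAt (hO.mem_nhds hp)).differentiableAt (by simp)).hasFDerivAt.sub
      (hasFDerivAt_id p)).fderiv
  set O₁ := O ∩ fderiv ℝ u ⁻¹' {A | ‖A‖ < 2 * η}
  have hO₁ : IsOpen O₁ := (hu.continuousOn_fderiv_of_isOpen hO (by simp)).isOpen_inter_preimage hO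
    (isOpen_lt continuous_norm continuous_const)
  have hax₁ : axisRay ⊆ O₁ := fun p hp => ⟨hax hp, by
    show ‖fderiv ℝ u p‖ < 2 * η
    rw [hud p (hax hp)]; linarith [(hma p hp).2]⟩
  obtain ⟨δ, hδ, hδ2, hδO⟩ := exists_axis_extension hO₁ hax₁
  obtain ⟨e, he, heP⟩ := exists_tube hO₁ hδO hδ
  have he0 : ∀ t, 0 < e t := fun t => (heP t).1
  obtain ⟨χ, hχ, hχ01, hχz, hχo, hχd⟩ := exists_tube_cutoff hC hC' he he0
    fun t => (heP t).2.2.1.trans hδ2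
  have heδ := (heP 0).2.1
  have htube : ∀ p, -e 0 ≤ hgt p → ‖flat p‖ ≤ e (hgt p) → p ∈ O₁ := fun p hp hpe =>
    (heP (hgt p)).2.2.2 (by linarith) p rfl hpe
  let w : E3 → E3 := fun p => χ p • u p
  have hKc : IsClosed {p | -e 0 ≤ hgt p ∧ ‖flat p‖ ≤ e (hgt p)} :=
    (isClosed_le continuous_const hgt.continuous).inter
      (isClosed_le flat.continuous.norm (he.continuous.comp hgt.continuous))
  have hw0 : ∀ p, ¬ (-e 0 ≤ hgt p ∧ ‖flat p‖ ≤ e (hgt p)) → w =ᶠ[𝓝 p] fun _ => 0 := fun p hp => by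
    filter_upwards [hKc.isOpen_compl.mem_nhds hp] with q hq
    have : χ q = 0 := hχz q (by
      by_contra! h
      exact hq ⟨h.1.le, h.2.le⟩)
    simp [w, this]
  have hua : ∀ p ∈ O₁, ContDiffAt ℝ ∞ u p := fun p hp => hu.contDiffAt (hO.mem_nhds hp.1)
  have hw : ContDiff ℝ ∞ w := by
    rw [contDiff_iff_contDiffAt]
    intro p
    by_cases hp : -e 0 ≤ hgt p ∧ ‖flat p‖ ≤ e (hgt p)
    · exact hχ.contDiffAt.smul (hua p (htube p hp.1 hp.2))
    · exact contDiffAt_const.congr_of_eventuallyEq (hw0 p hp)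
  have hwd : ∀ p, ‖fderiv ℝ w p‖ ≤ 1 / 2 := by
    intro p
    by_cases hp : -e 0 ≤ hgt p ∧ ‖flat p‖ ≤ e (hgt p)
    · obtain ⟨h1, h2⟩ := hχd p hp.1 hp.2
      have h3 := norm_sub_le_of_tube (K := 2 * η) (by positivity) (he0 0).le he0 htube
        (fun p hp => (hua p hp).differentiableAt (by simp)) (fun p hp => le_of_lt hp.2)
        (fun p hp => by simp [u, (hma p hp).1]) hp.1 hp.2
      have h4 : ‖fderiv ℝ u p‖ ≤ 2 * η := le_of_lt (htube p hp.1 hp.2).2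
      have het := he0 (hgt p)
      have h5 : HasFDerivAt w _ p := ((hχ.differentiable (by simp)) p).hasFDerivAt.smul
        ((hua p (htube p hp.1 hp.2)).differentiableAt (by simp)).hasFDerivAt
      rw [h5.fderiv]
      have h6 : ‖u p‖ ≤ 2 * η * (3 * e (hgt p)) := h3.trans (by gcongr; linarith)
      calc _ ≤ ‖χ p • fderiv ℝ u p‖ + ‖(fderiv ℝ χ p).smulRight (u p)‖ := norm_add_le _ _
        _ ≤ 1 * (2 * η) + 9 * C / e (hgt p) * (2 * η * (3 * e (hgt p))) := by
            rw [norm_smul, ContinuousLinearMap.norm_smulRight_apply,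
              Real.norm_of_nonneg (hχ01 p).1]
            gcongr
            exact (hχ01 p).2
        _ = 2 * (27 * C + 1) * η := by field_simp; ring
        _ = 1 / 2 := by rw [hη]; field_simp; norm_num
    · rw [(hw0 p hp).fderiv_eq]; simp
  refine ⟨fun p => p + w p, {p | -(e 0 / 2) < hgt p ∧ 2 * ‖flat p‖ ^ 2 < e (hgt p) ^ 2},
    (IsotopicToIdRel.id_add hw hwd).mono ?_, ?_, ?_, ?_, ?_⟩
  · rintro p (hp | hp)
    · show χ p • u p = 0
      simp [u, (hma p hp).1]
    · have hp' : hgt p ≤ -1 := hp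
      show χ p • u p = 0
      rw [hχz p (Or.inl (by linarith)), zero_smul]
  · exact (isOpen_lt continuous_const hgt.continuous).inter
      (isOpen_lt (continuous_const.mul (flat.continuous.norm.pow 2))
        ((he.continuous.comp hgt.continuous).pow 2))
  · intro p hp
    obtain ⟨t, ht, rfl⟩ := mem_axisRay_iff.1 hp
    have := he0 0
    refine ⟨?_, ?_⟩
    · simp; linarith
    · simpa using pow_pos (he0 t) 2
  · rintro p ⟨h1, h2⟩
    have := he0 0
    refine (htube p (by linarith) ?_).1
    refine le_of_sq_le_sq ?_ (he0 _).le
    nlinarith [sq_nonneg (‖flat p‖)]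
  · rintro p ⟨h1, h2⟩
    simp [w, u, hχo p h1.le h2.le]

/-! ### Uniqueness of regular neighborhoods relative to the multiray -/

/-- Two sets with ray charts along the same rays are isotopic relative to the rays. -/
theorem IsRayChart.exists_isotopy {Z : Type} [TopologicalSpace Z] [DiscreteTopology Z]
    {τ N N' : Set E3} {ψ ψ' : Z → E3 → E3} (hψ : IsRayChart τ N ψ) (hψ' : IsRayChart τ N' ψ')
    (hax : ∀ z, ψ z '' axisRay = ψ' z '' axisRay) :
    ∃ D, IsotopicToIdRel τ D ∧ D '' N = N' := by
  obtain ⟨η, hη, hint⟩ := exists_axis_interpolation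
  -- After reparametrizing both charts, the transition map near the half-axis agrees with the end
  -- `d` of an ambient isotopy of the model.
  have key : ∀ z, ∃ w h w' h' O d, IsAxisReparam w h ∧ IsAxisReparam w' h' ∧ IsOpen O ∧
      axisRay ⊆ O ∧ IsotopicToIdRel (axisRay ∪ {p | hgt p ≤ -1}) d ∧
      ∀ p ∈ O, ψ' z (w' (d p)) = ψ z (w p) := by
    intro z
    obtain ⟨hop, g, hg, hgψ⟩ := isOpen_image_and_exists_smooth_inverse isOpen_univ
      (hψ'.smooth z).contDiffOn (fun x _ x' _ h => (hψ'.eq_of_apply_eq z z x x' h).2)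
      (fun x _ => hψ'.immersion z x)
    have hO : IsOpen (ψ z ⁻¹' (ψ' z '' univ)) :=
      (hop _ subset_rfl isOpen_univ).preimage (hψ.smooth z).continuous
    have haxO : axisRay ⊆ ψ z ⁻¹' (ψ' z '' univ) := fun p hp =>
      image_mono (subset_univ _) (hax z ▸ mem_image_of_mem (ψ z) hp)
    have hm : ContDiffOn ℝ ∞ (fun p => g (ψ z p)) (ψ z ⁻¹' (ψ' z '' univ)) :=
      hg.comp (hψ.smooth z).contDiffOn fun p hp => hp
    have hψg : ∀ p ∈ ψ z ⁻¹' (ψ' z '' univ), ψ' z (g (ψ z p)) = ψ z p := by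
      rintro p ⟨q, -, hq⟩
      rw [← hq, hgψ q trivial]
    have hma : (fun p => g (ψ z p)) '' axisRay = axisRay := by
      have h1 : (fun p => g (ψ z p)) '' axisRay = g '' (ψ z '' axisRay) := by rw [image_image]
      rw [h1, hax, image_image]
      simp [hgψ]
    have hmi : ∀ p ∈ axisRay, Injective (fderiv ℝ (fun p => g (ψ z p)) p) := fun p hp => by
      have h1 : HasFDerivAt (fun p => g (ψ z p)) _ p :=
        ((hm.contDiffAt (hO.mem_nhds (haxO hp))).differentiableAt (by simp)).hasFDerivAt
      have h2 := HasFDerivAt.comp (g := ψ' z) p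
        ((hψ'.smooth z).differentiable (by simp) _).hasFDerivAt h1
      have h3 : HasFDerivAt (ψ z) _ p := h2.congr_of_eventuallyEq (by
        filter_upwards [hO.mem_nhds (haxO hp)] with q hq
        exact (hψg q hq).symm)
      have h4 := hψ.immersion z p
      rw [h3.fderiv] at h4
      exact Injective.of_comp (f := fderiv ℝ (ψ' z) (g (ψ z p))) h4
    obtain ⟨w, h, w', h', O', m', hw, hw', hO', haxO', hm', hma', hwm⟩ :=
      exists_axis_normalization hO haxO hm hmi hma hη
    obtain ⟨d, O'', hd, hO'', haxO'', hOO, hdm⟩ := hint O' m' hO' haxO' hm' hma'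
    refine ⟨w, h, w', h', O'', d, hw, hw', hO'', haxO'', hd, fun p hp => ?_⟩
    obtain ⟨h1, h2⟩ := hwm p (hOO hp)
    rw [hdm p hp, h2, hψg _ h1]
  choose w h w' h' O d hw hw' hO haxO hd hwd using key
  -- The half-space above level `c` is squeezed into the region of agreement. Doing so in the first
  -- chart, and following the same motion by `d` in the second, gives literally the same subset of
  -- ℝ³.
  choose c hc t ht htO using fun z => exists_thin_isotopy (hO z) (haxO z)
  obtain ⟨D₁, hD₁, hD₁N⟩ := (hψ.comp_reparam hw).exists_shrink_to_image hc ht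
  obtain ⟨D₂, hD₂, hD₂N⟩ := (hψ'.comp_reparam hw').exists_shrink_to_image hc
    (d := fun z => d z ∘ t z) fun z => ((hd z).mono (union_subset_union_right _ fun p hp => by
      have hp' : hgt p ≤ -2 := hp
      show hgt p ≤ -1
      linarith)).comp (ht z)
  have hDD : D₁ '' N = D₂ '' N' := by
    rw [hD₁N, hD₂N]
    refine iUnion_congr fun z => ?_
    rw [image_comp, image_image _ (d z)]
    exact (image_congr fun p hp => hwd z p (htO z hp)).symm
  obtain ⟨E, hE, hED, -⟩ := hD₂.exists_inverse
  refine ⟨E ∘ D₁, hE.comp hD₁, ?_⟩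
  rw [image_comp, hDD, image_image]
  simp [hED]

/-- A locally finite family of disjoint connected closed sets. -/
structure IsComponentFamily {Z : Type} (A : Z → Set E3) : Prop where
  nonempty : ∀ z, (A z).Nonempty
  preconnected : ∀ z, IsPreconnected (A z)
  eq_of_mem : ∀ z z' x, x ∈ A z → x ∈ A z' → z = z'
  closed : ∀ S : Set Z, IsClosed (⋃ z ∈ S, A z)

theorem IsComponentFamily.subset {Z : Type} {A : Z → Set E3} (hA : IsComponentFamily A)
    {S : Set E3} (hS : IsPreconnected S) (hSA : S ⊆ ⋃ z, A z) {z : Z} (hSz : (S ∩ A z).Nonempty) :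
    S ⊆ A z := by
  have h1 : IsClosed (A z) := by simpa using hA.closed {z}
  by_contra hcon
  obtain ⟨x, hx, hxz⟩ := not_subset.1 hcon
  obtain ⟨w, hw⟩ := mem_iUnion.1 (hSA hx)
  obtain ⟨y, hyS, hy1, hy2⟩ := isPreconnected_closed_iff.1 hS _ _ h1 (hA.closed {z}ᶜ)
    (fun y hy => by
      obtain ⟨v, hv⟩ := mem_iUnion.1 (hSA hy)
      by_cases hvz : v = z
      · exact Or.inl (hvz ▸ hv)
      · exact Or.inr (mem_iUnion₂.2 ⟨v, hvz, hv⟩)) hSz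
    ⟨x, hx, mem_iUnion₂.2 ⟨w, fun h => hxz (h ▸ hw), hw⟩⟩
  obtain ⟨v, hv, hyv⟩ := mem_iUnion₂.1 hy2
  exact hv (hA.eq_of_mem _ _ y hyv hy1)

/-- Both families consist of the components of one set, hence differ by a bijection of indices: each
connected member lies in a member of the other family, and the two assignments are inverse by
disjointness. -/
theorem IsComponentFamily.exists_equiv {Z Z' : Type} {A : Z → Set E3} {B : Z' → Set E3}
    (hA : IsComponentFamily A) (hB : IsComponentFamily B) (h : ⋃ z, A z = ⋃ z, B z) :
    ∃ s : Z ≃ Z', ∀ z, A z = B (s z) := by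
  have aux : ∀ {Z Z' : Type} {A : Z → Set E3} {B : Z' → Set E3}, IsComponentFamily A →
      IsComponentFamily B → ⋃ z, A z = ⋃ z, B z → ∀ z, ∃ z', A z ⊆ B z' := by
    intro Z Z' A B hA hB h z
    obtain ⟨x, hx⟩ := hA.nonempty z
    obtain ⟨z', hz'⟩ := mem_iUnion.1 (h ▸ mem_iUnion.2 ⟨z, hx⟩ : x ∈ ⋃ z, B z)
    exact ⟨z', hB.subset (hA.preconnected z) (h ▸ subset_iUnion A z) ⟨x, hx, hz'⟩⟩
  choose s hs using aux hA hB h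
  choose r hr using aux hB hA h.symm
  have hrs : ∀ z, r (s z) = z := fun z => by
    obtain ⟨x, hx⟩ := hA.nonempty z
    exact hA.eq_of_mem _ _ x (hr _ (hs _ hx)) hx
  have hsr : ∀ z, s (r z) = z := fun z => by
    obtain ⟨x, hx⟩ := hB.nonempty z
    exact hB.eq_of_mem _ _ x (hs _ (hr _ hx)) hx
  refine ⟨⟨s, r, hrs, hsr⟩, fun z => (hs z).antisymm ?_⟩
  have := hr (s z)
  rwa [hrs] at this

namespace IsProperSmoothEmbedding

variable {Z : Type} [TopologicalSpace Z] [DiscreteTopology Z] {φ : Z → E3 → E3}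

theorem isComponentFamily (hφ : IsProperSmoothEmbedding upperHalfSpace3 φ) {C : Set E3}
    (hC : IsClosed C) (hCH : C ⊆ upperHalfSpace3) (hCn : C.Nonempty) (hCc : IsPreconnected C) :
    IsComponentFamily fun z => φ z '' C := by
  classical
  refine ⟨fun z => hCn.image _, fun z => hCc.image _ ((hφ.smooth z).continuousOn.mono hCH), ?_,
    fun S => ?_⟩
  · rintro z z' _ ⟨x, hx, rfl⟩ ⟨x', hx', h⟩
    exact (hφ.eq_of_apply_eq (hCH hx) (hCH hx') h.symm).1
  · have := hφ.isClosed_iUnion_image (C := fun z => if z ∈ S then C else ∅)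
      (fun z => by split_ifs <;> simp [hC])
      (fun z => by split_ifs <;> simp [hCH])
    refine (congrArg IsClosed ?_).mp this
    refine iUnion_congr fun z => ?_
    by_cases h : z ∈ S <;> simp [h]

end IsProperSmoothEmbedding

theorem isPreconnected_zetaRay : IsPreconnected zetaRay := by
  rw [zetaRay_eq]
  refine Convex.isPreconnected ?_
  have := ((convex_singleton (𝕜 := ℝ) (0 : E3)).linear_preimage (flat : E3 →ₗ[ℝ] E3)).inter
    ((convex_Ici (𝕜 := ℝ) (1 : ℝ)).linear_preimage (hgt : E3 →ₗ[ℝ] ℝ))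
  exact this

theorem Diffeomorph.image_frontier' (f : E3 ≃ₘ[ℝ] E3) (S : Set E3) :
    f '' frontier S = frontier (f '' S) := f.toHomeomorph.image_frontier S

/-- A diffeomorphism which matches two multirays is isotopic, relative to the first of them, to one
which also matches given regular neighborhoods. -/
theorem exists_isotopicRel_image_eq {n : ℕ∞} {τ τ' N N' : Set E3} (hN : IsRegularNhd n τ N)
    (hN' : IsRegularNhd n τ' N') (f : E3 ≃ₘ[ℝ] E3) (hf : f '' τ = τ') :
    ∃ g : E3 ≃ₘ[ℝ] E3, g '' N = N' ∧ IsotopicRel τ f g := by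
  obtain ⟨φ, hφ, rfl, rfl⟩ := hN
  obtain ⟨φ', hφ', rfl, rfl⟩ := hN'
  have hfφ := hφ.comp_diffeomorph f
  have himg : ∀ S : Set E3, f '' (⋃ z, φ z '' S) = ⋃ z, (fun x => f (φ z x)) '' S := fun S => by
    rw [image_iUnion]
    exact iUnion_congr fun z => by rw [image_image]
  rw [himg] at hf
  obtain ⟨s, hs⟩ := (hfφ.isComponentFamily isClosed_zetaRay
    (zetaRay_subset.trans hgt_pos_subset) ⟨_, vert_mem_zetaRay⟩
    isPreconnected_zetaRay).exists_equiv (hφ'.isComponentFamily isClosed_zetaRay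
      (zetaRay_subset.trans hgt_pos_subset) ⟨_, vert_mem_zetaRay⟩ isPreconnected_zetaRay) hf
  have h1 := hfφ.isRayChart
  -- Reindexing the second family by the matching of rays gives charts along the same ray for every
  -- index.
  have h2 := (hφ'.comp_equiv s).isRayChart
  have hre : ∀ S : Set E3, ⋃ z, φ' (s z) '' S = ⋃ z, φ' z '' S := fun S =>
    s.surjective.iUnion_comp fun z => φ' z '' S
  rw [hf] at h1
  rw [hre, hre] at h2
  obtain ⟨D, hD, hDN⟩ := h1.exists_isotopy h2 fun z => by
    have e1 : ∀ ψ : E3 → E3, (fun p => ψ (expChart p)) '' axisRay = ψ '' zetaRay := fun ψ => by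
      rw [← image_expChart_axisRay, image_image]
    rw [e1 (φ' (s z)), ← hs z, e1 fun x => f (φ z x)]
  rw [← hf, ← himg] at hD
  obtain ⟨g, hg, hgf⟩ := hD.isotopicRel f
  refine ⟨g, ?_, hgf⟩
  rw [← hDN, ← himg, image_image]
  exact image_congr fun x _ => hg x

/-! ### Moving rays inside the upper half-space -/

/-- A horizontal displacement that depends on the height only. -/
theorem IsotopicToIdRel.shear {l : ℝ → E3} (hl : ContDiff ℝ ∞ l) (hlh : ∀ t, hgt (l t) = 0) :
    IsotopicToIdRel {p | l (hgt p) = 0} fun p => p + l (hgt p) := by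
  set S := Real.smoothTransition
  have hS : ContDiff ℝ ∞ S := Real.smoothTransition.contDiff
  have hsm : ContDiff ℝ ∞ fun x : ℝ × E3 => S x.1 • l (hgt x.2) :=
    (hS.comp contDiff_fst).smul (hl.comp (hgt.contDiff.comp contDiff_snd))
  refine ⟨fun x => x.2 + S x.1 • l (hgt x.2), fun x => x.2 - S x.1 • l (hgt x.2),
    contDiff_snd.add hsm, contDiff_snd.sub hsm, fun t x => ?_, fun t x => ?_, fun x => ?_,
    fun x => ?_, ?_⟩
  · simp [hlh]
  · simp [hlh]
  · simp [S]
  · simp [S]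
  · intro t x hx
    have : l (hgt x) = 0 := hx
    simp [this]

/-- The image of an inverse. -/
theorem image_eq_of_inverse {d e : E3 → E3} (hed : ∀ x, e (d x) = x) {S T : Set E3}
    (h : d '' S = T) : e '' T = S := by
  rw [← h, image_image]; simp [hed]

/-- The vertical ray over `q` from height `c`. -/
def vertRay (q : E3) (c : ℝ) : Set E3 := {p | ∃ t, c ≤ t ∧ p = q + t • vert}

theorem zetaRay_eq_vertRay : zetaRay = vertRay 0 1 := by
  rw [zetaRay_eq]
  ext p
  constructor
  · rintro ⟨h1, h2⟩
    exact ⟨hgt p, h2, ext_flat_hgt (by simp [h1]) (by simp)⟩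
  · rintro ⟨t, ht, rfl⟩
    exact ⟨by simp, by simpa using ht⟩

theorem exists_raise_vertRay (q : E3) (hq : hgt q = 0) {c c' : ℝ} (hc : 0 < c) (hcc : c ≤ c') :
    ∃ d, IsotopicToIdRel {p | hgt p ≤ c / 2} d ∧ d '' vertRay q c = vertRay q c' := by
  set S := Real.smoothTransition
  have hS : ContDiff ℝ ∞ S := Real.smoothTransition.contDiff
  let a : E3 → ℝ := fun p => S (2 * hgt p / c - 1) * (c' - c)
  have ha : ContDiff ℝ ∞ a := (hS.comp (((contDiff_const.mul hgt.contDiff).div_const c).sub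
    contDiff_const)).mul contDiff_const
  have h0 : ∀ p, hgt p ≤ c / 2 → a p = 0 := fun p hp => by
    have : S (2 * hgt p / c - 1) = 0 := Real.smoothTransition.zero_of_nonpos (by
      rw [sub_nonpos, div_le_one hc]; linarith)
    simp [a, this]
  have h1 : ∀ p, c ≤ hgt p → a p = c' - c := fun p hp => by
    have : S (2 * hgt p / c - 1) = 1 := Real.smoothTransition.one_of_one_le (by
      rw [le_sub_iff_add_le, le_div_iff₀ hc]; linarith)
    simp [a, this]
  refine ⟨fun p => p + a p • vert, (IsotopicToIdRel.vertical ha (fun p => ?_) fun q => ?_).mono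
    fun p hp => h0 p hp, ?_⟩
  · have e1 : HasDerivAt (fun z : ℝ => 2 * (hgt p + z) / c - 1) (2 / c) 0 := by
      have := ((((hasDerivAt_id (0 : ℝ)).const_add (hgt p)).const_mul 2).div_const c).sub_const 1
      simpa using this
    have e2 : HasDerivAt (fun z : ℝ => a (p + z • vert))
        (deriv S (2 * (hgt p + 0) / c - 1) * (2 / c) * (c' - c)) 0 := by
      have := (HasDerivAt.comp (h₂ := S) 0 (hasDerivAt_smoothTransition _) e1).mul_const (c' - c)
      refine this.congr_of_eventuallyEq (Eventually.of_forall fun z => ?_)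
      simp [a]
    rw [fderiv_vert_eq_of_hasDerivAt (ha.differentiable (by simp)) e2]
    have h2 : 0 ≤ deriv S (2 * (hgt p + 0) / c - 1) := Real.smoothTransition.monotone.deriv_nonneg
    have h3 : 0 ≤ c' - c := by linarith
    have : 0 ≤ deriv S (2 * (hgt p + 0) / c - 1) * (2 / c) * (c' - c) := by positivity
    linarith
  · refine ⟨c' - c, fun z => ?_⟩
    have h3 : 0 ≤ c' - c := by linarith
    simp only [a]
    rw [abs_of_nonneg (mul_nonneg (Real.smoothTransition.nonneg _) h3)]
    exact mul_le_of_le_one_left h3 (Real.smoothTransition.le_one _)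
  · ext p
    constructor
    · rintro ⟨_, ⟨t, ht, rfl⟩, rfl⟩
      refine ⟨t + (c' - c), by linarith, ?_⟩
      show q + t • vert + a (q + t • vert) • vert = _
      rw [h1 _ (by simpa [hq] using ht), add_assoc, ← add_smul]
    · rintro ⟨t, ht, rfl⟩
      refine ⟨q + (t - (c' - c)) • vert, ⟨_, by linarith, rfl⟩, ?_⟩
      show q + (t - (c' - c)) • vert + a (q + (t - (c' - c)) • vert) • vert = _
      rw [h1 _ (by simp [hq]; linarith), add_assoc, ← add_smul]
      congr 2; ring

/-- Any two vertical rays in the upper half-space are isotopic. -/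
theorem exists_move_vertRay {q q' : E3} (hq : hgt q = 0) (hq' : hgt q' = 0) {c c' : ℝ}
    (hc : 0 < c) (hc' : 0 < c') :
    ∃ b > 0, ∃ d, IsotopicToIdRel {p | hgt p ≤ b} d ∧ d '' vertRay q c = vertRay q' c' := by
  -- Both rays are shortened to start at the common height `max c c'`, where a height-dependent
  -- horizontal translation takes one to the other.
  obtain ⟨d₁, hd₁, hi₁⟩ := exists_raise_vertRay q hq hc (le_max_left c c')
  obtain ⟨d₂, hd₂, hi₂⟩ := exists_raise_vertRay q' hq' hc' (le_max_right c c')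
  obtain ⟨e₂, he₂, hed, -⟩ := hd₂.exists_inverse
  set M := max c c'
  have hM : 0 < M := hc.trans_le (le_max_left _ _)
  set S := Real.smoothTransition
  have hS : ContDiff ℝ ∞ S := Real.smoothTransition.contDiff
  have hsh := IsotopicToIdRel.shear (l := fun t => S (2 * t / M - 1) • (q' - q))
    ((hS.comp (((contDiff_const.mul contDiff_id).div_const M).sub contDiff_const)).smul
      contDiff_const) (fun t => by simp [hq, hq'])
  refine ⟨min (c / 2) (c' / 2), by positivity, _, (he₂.mono fun p hp => ?_).comp
    ((hsh.mono fun p hp => ?_).comp (hd₁.mono fun p hp => ?_)), ?_⟩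
  · exact (show hgt p ≤ min (c / 2) (c' / 2) from hp).trans (min_le_right _ _)
  · have h1 : hgt p ≤ c / 2 := (show hgt p ≤ min (c / 2) (c' / 2) from hp).trans (min_le_left _ _)
    have h2 : c ≤ M := le_max_left _ _
    have : S (2 * hgt p / M - 1) = 0 := Real.smoothTransition.zero_of_nonpos (by
      rw [sub_nonpos, div_le_one hM]; linarith)
    simp [this]
  · exact (show hgt p ≤ min (c / 2) (c' / 2) from hp).trans (min_le_left _ _)
  · rw [image_comp, image_comp, hi₁]
    refine (congrArg _ ?_).trans (image_eq_of_inverse hed hi₂)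
    have h1 : ∀ t, M ≤ t → S (2 * t / M - 1) = 1 := fun t ht =>
      Real.smoothTransition.one_of_one_le (by
        rw [le_sub_iff_add_le, le_div_iff₀ hM]; linarith)
    ext p
    constructor
    · rintro ⟨_, ⟨t, ht, rfl⟩, rfl⟩
      refine ⟨t, ht, ?_⟩
      simp only [map_add, hq, map_smul, hgt_vert, smul_eq_mul, mul_one, zero_add, h1 t ht, one_smul]
      abel
    · rintro ⟨t, ht, rfl⟩
      refine ⟨q + t • vert, ⟨t, ht, rfl⟩, ?_⟩
      simp only [map_add, hq, map_smul, hgt_vert, smul_eq_mul, mul_one, zero_add, h1 t ht, one_smul]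
      abel

/-- The first horizontal unit vector. -/
noncomputable def hor : E3 := EuclideanSpace.single 0 1

@[simp] theorem hgt_hor : hgt hor = 0 := by simp [hgt, hor]

/-- The first coordinate. -/
noncomputable def coordX : E3 →L[ℝ] ℝ := EuclideanSpace.proj 0

@[simp] theorem coordX_hor : coordX hor = 1 := by simp [coordX, hor]

@[simp] theorem coordX_vert : coordX vert = 0 := by simp [coordX, vert]

@[simp] theorem flat_hor : flat hor = hor := flat_eq_self hgt_hor

/-- The vertical ray can be laid down onto the graph of a small positive function. -/
theorem exists_lay_down {ε : E3 → ℝ} (hε : ContDiff ℝ ∞ ε) (hεf : ∀ p, ε (flat p) = ε p)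
    (hε0 : ∀ p, 0 < ε p) (hε1 : ∀ p, ε p ≤ 1 / 2) :
    ∃ d, IsotopicToIdRel {p | hgt p ≤ ε p / 2} d ∧
      d '' zetaRay = {p | ∃ x : ℝ, 1 ≤ x ∧ p = x • hor + ε (x • hor) • vert} := by
  set S := Real.smoothTransition
  have hS : ContDiff ℝ ∞ S := Real.smoothTransition.contDiff
  -- This shear tilts the vertical ray to the diagonal `t • hor + t • vert`. The inverse of the
  -- vertical isotopy defined below then lowers the diagonal to the graph.
  have hsh := IsotopicToIdRel.shear (l := fun t => (t * S (2 * t - 1)) • hor)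
    ((contDiff_id.mul (hS.comp ((contDiff_const.mul contDiff_id).sub contDiff_const))).smul
      contDiff_const) (fun t => by simp)
  -- Raising the graph of `ε` by `coordX - ε` puts it on the diagonal. The cutoff and `ε ≤ 1 / 2`
  -- make the displacement nonnegative everywhere, so its vertical derivative is nonnegative.
  let f : E3 → ℝ := fun p => S (2 * coordX p - 1) * (coordX p - ε p)
  have hf : ContDiff ℝ ∞ f := (hS.comp ((contDiff_const.mul coordX.contDiff).sub
    contDiff_const)).mul (coordX.contDiff.sub hε)
  have hεv : ∀ p (z : ℝ), ε (p + z • vert) = ε p := fun p z => comp_flat_add_smul_vert hεf p z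
  have hfv : ∀ p (z : ℝ), f (p + z • vert) = f p := fun p z => by simp [f, hεv]
  have hf0 : ∀ p, 0 ≤ f p := fun p => by
    rcases le_total (coordX p) (1 / 2) with h | h
    · have : S (2 * coordX p - 1) = 0 := Real.smoothTransition.zero_of_nonpos (by linarith)
      simp [f, this]
    · exact mul_nonneg (Real.smoothTransition.nonneg _) (by linarith [hε1 p])
  let a : E3 → ℝ := fun p => S (2 * hgt p / ε p - 1) * f p
  have ha : ContDiff ℝ ∞ a := (hS.comp (((contDiff_const.mul hgt.contDiff).div hε
    fun p => (hε0 p).ne').sub contDiff_const)).mul hf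
  have hV := IsotopicToIdRel.vertical ha (fun p => by
    have e1 : HasDerivAt (fun z : ℝ => 2 * (hgt p + z) / ε p - 1) (2 / ε p) 0 := by
      have := ((((hasDerivAt_id (0 : ℝ)).const_add (hgt p)).const_mul 2).div_const
        (ε p)).sub_const 1
      simpa using this
    have e2 : HasDerivAt (fun z : ℝ => a (p + z • vert))
        (deriv S (2 * (hgt p + 0) / ε p - 1) * (2 / ε p) * f p) 0 := by
      have := (HasDerivAt.comp (h₂ := S) 0 (hasDerivAt_smoothTransition _) e1).mul_const (f p)
      refine this.congr_of_eventuallyEq (Eventually.of_forall fun z => ?_)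
      simp [a, hεv, hfv]
    rw [fderiv_vert_eq_of_hasDerivAt (ha.differentiable (by simp)) e2]
    have h2 : 0 ≤ deriv S (2 * (hgt p + 0) / ε p - 1) :=
      Real.smoothTransition.monotone.deriv_nonneg
    have h3 := hf0 p
    have h4 := hε0 p
    have : 0 ≤ deriv S (2 * (hgt p + 0) / ε p - 1) * (2 / ε p) * f p := by positivity
    linarith) fun q => ⟨f q, fun z => by
      simp only [a, hfv]
      rw [abs_of_nonneg (mul_nonneg (Real.smoothTransition.nonneg _) (hf0 q))]
      exact mul_le_of_le_one_left (hf0 q) (Real.smoothTransition.le_one _)⟩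
  obtain ⟨e, he, hed, -⟩ := hV.exists_inverse
  refine ⟨_, (he.mono fun p hp => ?_).comp (hsh.mono fun p hp => ?_), ?_⟩
  · have hp' : hgt p ≤ ε p / 2 := hp
    have : S (2 * hgt p / ε p - 1) = 0 := Real.smoothTransition.zero_of_nonpos (by
      rw [sub_nonpos, div_le_one (hε0 p)]; linarith)
    show a p = 0
    simp [a, this]
  · have hp' : hgt p ≤ ε p / 2 := hp
    have : S (2 * hgt p - 1) = 0 :=
      Real.smoothTransition.zero_of_nonpos (by linarith [hε1 p])
    simp [this]
  · rw [image_comp]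
    refine image_eq_of_inverse hed ?_
    have h1 : ∀ x : ℝ, 1 ≤ x → x • hor + ε (x • hor) • vert + a (x • hor + ε (x • hor) • vert) • vert
        = x • hor + x • vert := fun x hx => by
      have e1 : S (2 * hgt (x • hor + ε (x • hor) • vert) / ε (x • hor + ε (x • hor) • vert) - 1)
          = 1 := Real.smoothTransition.one_of_one_le (by
        rw [hεv]
        simp [(hε0 _).ne']
        norm_num)
      have e2 : f (x • hor + ε (x • hor) • vert) = x - ε (x • hor) := by
        have : S (2 * x - 1) = 1 := Real.smoothTransition.one_of_one_le (by linarith)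
        rw [hfv]
        simp [f, this]
      simp only [a]
      rw [e1, e2, one_mul, add_assoc, ← add_smul]
      congr 2; ring
    have h2 : ∀ t : ℝ, 1 ≤ t → t • vert + (hgt (t • vert) * S (2 * hgt (t • vert) - 1)) • hor =
        t • hor + t • vert := fun t ht => by
      have : S (2 * t - 1) = 1 := Real.smoothTransition.one_of_one_le (by linarith)
      simp [this, add_comm]
    rw [zetaRay_eq_vertRay]
    ext p
    constructor
    · rintro ⟨_, ⟨x, hx, rfl⟩, rfl⟩
      exact ⟨x • vert, ⟨x, hx, by simp⟩, by simp only [h1 x hx, h2 x hx]⟩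
    · rintro ⟨_, ⟨t, ht, rfl⟩, rfl⟩
      refine ⟨_, ⟨t, ht, rfl⟩, ?_⟩
      simp only [h1 t ht, zero_add, h2 t ht]

/-- A horizontal diffeomorphism of `ℝ³`, constant in the vertical direction. -/
structure IsHorizontalPair (k k' : E3 → E3) : Prop where
  smooth : ContDiff ℝ ∞ k
  smooth' : ContDiff ℝ ∞ k'
  left_inv : ∀ p, k' (k p) = p
  right_inv : ∀ p, k (k' p) = p
  flat_apply : ∀ p, flat (k p) = k (flat p)
  flat_apply' : ∀ p, flat (k' p) = k' (flat p)
  hgt_apply : ∀ p, hgt (k p) = hgt p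
  hgt_apply' : ∀ p, hgt (k' p) = hgt p

/-- A half-line on the graph of `σ` which corresponds to a straight half-line on the graph of `ε`
can be moved to a vertical ray. -/
theorem exists_stand_up {ε σ : E3 → ℝ} (hε : ContDiff ℝ ∞ ε) (hεf : ∀ p, ε (flat p) = ε p)
    (hε0 : ∀ p, 0 < ε p) (hε1 : ∀ p, ε p ≤ 1 / 2) (hσ : ContDiff ℝ ∞ σ)
    (hσf : ∀ p, σ (flat p) = σ p) (hσ0 : ∀ p, 0 < σ p) {k k' : E3 → E3}
    (hk : IsHorizontalPair k k') :
    ∃ d, IsotopicToIdRel {p | hgt p ≤ σ p / 2} d ∧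
      d '' {p | ∃ x : ℝ, 1 ≤ x ∧ p = k (x • hor) + σ (k (x • hor)) • vert} =
        vertRay (k 0) (σ (k 0) / ε 0) := by
  obtain ⟨d, hd, hdi⟩ := exists_lay_down hε hεf hε0 hε1
  obtain ⟨e, he, hed, -⟩ := hd.exists_inverse
  -- A diffeomorphism covering `k` and linear on vertical lines, scaled to carry the graph of `ε` to
  -- that of `σ`. The reverse of the laying down, conjugated by it, stands the curve up.
  let P : E3 → E3 := fun p => flat (k p) + (hgt p * (σ (k p) / ε p)) • vert
  let Q : E3 → E3 := fun p => flat (k' p) + (hgt p * (ε (k' p) / σ p)) • vert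
  have hP : ContDiff ℝ ∞ P := (flat.contDiff.comp hk.smooth).add ((hgt.contDiff.mul
    ((hσ.comp hk.smooth).div hε fun p => (hε0 p).ne')).smul contDiff_const)
  have hQ : ContDiff ℝ ∞ Q := (flat.contDiff.comp hk.smooth').add ((hgt.contDiff.mul
    ((hε.comp hk.smooth').div hσ fun p => (hσ0 p).ne')).smul contDiff_const)
  have hPf : ∀ p, flat (P p) = flat (k p) := fun p => by simp [P]
  have hQf : ∀ p, flat (Q p) = flat (k' p) := fun p => by simp [Q]
  have hPh : ∀ p, hgt (P p) = hgt p * (σ (k p) / ε p) := fun p => by simp [P]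
  have hQh : ∀ p, hgt (Q p) = hgt p * (ε (k' p) / σ p) := fun p => by simp [Q]
  have hσP : ∀ p, σ (P p) = σ (k p) := fun p => by rw [← hσf, hPf, hσf]
  have hεQ : ∀ p, ε (Q p) = ε (k' p) := fun p => by rw [← hεf, hQf, hεf]
  have hk'P : ∀ p, flat (k' (P p)) = flat p := fun p => by
    rw [hk.flat_apply', hPf, hk.flat_apply, hk.left_inv]
  have hkQ : ∀ p, flat (k (Q p)) = flat p := fun p => by
    rw [hk.flat_apply, hQf, hk.flat_apply', hk.right_inv]
  have hQP : ∀ p, Q (P p) = p := fun p => by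
    have h1 := (hε0 p).ne'
    have h2 := (hσ0 (k p)).ne'
    refine ext_flat_hgt (by rw [hQf, hk'P]) ?_
    rw [hQh, hPh, hσP, ← hεf (k' (P p)), hk'P, hεf]
    field_simp
  have hPQ : ∀ p, P (Q p) = p := fun p => by
    have h1 := (hσ0 p).ne'
    have h2 := (hε0 (k' p)).ne'
    refine ext_flat_hgt (by rw [hPf, hkQ]) ?_
    rw [hPh, hQh, hεQ, ← hσf (k (Q p)), hkQ, hσf]
    field_simp
  refine ⟨_, (he.conj hP hQ hQP hPQ).mono fun p hp => ⟨Q p, ?_, hPQ p⟩, ?_⟩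
  · show hgt (Q p) ≤ ε (Q p) / 2
    have hp' : hgt p ≤ σ p / 2 := hp
    have h1 := hσ0 p
    have h2 := hε0 (k' p)
    rw [hQh, hεQ]
    calc hgt p * (ε (k' p) / σ p) ≤ σ p / 2 * (ε (k' p) / σ p) := by gcongr
      _ = _ := by field_simp
  · have h1 : {p | ∃ x : ℝ, 1 ≤ x ∧ p = k (x • hor) + σ (k (x • hor)) • vert} =
        P '' {p | ∃ x : ℝ, 1 ≤ x ∧ p = x • hor + ε (x • hor) • vert} := by
      have h2 : ∀ x : ℝ, P (x • hor + ε (x • hor) • vert) =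
          k (x • hor) + σ (k (x • hor)) • vert := fun x => by
        have e1 : flat (k (x • hor + ε (x • hor) • vert)) = k (x • hor) := by
          rw [hk.flat_apply]; simp
        have e2 : σ (k (x • hor + ε (x • hor) • vert)) = σ (k (x • hor)) := by
          rw [← hσf, e1]
        have e3 := (hε0 (x • hor)).ne'
        simp only [P, e1, e2, comp_flat_add_smul_vert hεf]
        simp
        field_simp
      ext p
      constructor
      · rintro ⟨x, hx, rfl⟩
        exact ⟨_, ⟨x, hx, rfl⟩, h2 x⟩
      · rintro ⟨_, ⟨x, hx, rfl⟩, rfl⟩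
        exact ⟨x, hx, h2 x⟩
    have h3 : e '' {p | ∃ x : ℝ, 1 ≤ x ∧ p = x • hor + ε (x • hor) • vert} = zetaRay :=
      image_eq_of_inverse hed hdi
    rw [h1, image_comp, image_comp, image_eq_of_inverse hQP rfl, h3, zetaRay_eq_vertRay]
    have h4 : ∀ t : ℝ, P (0 + t • vert) = k 0 + (t * (σ (k 0) / ε 0)) • vert := fun t => by
      have e1 : flat (k (0 + t • vert)) = k 0 := by rw [hk.flat_apply]; simp
      have e2 : σ (k (0 + t • vert)) = σ (k 0) := by rw [← hσf, e1]
      simp only [P, e1, e2, comp_flat_add_smul_vert hεf]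
      simp
    have h5 : 0 < σ (k 0) / ε 0 := div_pos (hσ0 _) (hε0 _)
    ext p
    constructor
    · rintro ⟨_, ⟨t, ht, rfl⟩, rfl⟩
      exact ⟨_, by nlinarith, h4 t⟩
    · rintro ⟨t, ht, rfl⟩
      refine ⟨_, ⟨t / (σ (k 0) / ε 0), by rwa [le_div_iff₀ h5, one_mul], rfl⟩, ?_⟩
      rw [h4, div_mul_cancel₀ _ h5.ne']

/-! ### Two parametrizations of the same half-space -/

namespace IsProperSmoothEmbedding

variable {Z : Type} [TopologicalSpace Z] [DiscreteTopology Z] {φ φ' : Z → E3 → E3}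

/-- Parametrizations of the same half-spaces differ along the boundary by a diffeomorphism of the
plane. -/
theorem exists_horizontalPair (hφ : IsProperSmoothEmbedding upperHalfSpace3 φ)
    (hφ' : IsProperSmoothEmbedding upperHalfSpace3 φ') (z : Z)
    (h : φ z '' {p | hgt p = 0} = φ' z '' {p | hgt p = 0}) :
    ∃ k k', IsHorizontalPair k k' ∧ ∀ p, φ z (flat p) = φ' z (k (flat p)) := by
  have key : ∀ {φ φ' : Z → E3 → E3}, IsProperSmoothEmbedding upperHalfSpace3 φ →
      IsProperSmoothEmbedding upperHalfSpace3 φ' →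
      φ z '' {p | hgt p = 0} ⊆ φ' z '' {p | hgt p = 0} →
      ∃ c : E3 → E3, ContDiff ℝ ∞ c ∧ ∀ p, hgt (c p) = 0 ∧ φ' z (c p) = φ z (flat p) := by
    intro φ φ' hφ hφ' h
    choose c hc0 hc using fun p => h ⟨flat p, hgt_flat p, rfl⟩
    replace hc0 : ∀ p, hgt (c p) = 0 := hc0
    refine ⟨c, ?_, fun p => ⟨hc0 p, hc p⟩⟩
    rw [contDiff_iff_contDiffAt]
    intro p₀
    have hcont : ContinuousAt c p₀ := by
      intro V hV
      have h1 : Tendsto (fun p => φ z (flat p)) (𝓝 p₀) (𝓝 (φ z (flat p₀))) :=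
        (hφ.contDiff_comp_flat z).continuous.continuousAt
      rw [← hc p₀] at h1
      show ∀ᶠ p in 𝓝 p₀, c p ∈ V
      filter_upwards [h1.eventually (hφ'.eventually_mem (boundary_subset (hc0 p₀)) hV)] with p hp
      exact (hp z (c p) (boundary_subset (hc0 p)) (hc p)).2
    -- A smooth map extending the boundary values of `φ' z` across the plane, linear in the
    -- transverse direction. Its local inverse expresses the continuous map `c` as a smooth one.
    let Ψ : E3 → E3 := fun p =>
      φ' z (flat p) + hgt p • fderivWithin ℝ (φ' z) upperHalfSpace3 (flat p) vert
    have hB : ContDiff ℝ ∞ fun p => fderivWithin ℝ (φ' z) upperHalfSpace3 (flat p) vert :=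
      (((hφ'.smooth z).fderivWithin (m := ∞) uniqueDiffOn_upperHalfSpace3
        (by simp)).comp_contDiff flat.contDiff flat_mem).clm_apply contDiff_const
    have hΨ : ContDiff ℝ ∞ Ψ := (hφ'.contDiff_comp_flat z).add (hgt.contDiff.smul hB)
    have hq : flat (c p₀) = c p₀ := flat_eq_self (hc0 p₀)
    obtain ⟨A, hA⟩ := exists_equiv_of_injective _
      (hφ'.immersion z (c p₀) (boundary_subset (hc0 p₀)))
    have hd : HasFDerivAt Ψ (A : E3 →L[ℝ] E3) (c p₀) := by
      have h1 := (hφ'.hasFDerivAt_comp_flat z (c p₀)).add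
        ((hgt.hasFDerivAt (x := c p₀)).smul
          ((hB.differentiable (by simp)) (c p₀)).hasFDerivAt)
      refine HasFDerivAt.congr_fderiv (f := Ψ) h1 ?_
      ext1 v
      rw [hA]
      simp only [hq, add_apply, ContinuousLinearMap.comp_apply,
        ContinuousLinearMap.smulRight_apply, hc0, zero_smul, zero_add]
      rw [← map_smul, ← map_add, flat_add_hgt]
    let e := hΨ.contDiffAt.toOpenPartialHomeomorph Ψ hd (by simp)
    have he : (e : E3 → E3) = Ψ := rfl
    have hes : c p₀ ∈ e.source := hΨ.contDiffAt.mem_toOpenPartialHomeomorph_source hd (by simp)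
    have hesm : ContDiffAt ℝ ∞ e.symm (Ψ (c p₀)) := hΨ.contDiffAt.to_localInverse hd (by simp)
    have hΨc : ∀ p, Ψ (c p) = φ z (flat p) := fun p => by
      simp only [Ψ, hc0, zero_smul, add_zero]
      rw [flat_eq_self (hc0 p), hc]
    rw [hΨc] at hesm
    refine (hesm.comp (f := fun p => φ z (flat p)) p₀
      (hφ.contDiff_comp_flat z).contDiffAt).congr_of_eventuallyEq ?_
    filter_upwards [hcont.eventually (e.open_source.mem_nhds hes)] with p hp
    show c p = e.symm (φ z (flat p))
    rw [← hΨc, ← he, e.left_inv hp]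
  obtain ⟨c, hc, hcP⟩ := key hφ hφ' h.subset
  obtain ⟨c', hc', hcP'⟩ := key hφ' hφ h.superset
  have hcc : ∀ p, c' (c p) = flat p := fun p => by
    have h1 := (hcP' (c p)).2
    rw [flat_eq_self (hcP p).1, (hcP p).2] at h1
    exact (hφ.eq_of_apply_eq (boundary_subset (hcP' _).1) (flat_mem p) h1).2
  have hcc' : ∀ p, c (c' p) = flat p := fun p => by
    have h1 := (hcP (c' p)).2
    rw [flat_eq_self (hcP' p).1, (hcP' p).2] at h1
    exact (hφ'.eq_of_apply_eq (boundary_subset (hcP _).1) (flat_mem p) h1).2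
  have hcf : ∀ p, c (flat p) = c p := fun p => by
    have h1 := (hcP (flat p)).2
    rw [flat_flat, ← (hcP p).2] at h1
    exact (hφ'.eq_of_apply_eq (boundary_subset (hcP _).1) (boundary_subset (hcP _).1) h1).2
  have hcf' : ∀ p, c' (flat p) = c' p := fun p => by
    have h1 := (hcP' (flat p)).2
    rw [flat_flat, ← (hcP' p).2] at h1
    exact (hφ.eq_of_apply_eq (boundary_subset (hcP' _).1) (boundary_subset (hcP' _).1) h1).2
  have hfc : ∀ p, flat (c p) = c p := fun p => flat_eq_self (hcP p).1
  have hfc' : ∀ p, flat (c' p) = c' p := fun p => flat_eq_self (hcP' p).1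
  refine ⟨fun p => c p + hgt p • vert, fun p => c' p + hgt p • vert,
    ⟨hc.add (hgt.contDiff.smul contDiff_const), hc'.add (hgt.contDiff.smul contDiff_const),
      fun p => ?_, fun p => ?_, fun p => ?_, fun p => ?_, fun p => ?_, fun p => ?_⟩, fun p => ?_⟩
  · simp only [comp_flat_add_smul_vert hcf', hcc, map_add, (hcP p).1, map_smul, hgt_vert,
      smul_eq_mul, mul_one, zero_add, flat_add_hgt]
  · simp only [comp_flat_add_smul_vert hcf, hcc', map_add, (hcP' p).1, map_smul, hgt_vert,
      smul_eq_mul, mul_one, zero_add, flat_add_hgt]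
  · simp [hcf, hfc]
  · simp [hcf', hfc']
  · simp [(hcP p).1]
  · simp [(hcP' p).1]
  · simp [hcf, (hcP p).2]

theorem comp_horizontalPair (hφ : IsProperSmoothEmbedding upperHalfSpace3 φ) {k k' : Z → E3 → E3}
    (hk : ∀ z, IsHorizontalPair (k z) (k' z)) :
    IsProperSmoothEmbedding upperHalfSpace3 fun z p => φ z (k z p) := by
  have hmem : ∀ z p, p ∈ upperHalfSpace3 → k z p ∈ upperHalfSpace3 := fun z p hp => by
    show 0 ≤ hgt (k z p)
    rw [(hk z).hgt_apply]; exact hp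
  have hmem' : ∀ z p, p ∈ upperHalfSpace3 → k' z p ∈ upperHalfSpace3 := fun z p hp => by
    show 0 ≤ hgt (k' z p)
    rw [(hk z).hgt_apply']; exact hp
  refine ⟨fun z => (hφ.smooth z).comp (hk z).smooth.contDiffOn (hmem z), fun z x hx => ?_,
    fun p q h => ?_, ?_⟩
  · have h1 : HasFDerivWithinAt (fun x => φ z (k z x))
        ((fderivWithin ℝ (φ z) upperHalfSpace3 (k z x)).comp (fderiv ℝ (k z) x))
        upperHalfSpace3 x :=
      (((hφ.smooth z).differentiableOn (by simp)) _ (hmem z x hx)).hasFDerivWithinAt.comp x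
        ((hk z).smooth.differentiable (by simp) x).hasFDerivAt.hasFDerivWithinAt (hmem z)
    rw [h1.fderivWithin (uniqueDiffOn_upperHalfSpace3 x hx)]
    refine (hφ.immersion z _ (hmem z x hx)).comp ?_
    have h2 : HasFDerivAt (fun x => k' z (k z x))
        ((fderiv ℝ (k' z) (k z x)).comp (fderiv ℝ (k z) x)) x :=
      HasFDerivAt.comp (g := k' z) x ((hk z).smooth'.differentiable (by simp) _).hasFDerivAt
        ((hk z).smooth.differentiable (by simp) x).hasFDerivAt
    simp only [(hk z).left_inv] at h2
    have h3 := h2.unique (hasFDerivAt_id x)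
    intro v w hvw
    have h4 := congrArg (fun A : E3 →L[ℝ] E3 => A v) h3
    have h5 := congrArg (fun A : E3 →L[ℝ] E3 => A w) h3
    simp only [ContinuousLinearMap.comp_apply, ContinuousLinearMap.id_apply] at h4 h5
    rw [← h4, ← h5]
    exact congrArg _ hvw
  · obtain ⟨z, x, hx⟩ := p
    obtain ⟨z', x', hx'⟩ := q
    obtain ⟨h1, h2⟩ := hφ.eq_of_apply_eq (hmem z x hx) (hmem z' x' hx') h
    obtain rfl : z = z' := h1
    have h3 : x = x' := by rw [← (hk z).left_inv x, h2, (hk z).left_inv]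
    subst h3; rfl
  · let K : Z × upperHalfSpace3 ≃ₜ Z × upperHalfSpace3 :=
      { toFun := fun p => (p.1, ⟨k p.1 p.2, hmem _ _ p.2.2⟩)
        invFun := fun p => (p.1, ⟨k' p.1 p.2, hmem' _ _ p.2.2⟩)
        left_inv := fun p => by simp [(hk p.1).left_inv]
        right_inv := fun p => by simp [(hk p.1).right_inv]
        continuous_toFun := by
          refine continuous_fst.prodMk (Continuous.subtype_mk ?_ _)
          exact continuous_prod_of_discrete_left.2 fun z =>
            (hk z).smooth.continuous.comp continuous_subtype_val
        continuous_invFun := by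
          refine continuous_fst.prodMk (Continuous.subtype_mk ?_ _)
          exact continuous_prod_of_discrete_left.2 fun z =>
            (hk z).smooth'.continuous.comp continuous_subtype_val }
    exact hφ.proper.comp K.isProperMap

end IsProperSmoothEmbedding

namespace IsProperSmoothEmbedding

variable {Z : Type} [TopologicalSpace Z] [DiscreteTopology Z] {φ φ' : Z → E3 → E3}

/-- Parametrizations which agree along the boundary: a graph close to the boundary in one of them is
also a graph in the other. -/
theorem exists_common_graph (hφ : IsProperSmoothEmbedding upperHalfSpace3 φ)
    (hφ' : IsProperSmoothEmbedding upperHalfSpace3 φ') (z : Z)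
    (hb : ∀ p, φ z (flat p) = φ' z (flat p))
    (hi : φ z '' {p | 0 < hgt p} ⊆ φ' z '' {p | 0 < hgt p}) :
    ∃ (ε σ : E3 → ℝ) (k k' : E3 → E3), ContDiff ℝ ∞ ε ∧ (∀ p, ε (flat p) = ε p) ∧
      (∀ p, 0 < ε p) ∧ (∀ p, ε p ≤ 1 / 2) ∧ ContDiff ℝ ∞ σ ∧ (∀ p, σ (flat p) = σ p) ∧
      (∀ p, 0 < σ p) ∧ IsHorizontalPair k k' ∧
      ∀ p, φ z (flat p + ε p • vert) = φ' z (flat (k p) + σ (k p) • vert) := by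
  -- The graph at height `s` with slope `l`, read in the second chart, has derivative within 1/2 of
  -- `flat`. This is what `exists_graph` requires.
  let Q : E3 → ℝ → (E3 →L[ℝ] ℝ) → Prop := fun x s l => ∀ K M, 0 < hgt K →
    φ' z K = φ z (flat x + s • vert) → (fderiv ℝ (φ' z) K).comp M =
      (fderiv ℝ (φ z) (flat x + s • vert)).comp (flat + (l.comp flat).smulRight vert) →
      ‖M - flat‖ ≤ 1 / 2
  obtain ⟨e, he, heP⟩ := exists_contDiff_pos_small (E := E3)
    (P := fun x s => s ≤ 1 / 2 ∧ ∀ s', 0 < s' → s' ≤ s → ∀ l, ‖l‖ ≤ s → Q x s' l) (by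
      intro x₀
      have hx₀ : flat x₀ ∈ upperHalfSpace3 := flat_mem x₀
      obtain ⟨A, hA⟩ := exists_equiv_of_injective _ (hφ'.immersion z (flat x₀) hx₀)
      obtain ⟨r, hr, hrA⟩ := exists_norm_sub_flat_le A
      set B := fderivWithin ℝ (φ z) upperHalfSpace3 (flat x₀)
      -- The charts agree along the boundary, so their tangential derivatives do; the transverse
      -- ones may differ, and enter only through the small slope.
      have hAB : (A : E3 →L[ℝ] E3).comp flat = B.comp flat := by
        have h1 := hφ'.hasFDerivAt_comp_flat z x₀
        have h2 := hφ.hasFDerivAt_comp_flat z x₀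
        simp only [hb] at h2
        rw [hA]
        exact h1.unique h2
      obtain ⟨ρ, hρ, hρB⟩ := Metric.continuousOn_iff.1 (hφ.continuousOn_fderivWithin z) _ hx₀
        (r / 4) (by positivity)
      obtain ⟨ρ', hρ', hρA⟩ := Metric.continuousOn_iff.1 (hφ'.continuousOn_fderivWithin z) _ hx₀
        r hr
      -- points of the second chart close to the boundary point
      have h1 : ∀ᶠ x : ℝ × E3 in 𝓝 (0, x₀), 0 ≤ x.1 → ∀ K, K ∈ upperHalfSpace3 →
          φ' z K = φ z (flat x.2 + x.1 • vert) → dist K (flat x₀) < ρ' := by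
        have hc : ContinuousWithinAt (φ z) upperHalfSpace3 (flat x₀) :=
          (hφ.smooth z).continuousOn _ hx₀
        have hm := hφ'.eventually_mem (z := z) hx₀ (Metric.ball_mem_nhds (flat x₀) hρ')
        rw [← hb] at hm
        have h2 := hc.eventually hm
        have h3 : Tendsto (fun x : ℝ × E3 => flat x.2 + x.1 • vert) (𝓝 (0, x₀)) (𝓝 (flat x₀)) := by
          have : Continuous fun x : ℝ × E3 => flat x.2 + x.1 • vert := by fun_prop
          simpa using this.tendsto (0, x₀)
        filter_upwards [h3.eventually (eventually_nhdsWithin_iff.1 h2)] with x hx hx0 K hK hKx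
        refine (hx ?_ z K hK hKx).2
        show 0 ≤ hgt (flat x.2 + x.1 • vert)
        simpa using hx0
      have h2 : ∀ᶠ x : ℝ × E3 in 𝓝 (0, x₀), dist (flat x.2 + x.1 • vert) (flat x₀) < ρ := by
        have : Continuous fun x : ℝ × E3 => flat x.2 + x.1 • vert := by fun_prop
        have h3 := this.tendsto (0, x₀)
        simp only [zero_smul, add_zero] at h3
        exact h3.eventually (Metric.ball_mem_nhds _ hρ)
      obtain ⟨c, hc, hcP⟩ := exists_pos_forall_of_eventually_nhds_prod
        (R := fun s x => (0 ≤ s → ∀ K, K ∈ upperHalfSpace3 →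
          φ' z K = φ z (flat x + s • vert) → dist K (flat x₀) < ρ') ∧
          dist (flat x + s • vert) (flat x₀) < ρ) (h1.and h2)
      -- The slope bound makes its contribution at most `r / 4`; the variation of the derivative
      -- contributes another `r / 4`.
      refine ⟨min (min c (1 / 2)) (r / (4 * (‖B‖ + r))), by positivity, hcP.mono ?_⟩
      intro x hx s hs hsc
      refine ⟨hsc.trans ((min_le_left _ _).trans (min_le_right _ _)), ?_⟩
      intro s' hs' hss l hl K M hK hKx hM
      obtain ⟨h3, h4⟩ := hx s' hs' (hss.trans (hsc.trans ((min_le_left _ _).trans (min_le_left _ _))))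
      have hlr : ‖l‖ ≤ r / (4 * (‖B‖ + r)) := hl.trans (hsc.trans (min_le_right _ _))
      have hyp : 0 < hgt (flat x + s' • vert) := by simpa using hs'
      have e1 := hρA K (hgt_pos_subset hK) (h3 hs'.le K (hgt_pos_subset hK) hKx)
      have e2 := hρB _ (hgt_pos_subset hyp) h4
      rw [dist_eq_norm, fderivWithin_of_mem_nhds (upperHalfSpace3_mem_nhds hK), ← hA] at e1
      rw [dist_eq_norm, fderivWithin_of_mem_nhds (upperHalfSpace3_mem_nhds hyp)] at e2
      set T := fderiv ℝ (φ z) (flat x + s' • vert)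
      refine hrA _ M _ e1 ?_ hM
      have e3 : T.comp (flat + (l.comp flat).smulRight vert) - (A : E3 →L[ℝ] E3).comp flat =
          (T - B).comp flat + (l.comp flat).smulRight (T vert) := by
        rw [hAB]; ext1 v; simp; abel
      have e4 : ‖T vert‖ ≤ ‖B‖ + r := by
        calc ‖T vert‖ ≤ ‖T‖ * ‖vert‖ := T.le_opNorm _
          _ = ‖T - B + B‖ := by rw [norm_vert, mul_one, sub_add_cancel]
          _ ≤ ‖T - B‖ + ‖B‖ := norm_add_le _ _
          _ ≤ _ := by linarith
      have e5 : 0 < ‖B‖ + r := by positivity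
      rw [e3]
      calc _ ≤ ‖(T - B).comp flat‖ + ‖(l.comp flat).smulRight (T vert)‖ := norm_add_le _ _
        _ ≤ ‖T - B‖ * ‖flat‖ + ‖l‖ * ‖flat‖ * ‖T vert‖ := by
            rw [ContinuousLinearMap.norm_smulRight_apply]
            gcongr
            · exact ContinuousLinearMap.opNorm_comp_le _ _
            · exact ContinuousLinearMap.opNorm_comp_le _ _
        _ ≤ r / 4 * 1 + r / (4 * (‖B‖ + r)) * 1 * (‖B‖ + r) := by
            have := norm_flat_clm_le
            gcongr
        _ = r / 2 := by field_simp; ring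
        _ < r := by linarith)
  let ε : E3 → ℝ := fun p => e (flat p)
  have hε : ContDiff ℝ ∞ ε := he.comp flat.contDiff
  have hεf : ∀ p, ε (flat p) = ε p := fun p => by simp [ε]
  have hε0 : ∀ p, 0 < ε p := fun p => (heP _).1
  have hψp : ∀ p, 0 < hgt (flat p + ε p • vert) := fun p => by simpa using hε0 p
  have hin : ContDiff ℝ ∞ fun p => flat p + ε p • vert :=
    flat.contDiff.add (hε.smul contDiff_const)
  have hψ : ContDiff ℝ ∞ fun p => φ z (flat p + ε p • vert) :=
    (hφ.contDiffOn_pos z).comp_contDiff hin hψp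
  obtain ⟨K, hK, hKP⟩ := hφ'.exists_lift z hψ fun p => by
    obtain ⟨y, hy, h⟩ := hi ⟨_, hψp p, rfl⟩
    exact ⟨y, hy, h⟩
  have hKf : ∀ p, K (flat p) = K p := fun p => by
    have h1 := (hKP (flat p)).2.1
    rw [flat_flat, hεf, ← (hKP p).2.1] at h1
    exact (hφ'.eq_of_apply_eq (hgt_pos_subset (hKP _).1) (hgt_pos_subset (hKP _).1) h1).2
  obtain ⟨k, k', σ, hk, hk', hσ, h1, h2, h3, h4, h5, h6, h7, h8⟩ := exists_graph hK hKf (fun p => by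
    obtain ⟨-, c, hc1, hc2, hc3⟩ := heP (flat p)
    refine (hc3 c ((hε0 p).trans_le hc1) le_rfl).2 (ε p) (hε0 p) hc1 _ hc2 (K p) _ (hKP p).1 ?_ ?_
    · rw [flat_flat]; exact (hKP p).2.1
    · rw [(hKP p).2.2, flat_flat]
      have e1 : HasFDerivAt (fun p => flat p + ε p • vert)
          (flat + ((fderiv ℝ e (flat p)).comp flat).smulRight vert) p :=
        flat.hasFDerivAt.add (((he.differentiable (by simp) _).hasFDerivAt.comp p
          flat.hasFDerivAt).smul_const vert)
      exact (HasFDerivAt.comp (g := φ z) p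
        (((hφ.contDiffOn_pos z).contDiffAt (isOpen_hgt_pos.mem_nhds (hψp p))).differentiableAt
          (by simp)).hasFDerivAt e1).fderiv)
  refine ⟨ε, σ, k, k', hε, hεf, hε0, fun p => ?_, hσ, h6, fun p => ?_,
    ⟨hk, hk', h1, h2, h3, h4, h5, fun p => ?_⟩, fun p => ?_⟩
  · obtain ⟨-, c, hc1, hc2, hc3⟩ := heP (flat p)
    exact hc1.trans (hc3 c ((hε0 p).trans_le hc1) le_rfl).1
  · rw [h7]; exact (hKP _).1
  · rw [← h5, h2]
  · rw [← (hKP p).2.1, ← h8]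

/-- Transplanting isotopies of the upper half-space which are constant near its boundary. -/
theorem exists_transplant (hφ : IsProperSmoothEmbedding upperHalfSpace3 φ) {b : Z → E3 → ℝ}
    (hbc : ∀ z, Continuous (b z)) (hb0 : ∀ z p, 0 < b z p) {d : Z → E3 → E3}
    (hd : ∀ z, IsotopicToIdRel {p | hgt p ≤ b z p} (d z)) :
    ∃ D, IsotopicToIdRel (⋃ z, φ z '' {p | 0 < hgt p})ᶜ D ∧
      ∀ z p, 0 < hgt p → D (φ z p) = φ z (d z p) := by
  have hC : ∀ z, {p | b z p ≤ hgt p} ⊆ {p | 0 < hgt p} := fun z p hp =>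
    (hb0 z p).trans_le (show b z p ≤ hgt p from hp)
  obtain ⟨D, hD, hDφ⟩ := IsotopicToIdRel.transplant (Φ := φ) (U := fun _ => {p | 0 < hgt p})
    (B := fun z => {p | hgt p ≤ b z p}) (fun _ => isOpen_hgt_pos) hφ.contDiffOn_pos
    (fun z x hx => hφ.injective_fderiv z hx)
    (fun z z' x x' hx hx' h => hφ.eq_of_apply_eq (hgt_pos_subset hx) (hgt_pos_subset hx') h)
    (C := fun z => {p | b z p ≤ hgt p}) hC
    (hφ.isClosed_iUnion_image (fun z => isClosed_le (hbc z) hgt.continuous)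
      fun z => (hC z).trans hgt_pos_subset)
    (fun z x hx => (not_le.1 (show ¬ b z x ≤ hgt x from hx)).le) hd
  refine ⟨D, hD.mono fun y hy z x hx hxy => (hy (mem_iUnion.2 ⟨z, ⟨x, hx, hxy⟩⟩)).elim, hDφ⟩

/-- Multirays with the same regular neighborhood, componentwise, are isotopic inside of it. -/
theorem exists_isotopy_of_image_eq (hφ : IsProperSmoothEmbedding upperHalfSpace3 φ)
    (hφ' : IsProperSmoothEmbedding upperHalfSpace3 φ')
    (hb : ∀ z, φ z '' {p | hgt p = 0} = φ' z '' {p | hgt p = 0})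
    (hi : ∀ z, φ z '' {p | 0 < hgt p} = φ' z '' {p | 0 < hgt p}) :
    ∃ D, IsotopicToIdRel (⋃ z, φ z '' {p | 0 < hgt p})ᶜ D ∧
      D '' (⋃ z, φ z '' zetaRay) = ⋃ z, φ' z '' zetaRay := by
  -- Precomposing the second parametrization with `κ` makes the two agree along the boundary, as
  -- needed for a common graph.
  choose κ κ' hκ hκb using fun z => hφ.exists_horizontalPair hφ' z (hb z)
  have hφκ := hφ'.comp_horizontalPair hκ
  have hκi : ∀ z, κ z '' {p | 0 < hgt p} = {p | 0 < hgt p} := fun z => by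
    ext p
    constructor
    · rintro ⟨q, hq, rfl⟩
      show 0 < hgt (κ z q)
      rw [(hκ z).hgt_apply]; exact hq
    · intro hp
      refine ⟨κ' z p, ?_, (hκ z).right_inv p⟩
      show 0 < hgt (κ' z p)
      rw [(hκ z).hgt_apply']; exact hp
  have hi' : ∀ z, (fun p => φ' z (κ z p)) '' {p | 0 < hgt p} = φ z '' {p | 0 < hgt p} := fun z => by
    rw [hi]
    nth_rewrite 2 [← hκi z]
    rw [image_image]
  choose ε σ k k' hε hεf hε0 hε1 hσ hσf hσ0 hk hgraph using fun z =>
    hφ.exists_common_graph hφκ z (hκb z) (hi' z).superset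
  choose d₁ hd₁ hd₁i using fun z => exists_lay_down (hε z) (hεf z) (hε0 z) (hε1 z)
  choose d₂ hd₂ hd₂i using fun z => exists_stand_up (hε z) (hεf z) (hε0 z) (hε1 z) (hσ z) (hσf z)
    (hσ0 z) (hk z)
  have hgt0 : ∀ z, hgt (k z 0) = 0 := fun z => by rw [(hk z).hgt_apply, map_zero]
  have hgt0' : ∀ z, hgt (κ' z 0) = 0 := fun z => by rw [(hκ z).hgt_apply', map_zero]
  -- The target lies over `κ' z 0` because `κ z` carries the vertical ray there to `zetaRay`.
  choose c hc d₃ hd₃ hd₃i using fun z => exists_move_vertRay (hgt0 z) (hgt0' z)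
    (div_pos (hσ0 z (k z 0)) (hε0 z 0)) one_pos
  obtain ⟨D₁, hD₁, hD₁φ⟩ := hφ.exists_transplant (fun z => (hε z).continuous.div_const 2)
    (fun z p => half_pos (hε0 z p)) hd₁
  obtain ⟨D₂, hD₂, hD₂φ⟩ := hφκ.exists_transplant (fun z => (hσ z).continuous.div_const 2)
    (fun z p => half_pos (hσ0 z p)) hd₂
  obtain ⟨D₃, hD₃, hD₃φ⟩ := hφκ.exists_transplant (fun z => continuous_const (y := c z))
    (fun z p => hc z) hd₃
  have hIU : ⋃ z, (fun p => φ' z (κ z p)) '' {p | 0 < hgt p} = ⋃ z, φ z '' {p | 0 < hgt p} :=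
    iUnion_congr hi'
  rw [hIU] at hD₂ hD₃
  refine ⟨D₃ ∘ D₂ ∘ D₁, hD₃.comp (hD₂.comp hD₁), ?_⟩
  have himg : ∀ {D : E3 → E3} {ψ : E3 → E3} {d : E3 → E3} {S T : Set E3},
      (∀ p, 0 < hgt p → D (ψ p) = ψ (d p)) → S ⊆ {p | 0 < hgt p} → d '' S = T →
      D '' (ψ '' S) = ψ '' T := by
    intro D ψ d S T h hS hST
    rw [← hST, image_image, image_image]
    exact image_congr fun p hp => h p (hS hp)
  rw [image_comp, image_comp, image_iUnion, image_iUnion, image_iUnion]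
  refine iUnion_congr fun z => ?_
  -- The same curve in ℝ³ read in the two parametrizations: this is where one passes from the first
  -- to the second.
  have e1 : φ z '' {p | ∃ x : ℝ, 1 ≤ x ∧ p = x • hor + ε z (x • hor) • vert} =
      (fun p => φ' z (κ z p)) ''
        {p | ∃ x : ℝ, 1 ≤ x ∧ p = k z (x • hor) + σ z (k z (x • hor)) • vert} := by
    have e2 : ∀ x : ℝ, φ z (x • hor + ε z (x • hor) • vert) =
        φ' z (κ z (k z (x • hor) + σ z (k z (x • hor)) • vert)) := fun x => by
      have := hgraph z (x • hor)
      rw [(hk z).flat_apply] at this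
      simpa using this
    ext y
    constructor
    · rintro ⟨_, ⟨x, hx, rfl⟩, rfl⟩
      exact ⟨_, ⟨x, hx, rfl⟩, (e2 x).symm⟩
    · rintro ⟨_, ⟨x, hx, rfl⟩, rfl⟩
      exact ⟨_, ⟨x, hx, rfl⟩, e2 x⟩
  rw [himg (hD₁φ z) zetaRay_subset (hd₁i z), e1, himg (hD₂φ z) ?_ (hd₂i z),
    himg (hD₃φ z) ?_ (hd₃i z)]
  · have e3 : (fun p => φ' z (κ z p)) '' vertRay (κ' z 0) 1 = φ' z '' (κ z '' vertRay (κ' z 0) 1) := by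
      rw [image_image]
    rw [e3]
    congr 1
    have e4 : ∀ t : ℝ, κ z (κ' z 0 + t • vert) = 0 + t • vert := fun t => by
      refine ext_flat_hgt ?_ ?_
      · have : flat (κ' z 0) = κ' z 0 := flat_eq_self (hgt0' z)
        rw [(hκ z).flat_apply, map_add, this]
        simp [(hκ z).right_inv]
      · rw [(hκ z).hgt_apply]; simp [hgt0']
    rw [zetaRay_eq_vertRay]
    ext p
    constructor
    · rintro ⟨_, ⟨t, ht, rfl⟩, rfl⟩
      exact ⟨t, ht, e4 t⟩
    · rintro ⟨t, ht, rfl⟩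
      exact ⟨_, ⟨t, ht, rfl⟩, e4 t⟩
  · rintro _ ⟨t, ht, rfl⟩
    show 0 < hgt _
    have : 0 < σ z (k z 0) / ε z 0 := div_pos (hσ0 _ _) (hε0 _ _)
    simp [hgt0]; linarith
  · rintro _ ⟨x, hx, rfl⟩
    show 0 < hgt _
    simpa [(hk z).hgt_apply] using hσ0 _ _

end IsProperSmoothEmbedding

/-- A diffeomorphism which matches regular neighborhoods is isotopic, relative to the complement of
the interior of the first of them, to one which also matches the multirays. -/
theorem exists_isotopicRel_image_ray_eq {n : ℕ∞} {τ τ' N N' : Set E3} (hN : IsRegularNhd n τ N)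
    (hN' : IsRegularNhd n τ' N') (g : E3 ≃ₘ[ℝ] E3) (hg : g '' N = N') :
    ∃ f : E3 ≃ₘ[ℝ] E3, f '' τ = τ' ∧ IsotopicRel (interior N)ᶜ g f := by
  obtain ⟨φ, hφ, rfl, rfl⟩ := hN
  obtain ⟨φ', hφ', rfl, rfl⟩ := hN'
  have hgφ := hφ.comp_diffeomorph g
  have himg : ∀ S : Set E3, g '' (⋃ z, φ z '' S) = ⋃ z, (fun x => g (φ z x)) '' S := fun S => by
    rw [image_iUnion]
    exact iUnion_congr fun z => by rw [image_image]
  rw [himg] at hg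
  have hHn : upperHalfSpace3.Nonempty := ⟨vert, zetaRay_subset.trans hgt_pos_subset vert_mem_zetaRay⟩
  have hHc : IsPreconnected upperHalfSpace3 := convex_upperHalfSpace3.isPreconnected
  obtain ⟨s, hs⟩ := (hgφ.isComponentFamily isClosed_upperHalfSpace3 subset_rfl hHn
    hHc).exists_equiv (hφ'.isComponentFamily isClosed_upperHalfSpace3 subset_rfl hHn hHc) hg
  have hφs := hφ'.comp_equiv s
  have hre : ∀ S : Set E3, ⋃ z, φ' (s z) '' S = ⋃ z, φ' z '' S := fun S =>
    s.surjective.iUnion_comp fun z => φ' z '' S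
  have hfr : ⋃ z, (fun x => g (φ z x)) '' {p | hgt p = 0} = ⋃ z, φ' (s z) '' {p | hgt p = 0} := by
    rw [← hgφ.frontier_iUnion_image, hg, ← hre, hφs.frontier_iUnion_image]
  have hin : ⋃ z, (fun x => g (φ z x)) '' {p | 0 < hgt p} =
      ⋃ z, φ' (s z) '' {p | 0 < hgt p} := by
    rw [← hgφ.interior_iUnion_image, hg, ← hre, hφs.interior_iUnion_image]
  -- Equality of unions of interiors or boundaries restricts to single components, since the closed
  -- half-spaces are already matched one by one and are disjoint.
  have hcomp : ∀ {a b : Idx n → E3 → E3} {S : Set E3}, S ⊆ upperHalfSpace3 →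
      IsProperSmoothEmbedding upperHalfSpace3 b →
      (∀ z, a z '' upperHalfSpace3 = b z '' upperHalfSpace3) →
      ⋃ z, a z '' S = ⋃ z, b z '' S → ∀ z, a z '' S ⊆ b z '' S := by
    rintro a b S hS hb hab h z _ ⟨p, hp, rfl⟩
    obtain ⟨w, q, hq, hqp⟩ := mem_iUnion.1 (h.subset (mem_iUnion.2 ⟨z, p, hp, rfl⟩))
    obtain ⟨q', hq', hqp'⟩ := (hab z).subset ⟨p, hS hp, rfl⟩
    obtain ⟨rfl, -⟩ := hb.eq_of_apply_eq (hS hq) hq' (hqp.trans hqp'.symm)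
    exact ⟨q, hq, hqp⟩
  obtain ⟨D, hD, hDτ⟩ := hgφ.exists_isotopy_of_image_eq hφs
    (fun z => (hcomp IsProperSmoothEmbedding.boundary_subset hφs hs hfr z).antisymm
      (hcomp IsProperSmoothEmbedding.boundary_subset hgφ (fun z => (hs z).symm) hfr.symm z))
    (fun z => (hcomp hgt_pos_subset hφs hs hin z).antisymm
      (hcomp hgt_pos_subset hgφ (fun z => (hs z).symm) hin.symm z))
  rw [← himg, hre] at hDτ
  obtain ⟨f, hf, hgf⟩ := IsotopicToIdRel.isotopicRel (A := (interior (⋃ z, φ z '' upperHalfSpace3))ᶜ)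
    g (by
      rw [show g '' (interior (⋃ z, φ z '' upperHalfSpace3))ᶜ =
        (g '' interior (⋃ z, φ z '' upperHalfSpace3))ᶜ from image_compl_eq g.bijective,
        hφ.interior_iUnion_image, himg]
      exact hD)
  refine ⟨f, ?_, hgf⟩
  rw [← hDτ, image_image]
  exact image_congr fun x _ => hf x

/-! ### Connectedness of complements -/

theorem isPreconnected_between {σ : E3 → ℝ} (hσ : Continuous σ) (hσf : ∀ p, σ (flat p) = σ p)
    (hσ0 : ∀ p, 0 < σ p) : IsPreconnected {p | 0 < hgt p ∧ hgt p < σ p} := by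
  have h1 : IsPreconnected {p : E3 | 0 < hgt p ∧ hgt p < 1} := by
    have := ((convex_Ioo (𝕜 := ℝ) (0 : ℝ) 1).linear_preimage (hgt : E3 →ₗ[ℝ] ℝ)).isPreconnected
    exact this
  have h2 := h1.image (fun p => flat p + (hgt p * σ p) • vert) (by fun_prop)
  have hs : ∀ p (c : ℝ), σ (flat p + c • vert) = σ p := fun p c => by
    rw [comp_flat_add_smul_vert hσf, hσf]
  refine (congrArg IsPreconnected ?_).mp h2
  ext p
  constructor
  · rintro ⟨q, ⟨hq0, hq1⟩, rfl⟩
    have := hσ0 q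
    show 0 < hgt (flat q + (hgt q * σ q) • vert) ∧ hgt (flat q + (hgt q * σ q) • vert) < _
    rw [hs]
    simp only [map_add, hgt_flat, map_smul, hgt_vert, smul_eq_mul, mul_one, zero_add]
    exact ⟨by positivity, by nlinarith⟩
  · rintro ⟨hp0, hp1⟩
    have := hσ0 p
    refine ⟨flat p + (hgt p / σ p) • vert, ⟨by simpa using div_pos hp0 this, ?_⟩, ?_⟩
    · simpa using (div_lt_one this).2 hp1
    · refine ext_flat_hgt (by simp) ?_
      simp only [map_add, hgt_flat, map_smul, hgt_vert, smul_eq_mul, mul_one, zero_add, hs]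
      field_simp
      exact zero_add _

namespace IsProperSmoothEmbedding

variable {Z : Type} [TopologicalSpace Z] [DiscreteTopology Z] {φ : Z → E3 → E3}

/-- The cone over a multiray has dimension at most two. -/
theorem dimH_cone_le [Countable Z] (hφ : IsProperSmoothEmbedding upperHalfSpace3 φ) (x : E3) :
    dimH {m : E3 | ∃ s : ℝ, ∃ y ∈ ⋃ z, φ z '' zetaRay, m = x + s • (y - x)} ≤ 2 := by
  have h1 : ∀ z, dimH ((fun q : ℝ × ℝ => x + q.1 • (φ z (q.2 • vert) - x)) ''
      {q : ℝ × ℝ | 0 < q.2}) ≤ 2 := fun z => by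
    have hs : ContDiffOn ℝ 1 (fun q : ℝ × ℝ => x + q.1 • (φ z (q.2 • vert) - x))
        {q : ℝ × ℝ | 0 < q.2} := by
      have h2 : ContDiffOn ℝ 1 (fun q : ℝ × ℝ => φ z (q.2 • vert)) {q : ℝ × ℝ | 0 < q.2} :=
        ((hφ.contDiffOn_pos z).of_le (by simp)).comp
          (contDiff_snd.smul contDiff_const).contDiffOn fun q hq => by
            show 0 < hgt (q.2 • vert)
            simpa using hq
      exact contDiffOn_const.add (contDiff_fst.contDiffOn.smul (h2.sub contDiffOn_const))
    have hc : Convex ℝ {q : ℝ × ℝ | 0 < q.2} :=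
      (convex_Ioi (𝕜 := ℝ) (0 : ℝ)).linear_preimage (LinearMap.snd ℝ ℝ ℝ)
    calc _ ≤ dimH {q : ℝ × ℝ | 0 < q.2} := hs.dimH_image_le hc subset_rfl
      _ ≤ dimH (univ : Set (ℝ × ℝ)) := dimH_mono (subset_univ _)
      _ = 2 := by rw [Real.dimH_univ_eq_finrank]; simp
  -- The cone is contained in countably many smooth images of a half-plane, none of which raises
  -- dimension.
  calc _ ≤ dimH (⋃ z, (fun q : ℝ × ℝ => x + q.1 • (φ z (q.2 • vert) - x)) ''
        {q : ℝ × ℝ | 0 < q.2}) := by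
        refine dimH_mono ?_
        rintro m ⟨s, y, hy, rfl⟩
        obtain ⟨z, p, hp, rfl⟩ := mem_iUnion.1 hy
        rw [zetaRay_eq_vertRay] at hp
        obtain ⟨t, ht, rfl⟩ := hp
        exact mem_iUnion.2 ⟨z, (s, t), one_pos.trans_le ht, by simp⟩
    _ ≤ 2 := by rw [dimH_iUnion]; exact iSup_le h1

/-- The complement of a multiray is connected. -/
theorem isPreconnected_compl_ray [Countable Z] (hφ : IsProperSmoothEmbedding upperHalfSpace3 φ) :
    IsPreconnected (⋃ z, φ z '' zetaRay)ᶜ := by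
  set τ := ⋃ z, φ z '' zetaRay
  refine isPreconnected_of_forall_pair fun x hx y hy => ?_
  have h1 : dimH ({m : E3 | ∃ s : ℝ, ∃ c ∈ τ, m = x + s • (c - x)} ∪
      {m : E3 | ∃ s : ℝ, ∃ c ∈ τ, m = y + s • (c - y)}) < Module.finrank ℝ E3 := by
    rw [dimH_union]
    refine (max_le (hφ.dimH_cone_le x) (hφ.dimH_cone_le y)).trans_lt ?_
    simp
    norm_num
  -- Neither cone fills ℝ³, so some `m` lies on no line joining `x` or `y` to a point of the
  -- multiray; the broken line from `x` through `m` to `y` avoids it.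
  obtain ⟨m, hm⟩ := (dense_compl_of_dimH_lt_finrank h1).nonempty
  rw [mem_compl_iff, mem_union, not_or] at hm
  have h2 : ∀ x ∉ τ, (¬ ∃ s : ℝ, ∃ c ∈ τ, m = x + s • (c - x)) → segment ℝ x m ⊆ τᶜ := by
    intro x hx h c hc hcτ
    rw [segment_eq_image'] at hc
    obtain ⟨t, -, rfl⟩ := hc
    have ht : t ≠ 0 := fun h0 => hx (by simpa [h0] using hcτ)
    refine h ⟨t⁻¹, _, hcτ, ?_⟩
    simp [smul_smul, ht]
  refine ⟨segment ℝ x m ∪ segment ℝ y m, union_subset (h2 x hx hm.1) (h2 y hy hm.2),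
    Or.inl (left_mem_segment ℝ x m), Or.inr (left_mem_segment ℝ y m), ?_⟩
  exact IsPreconnected.union m (right_mem_segment ℝ x m) (right_mem_segment ℝ y m)
    (convex_segment x m).isPreconnected (convex_segment y m).isPreconnected

/-- The complement of a regular neighborhood is connected. -/
theorem isPreconnected_compl [Countable Z] (hφ : IsProperSmoothEmbedding upperHalfSpace3 φ) :
    IsPreconnected (⋃ z, φ z '' upperHalfSpace3)ᶜ := by
  have hζH := zetaRay_subset.trans hgt_pos_subset
  obtain ⟨D, σ, hD, hσ⟩ := hφ.exists_push (A := ⋃ z, φ z '' zetaRay)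
    (hφ.isClosed_iUnion_image (fun _ => isClosed_zetaRay) fun _ => hζH)
    (fun z p hp h => by
      obtain ⟨w, q, hq, hqp⟩ := mem_iUnion.1 h
      obtain ⟨-, rfl⟩ := hφ.eq_of_apply_eq (hζH hq) (boundary_subset hp) hqp
      exact (zetaRay_subset hq).ne' hp)
    fun z => mem_iUnion.2 ⟨z, _, vert_mem_zetaRay, rfl⟩
  choose hσs hσf hσ0 hσi using hσ
  have hDN : D '' (⋃ z, φ z '' upperHalfSpace3) = ⋃ z, φ z '' {p | σ z p ≤ hgt p} := by
    rw [image_iUnion]; exact iUnion_congr hσi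
  set N₁ := ⋃ z, φ z '' {p | σ z p ≤ hgt p}
  have hσH : ∀ z, {p | σ z p ≤ hgt p} ⊆ {p | 0 < hgt p} := fun z p hp =>
    (hσ0 z p).1.trans_le (show σ z p ≤ hgt p from hp)
  have hN₁ : IsClosed N₁ := hφ.isClosed_iUnion_image
    (fun z => isClosed_le (hσs z).continuous hgt.continuous) fun z => (hσH z).trans hgt_pos_subset
  -- The pushed-in neighborhood has open collars outside it. Each is connected, hence lies on one
  -- side of a separation, which can then be extended over the punctured open half-space to separate
  -- the complement of the multiray.
  have key : IsPreconnected N₁ᶜ := by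
    rw [isPreconnected_iff_subset_of_disjoint]
    intro u v hu hv huv hd
    have hmem : ∀ z p, 0 < hgt p → (φ z p ∈ N₁ᶜ ↔ hgt p < σ z p) := fun z p hp => by
      refine ⟨fun h => not_le.1 fun h' => h (mem_iUnion.2 ⟨z, p, h', rfl⟩), fun h h' => ?_⟩
      obtain ⟨w, q, hq, hqp⟩ := mem_iUnion.1 h'
      obtain ⟨rfl, rfl⟩ := hφ.eq_of_apply_eq (hgt_pos_subset (hσH w hq)) (hgt_pos_subset hp) hqp
      exact absurd h (not_lt.2 hq)
    have hcol : ∀ z, φ z '' {p | 0 < hgt p ∧ hgt p < σ z p} ⊆ u ∨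
        φ z '' {p | 0 < hgt p ∧ hgt p < σ z p} ⊆ v := fun z => by
      have h1 := (isPreconnected_between (hσs z).continuous (hσf z) fun p => (hσ0 z p).1).image
        (φ z) ((hφ.contDiffOn_pos z).continuousOn.mono fun p hp => hp.1)
      have h2 : φ z '' {p | 0 < hgt p ∧ hgt p < σ z p} ⊆ N₁ᶜ := by
        rintro _ ⟨p, hp, rfl⟩
        exact (hmem z p hp.1).2 hp.2
      refine isPreconnected_iff_subset_of_disjoint.1 h1 u v hu hv (h2.trans huv) ?_
      exact subset_empty_iff.1 ((inter_subset_inter_left _ h2).trans hd.subset)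
    have hne : ∀ z, ¬ (φ z '' {p | 0 < hgt p ∧ hgt p < σ z p} ⊆ u ∧
        φ z '' {p | 0 < hgt p ∧ hgt p < σ z p} ⊆ v) := fun z h => by
      have hp : (σ z 0 / 2) • vert ∈ {p | 0 < hgt p ∧ hgt p < σ z p} := by
        have h0 := (hσ0 z 0).1
        have : σ z ((σ z 0 / 2) • vert) = σ z 0 := by
          rw [← hσf]; simp
        refine ⟨by simpa using h0, ?_⟩
        rw [this]; simpa using h0
      exact (hd.subset ⟨(hmem z _ hp.1).2 hp.2, h.1 ⟨_, hp, rfl⟩, h.2 ⟨_, hp, rfl⟩⟩ : _)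
    have hop : ∀ z, IsOpen (φ z '' ({p | 0 < hgt p} \ zetaRay)) := fun z =>
      hφ.isOpen_image z (isOpen_hgt_pos.sdiff isClosed_zetaRay) sdiff_subset
    -- extending an open set of the complement over the punctured half-spaces
    let ext : Set E3 → Set E3 := fun u => (N₁ᶜ ∩ u) ∪
      ⋃ z ∈ {z | φ z '' {p | 0 < hgt p ∧ hgt p < σ z p} ⊆ u}, φ z '' ({p | 0 < hgt p} \ zetaRay)
    have hextop : ∀ u, IsOpen u → IsOpen (ext u) := fun u hu =>
      (hN₁.isOpen_compl.inter hu).union (isOpen_biUnion fun z _ => hop z)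
    have hτ : ∀ z p, 0 < hgt p → φ z p ∉ ⋃ z, φ z '' zetaRay → p ∉ zetaRay := fun z p _ h hp =>
      h (mem_iUnion.2 ⟨z, p, hp, rfl⟩)
    have hcov : (⋃ z, φ z '' zetaRay)ᶜ ⊆ ext u ∪ ext v := by
      intro y hy
      by_cases hyN : y ∈ N₁
      · obtain ⟨z, p, hp, rfl⟩ := mem_iUnion.1 hyN
        have hm : φ z p ∈ φ z '' ({p | 0 < hgt p} \ zetaRay) :=
          ⟨p, ⟨hσH z hp, hτ z p (hσH z hp) hy⟩, rfl⟩
        rcases hcol z with h | h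
        · exact Or.inl (Or.inr (mem_iUnion₂.2 ⟨z, h, hm⟩))
        · exact Or.inr (Or.inr (mem_iUnion₂.2 ⟨z, h, hm⟩))
      · rcases huv hyN with h | h
        · exact Or.inl (Or.inl ⟨hyN, h⟩)
        · exact Or.inr (Or.inl ⟨hyN, h⟩)
    have hdisj : ∀ y, y ∈ ext u → y ∈ ext v → False := by
      have hpt : ∀ u v : Set E3, N₁ᶜ ∩ (u ∩ v) = ∅ → ∀ y, y ∈ N₁ᶜ ∩ u →
          y ∈ (⋃ z ∈ {z | φ z '' {p | 0 < hgt p ∧ hgt p < σ z p} ⊆ v},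
            φ z '' ({p | 0 < hgt p} \ zetaRay)) → False := by
        rintro u v hd y ⟨hyN, hyu⟩ hy
        obtain ⟨z, hz, p, hp, rfl⟩ := mem_iUnion₂.1 hy
        have hz' : φ z '' {p | 0 < hgt p ∧ hgt p < σ z p} ⊆ v := hz
        exact (hd.subset ⟨hyN, hyu, hz' ⟨p, ⟨hp.1, (hmem z p hp.1).1 hyN⟩, rfl⟩⟩ : _)
      rintro y (h1 | h1) (h2 | h2)
      · exact (hd.subset ⟨h1.1, h1.2, h2.2⟩ : _)
      · exact hpt u v hd y h1 h2
      · exact hpt v u (by rw [inter_comm v]; exact hd) y h2 h1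
      · obtain ⟨z, hz, p, hp, rfl⟩ := mem_iUnion₂.1 h1
        obtain ⟨w, hw, q, hq, hqp⟩ := mem_iUnion₂.1 h2
        obtain ⟨rfl, -⟩ := hφ.eq_of_apply_eq (hgt_pos_subset hq.1) (hgt_pos_subset hp.1) hqp
        exact hne w ⟨hz, hw⟩
    have hWτ : N₁ᶜ ⊆ (⋃ z, φ z '' zetaRay)ᶜ := by
      refine compl_subset_compl.2 (iUnion_mono fun z => image_mono fun p hp => ?_)
      rw [zetaRay_eq] at hp
      show σ z p ≤ hgt p
      linarith [(hσ0 z p).2, hp.2]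
    rcases isPreconnected_iff_subset_of_disjoint.1 hφ.isPreconnected_compl_ray (ext u) (ext v)
      (hextop u hu) (hextop v hv) hcov (eq_empty_iff_forall_notMem.2
        fun y hy => hdisj y hy.2.1 hy.2.2) with h | h
    · left
      intro y hy
      rcases huv hy with h' | h'
      · exact h'
      · exact (hdisj y (h (hWτ hy)) (Or.inl ⟨hy, h'⟩)).elim
    · right
      intro y hy
      rcases huv hy with h' | h'
      · exact (hdisj y (Or.inl ⟨hy, h'⟩) (h (hWτ hy))).elim
      · exact h'
  obtain ⟨E, hE, hED, -⟩ := hD.exists_inverse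
  have h1 := key.image E hE.contDiff.continuous.continuousOn
  rwa [← hDN, ← image_compl_eq hD.bijective, image_image, image_congr fun x _ => hED x,
    image_id'] at h1

end IsProperSmoothEmbedding

/-! ### Complementary half-spaces have unknotted cores -/

/-- A diffeomorphism from `(0, 1)` onto `(0, ∞)` which is the identity on `(0, 1 / 2)`. -/
theorem exists_blow_up : ∃ ξ ξ' : ℝ → ℝ, ContDiffOn ℝ ∞ ξ (Iio 1) ∧ (∀ u ≤ 1 / 2, ξ u = u) ∧
    (∀ u, 0 < u → u < 1 → 0 < ξ u) ∧ (∀ u, 0 < u → u < 1 → HasDerivAt ξ (ξ' u) u ∧ 0 < ξ' u) ∧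
    InjOn ξ (Ioo 0 1) ∧ ∀ y, 0 < y → ∃ u, 0 < u ∧ u < 1 ∧ ξ u = y := by
  set S := Real.smoothTransition
  have hS : ContDiff ℝ ∞ S := Real.smoothTransition.contDiff
  have hS0 := Real.smoothTransition.nonneg
  -- The added term vanishes up to 1/2, where the cutoff starts, and tends to infinity at 1.
  let ξ : ℝ → ℝ := fun u => u + S (4 * u - 2) * (u / (1 - u))
  let ξ' : ℝ → ℝ := fun u => 1 + (deriv S (4 * u - 2) * 4 * (u / (1 - u)) +
    S (4 * u - 2) * ((1 * (1 - u) - u * (-1)) / (1 - u) ^ 2))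
  have h1 : ∀ u ≤ 1 / 2, ξ u = u := fun u hu => by
    have : S (4 * u - 2) = 0 := Real.smoothTransition.zero_of_nonpos (by linarith)
    simp [ξ, this]
  have hξ : ContDiffOn ℝ ∞ ξ (Iio 1) := by
    refine contDiffOn_id.add (ContDiffOn.mul (ContDiff.contDiffOn (hS.comp (by fun_prop))) ?_)
    exact contDiffOn_id.div (contDiffOn_const.sub contDiffOn_id) fun u hu =>
      (sub_pos.2 (show u < 1 from hu)).ne'
  have h2 : ∀ u, 0 < u → u < 1 → HasDerivAt ξ (ξ' u) u ∧ 0 < ξ' u := fun u hu hu1 => by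
    have hu' : 0 < 1 - u := by linarith
    have e1 : HasDerivAt (fun u : ℝ => 4 * u - 2) 4 u := by
      simpa using ((hasDerivAt_id u).const_mul 4).sub_const 2
    have e2 : HasDerivAt (fun u : ℝ => S (4 * u - 2)) (deriv S (4 * u - 2) * 4) u :=
      HasDerivAt.comp (h₂ := S) u (hasDerivAt_smoothTransition _) e1
    have e3 : HasDerivAt (fun u : ℝ => u / (1 - u)) ((1 * (1 - u) - u * (-1)) / (1 - u) ^ 2) u :=
      (hasDerivAt_id u).fun_div ((hasDerivAt_id u).const_sub 1) hu'.ne'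
    refine ⟨(hasDerivAt_id u).fun_add (e2.fun_mul e3), ?_⟩
    have e4 : 0 ≤ deriv S (4 * u - 2) := Real.smoothTransition.monotone.deriv_nonneg
    have e5 : 0 ≤ S (4 * u - 2) * ((1 * (1 - u) - u * (-1)) / (1 - u) ^ 2) := by
      refine mul_nonneg (hS0 _) (div_nonneg ?_ (sq_nonneg _))
      linarith
    have : 0 ≤ deriv S (4 * u - 2) * 4 * (u / (1 - u)) := by positivity
    simp only [ξ']
    linarith
  refine ⟨ξ, ξ', hξ, h1, fun u hu hu1 => ?_, h2, ?_, fun y hy => ?_⟩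
  · have hu' : 0 < 1 - u := by linarith
    have : 0 ≤ S (4 * u - 2) * (u / (1 - u)) := mul_nonneg (hS0 _) (by positivity)
    simp only [ξ]
    linarith
  · refine StrictMonoOn.injOn (strictMonoOn_of_deriv_pos (convex_Ioo 0 1)
      (hξ.continuousOn.mono fun u hu => hu.2) fun u hu => ?_)
    rw [interior_Ioo] at hu
    rw [(h2 u hu.1 hu.2).1.deriv]
    exact (h2 u hu.1 hu.2).2
  · have ha : 0 < min y (1 / 2) := by positivity
    have hb1 : max (3 / 4) (y / (1 + y)) < 1 := by
      refine max_lt (by norm_num) ?_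
      rw [div_lt_one (by positivity)]; linarith
    set b := max (3 / 4) (y / (1 + y))
    have hab : min y (1 / 2) ≤ b := (min_le_right _ _).trans
      ((by norm_num : (1 : ℝ) / 2 ≤ 3 / 4).trans (le_max_left _ _))
    have hξb : y ≤ ξ b := by
      have e1 : S (4 * b - 2) = 1 := Real.smoothTransition.one_of_one_le (by
        have : 3 / 4 ≤ b := le_max_left _ _
        linarith)
      have e2 : y / (1 + y) ≤ b := le_max_right _ _
      have e3 : 0 < 1 - b := by linarith
      have e4 : y ≤ b / (1 - b) := by
        rw [le_div_iff₀ e3]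
        rw [div_le_iff₀ (by positivity)] at e2
        linarith
      have e5 : 0 ≤ b := ha.le.trans hab
      simp only [ξ, e1]
      linarith
    obtain ⟨u, hu, huy⟩ := intermediate_value_Icc hab
      (hξ.continuousOn.mono fun u hu => hu.2.trans_lt hb1)
      ⟨(h1 _ (min_le_right _ _)).trans_le (min_le_left _ _), hξb⟩
    exact ⟨u, ha.trans_le hu.1, hu.2.trans_lt hb1, huy⟩

/-- A diffeomorphism from the region between the plane and the graph of `σ` onto the upper
half-space, which is the identity near the plane. -/
theorem exists_fiberwise_blow_up {σ : E3 → ℝ} (hσ : ContDiff ℝ ∞ σ) (hσf : ∀ p, σ (flat p) = σ p)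
    (hσ0 : ∀ p, 0 < σ p) :
    ∃ ρ : E3 → E3, ContDiffOn ℝ ∞ ρ {p | hgt p < σ p} ∧
      (∀ p, 0 < hgt p → hgt p < σ p → Injective (fderiv ℝ ρ p)) ∧
      (∀ p, hgt p ≤ σ p / 2 → ρ p = p) ∧ (∀ p, 0 < hgt p → hgt p < σ p → 0 < hgt (ρ p)) ∧
      InjOn ρ {p | 0 < hgt p ∧ hgt p < σ p} ∧
      ∀ q, 0 < hgt q → ∃ p, 0 < hgt p ∧ hgt p < σ p ∧ ρ p = q := by
  obtain ⟨ξ, ξ', hξ, h1, h2, h3, h4, h5⟩ := exists_blow_up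
  let ρ : E3 → E3 := fun p => flat p + (σ p * ξ (hgt p / σ p)) • vert
  have hρf : ∀ p, flat (ρ p) = flat p := fun p => by simp [ρ]
  have hρh : ∀ p, hgt (ρ p) = σ p * ξ (hgt p / σ p) := fun p => by simp [ρ]
  have hu : ∀ p, hgt p < σ p → hgt p / σ p < 1 := fun p hp => (div_lt_one (hσ0 p)).2 hp
  have hu0 : ∀ p, 0 < hgt p → 0 < hgt p / σ p := fun p hp => div_pos hp (hσ0 p)
  have hρ : ContDiffOn ℝ ∞ ρ {p | hgt p < σ p} := by
    refine flat.contDiff.contDiffOn.add (ContDiffOn.smul (hσ.contDiffOn.mul ?_) contDiffOn_const)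
    exact hξ.comp (hgt.contDiff.div hσ fun p => (hσ0 p).ne').contDiffOn hu
  refine ⟨ρ, hρ, fun p hp hpσ => ?_, fun p hp => ?_, fun p hp hpσ => ?_, ?_, fun q hq => ?_⟩
  · have hopen : IsOpen {p | hgt p < σ p} := isOpen_lt hgt.continuous hσ.continuous
    have hd : HasFDerivAt ρ (fderiv ℝ ρ p) p :=
      ((hρ.contDiffAt (hopen.mem_nhds hpσ)).differentiableAt (by simp)).hasFDerivAt
    have hf : flat.comp (fderiv ℝ ρ p) = flat := by
      have e1 := flat.hasFDerivAt.comp p hd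
      have e2 : (flat : E3 → E3) ∘ ρ = flat := funext hρf
      rw [e2] at e1
      exact e1.unique flat.hasFDerivAt
    have hv : fderiv ℝ ρ p vert = ξ' (hgt p / σ p) • vert := by
      have e1 : HasDerivAt (fun t : ℝ => p + t • vert) vert 0 := by
        simpa using ((hasDerivAt_id (0 : ℝ)).smul_const vert).const_add p
      have e2 : HasDerivAt (fun t : ℝ => ρ (p + t • vert)) (fderiv ℝ ρ p vert) 0 := by
        refine HasFDerivAt.comp_hasDerivAt (l := ρ) 0 ?_ e1
        rw [zero_smul, add_zero]; exact hd
      have e3 : HasDerivAt (fun t : ℝ => (hgt p + t) / σ p) (1 / σ p) 0 :=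
        ((hasDerivAt_id (0 : ℝ)).const_add (hgt p)).div_const (σ p)
      have e4 : HasDerivAt (fun t : ℝ => ξ ((hgt p + t) / σ p)) (ξ' (hgt p / σ p) * (1 / σ p)) 0 := by
        refine HasDerivAt.comp (h₂ := ξ) 0 ?_ e3
        rw [add_zero]
        exact (h3 _ (hu0 p hp) (hu p hpσ)).1
      have e5 : HasDerivAt (fun t : ℝ => ρ (p + t • vert))
          ((σ p * (ξ' (hgt p / σ p) * (1 / σ p))) • vert) 0 := by
        refine (((e4.const_mul (σ p)).smul_const vert).const_add (flat p)).congr_of_eventuallyEq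
          (Eventually.of_forall fun t => ?_)
        simp [ρ, comp_flat_add_smul_vert hσf]
      rw [e2.unique e5]
      have := (hσ0 p).ne'
      congr 1
      field_simp
    rw [injective_iff_map_eq_zero]
    intro v hv0
    have hfv : flat v = 0 := by
      have := congrArg (fun A : E3 →L[ℝ] E3 => A v) hf
      simp only [ContinuousLinearMap.comp_apply, hv0, map_zero] at this
      exact this.symm
    have hvv : v = hgt v • vert := by
      conv_lhs => rw [← flat_add_hgt v, hfv, zero_add]
    rw [hvv, map_smul, hv] at hv0
    have := congrArg hgt hv0
    have hpos := (h3 _ (hu0 p hp) (hu p hpσ)).2.ne'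
    have h0 : hgt v = 0 := by simpa [hpos] using this
    rw [hvv, h0, zero_smul]
  · have := hσ0 p
    refine ext_flat_hgt (hρf p) ?_
    rw [hρh, h1 _ (by rw [div_le_iff₀ this]; linarith)]
    field_simp
  · rw [hρh]
    exact mul_pos (hσ0 p) (h2 _ (hu0 p hp) (hu p hpσ))
  · rintro p ⟨hp0, hpσ⟩ q ⟨hq0, hqσ⟩ hpq
    have hf : flat p = flat q := by rw [← hρf, hpq, hρf]
    have hs : σ p = σ q := by rw [← hσf, hf, hσf]
    have e1 := congrArg hgt hpq
    rw [hρh, hρh, hs] at e1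
    have e2 := mul_left_cancel₀ (hσ0 q).ne' e1
    have e3 := h4 ⟨by rw [← hs]; exact hu0 p hp0, by rw [← hs]; exact hu p hpσ⟩
      ⟨hu0 q hq0, hu q hqσ⟩ e2
    exact ext_flat_hgt hf (by have := (hσ0 q).ne'; field_simp at e3; exact e3)
  · have hσq := hσ0 q
    obtain ⟨u, hu0, hu1, huy⟩ := h5 (hgt q / σ q) (div_pos hq hσq)
    have hs : σ (flat q + (u * σ q) • vert) = σ q := by
      rw [comp_flat_add_smul_vert hσf, hσf]
    refine ⟨flat q + (u * σ q) • vert, by simp; positivity, ?_, ext_flat_hgt ?_ ?_⟩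
    · rw [hs]; simp; nlinarith
    · rw [hρf]; simp
    · rw [hρh, hs]
      have : hgt (flat q + (u * σ q) • vert) / σ q = u := by simp; field_simp
      rw [this, huy]
      field_simp

theorem isRadial_of_subset_axisRay {S : Set E3} (hS : S ⊆ axisRay) : IsRadial S := by
  intro x _
  refine ⟨vert, fun h => ?_, fun y hy => ?_⟩
  · have := norm_vert
    rw [h] at this; simp at this
  · obtain ⟨t, ht, rfl⟩ := mem_axisRay_iff.1 (hS (connectedComponentIn_subset S x hy))
    exact ⟨t, ht, rfl⟩

namespace IsProperSmoothEmbedding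

variable {Z : Type} [TopologicalSpace Z] [DiscreteTopology Z] {φ φ' : Z → E3 → E3}

/-- The ray in an open half-space whose complement is a properly embedded closed half-space is
unknotted. -/
theorem exists_diffeomorph_straighten (hφ : IsProperSmoothEmbedding upperHalfSpace3 φ)
    (hφ' : IsProperSmoothEmbedding upperHalfSpace3 φ') {w : Z}
    (h : φ' w '' {p | 0 < hgt p} = (⋃ z, φ z '' upperHalfSpace3)ᶜ) :
    ∃ e : E3 ≃ₘ[ℝ] E3, e '' (φ' w '' zetaRay) ⊆ axisRay := by
  -- The push fixes the ray under study, and also the rays of `φ`, which `exists_push` needs as base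
  -- points.
  have hζH := zetaRay_subset.trans hgt_pos_subset
  set A := φ' w '' zetaRay ∪ ⋃ z, φ z '' zetaRay
  have hAcl : IsClosed A := by
    refine IsClosed.union ?_ (hφ.isClosed_iUnion_image (fun _ => isClosed_zetaRay) fun _ => hζH)
    simpa using (hφ'.isComponentFamily isClosed_zetaRay hζH ⟨_, vert_mem_zetaRay⟩
      isPreconnected_zetaRay).closed {w}
  have hφ'N : ∀ p, 0 < hgt p → φ' w p ∉ ⋃ z, φ z '' upperHalfSpace3 := fun p hp =>
    h.subset ⟨p, hp, rfl⟩
  obtain ⟨D, σ, hD, hσ⟩ := hφ.exists_push hAcl (fun z p hp hA => by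
    rcases hA with ⟨q, hq, hqp⟩ | hA
    · exact hφ'N q (zetaRay_subset hq) (mem_iUnion.2 ⟨z, p, boundary_subset hp, hqp.symm⟩)
    · obtain ⟨w, q, hq, hqp⟩ := mem_iUnion.1 hA
      obtain ⟨-, rfl⟩ := hφ.eq_of_apply_eq (hζH hq) (boundary_subset hp) hqp
      exact (zetaRay_subset hq).ne' hp) fun z => Or.inr (mem_iUnion.2 ⟨z, _, vert_mem_zetaRay, rfl⟩)
  choose hσs hσf hσ0 hσi using hσ
  choose ρ hρ hρd hρid hρp hρi hρs using fun z =>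
    exists_fiberwise_blow_up (hσs z) (hσf z) fun p => (hσ0 z p).1
  have hinj : ∀ z z' x x', x ∈ {p | 0 < hgt p} → x' ∈ {p | 0 < hgt p} → φ z x = φ z' x' →
      z = z' ∧ x = x' := fun z z' x x' hx hx' h =>
    hφ.eq_of_apply_eq (hgt_pos_subset hx) (hgt_pos_subset hx') h
  have hC : ∀ z, {p | σ z p / 2 ≤ hgt p} ⊆ {p | 0 < hgt p} := fun z p hp =>
    (half_pos (hσ0 z p).1).trans_le (show σ z p / 2 ≤ hgt p from hp)
  have hCcl : IsClosed (⋃ z, φ z '' {p | σ z p / 2 ≤ hgt p}) :=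
    hφ.isClosed_iUnion_image (fun z => isClosed_le ((hσs z).continuous.div_const 2) hgt.continuous)
      fun z => (hC z).trans hgt_pos_subset
  -- Blowing up the collars between the boundary and the graphs carries the complement of the
  -- pushed-in neighborhood onto ℝ³, and is the identity outside the original neighborhood.
  let r : E3 → E3 := transplant φ (fun _ => {p | 0 < hgt p}) ρ
  have hr : ∀ z p, 0 < hgt p → r (φ z p) = φ z (ρ z p) := fun z p hp =>
    transplant_apply (U := fun _ => {p | 0 < hgt p}) hinj ρ hp
  have hr' : ∀ y, y ∉ ⋃ z, φ z '' {p | σ z p / 2 ≤ hgt p} → r y = y := fun y hy =>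
    transplant_of_notMem (U := fun _ => {p | 0 < hgt p}) hinj
      (fun z x hx => hρid z x (not_le.1 (show ¬ σ z x / 2 ≤ hgt x from hx)).le) hy
  -- A parametrization by ℝ³ of the complement of the pushed-in neighborhood; followed by `r` it
  -- becomes a self-diffeomorphism `G` of ℝ³.
  let Y : E3 → E3 := fun x => D (φ' w (expChart x))
  have hψ := hφ'.isRayChart
  have hYs : ContDiff ℝ ∞ Y := hD.contDiff.comp (hψ.smooth w)
  have hYi : Injective Y := fun x x' hx =>
    (hψ.eq_of_apply_eq w w x x' (hD.bijective.1 hx)).2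
  obtain ⟨E, hE, hED, hDE⟩ := hD.exists_inverse
  have hYd : ∀ x, Injective (fderiv ℝ Y x) := fun x => by
    have e1 := (hYs.differentiable (by simp) x).hasFDerivAt
    have e2 := HasFDerivAt.comp (g := E) x (hE.contDiff.differentiable (by simp) _).hasFDerivAt e1
    have e3 : HasFDerivAt (fun p => φ' w (expChart p)) _ x :=
      e2.congr_of_eventuallyEq (Eventually.of_forall fun p => (hED _).symm)
    have e4 := hψ.immersion w x
    rw [e3.fderiv] at e4
    exact Injective.of_comp (f := fderiv ℝ E (Y x)) e4
  have hYr : range Y = (⋃ z, φ z '' {p | σ z p ≤ hgt p})ᶜ := by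
    have e1 : range expChart = {p | 0 < hgt p} := by
      ext p
      exact ⟨by rintro ⟨q, rfl⟩; exact hgt_expChart_pos q, fun hp => ⟨_, exists_expChart_eq hp⟩⟩
    have e2 : range Y = D '' (φ' w '' range expChart) := by
      rw [← range_comp, ← range_comp]; rfl
    rw [e2, e1, h, image_compl_eq hD.bijective, image_iUnion]
    exact congrArg _ (iUnion_congr hσi)
  have hYσ : ∀ x z p, Y x = φ z p → hgt p < σ z p := fun x z p hxp => by
    by_contra! hcon
    exact (hYr.subset ⟨x, hxp⟩) (mem_iUnion.2 ⟨z, p, hcon, rfl⟩)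
  have hCU : ∀ y, y ∉ ⋃ z, φ z '' {p | 0 < hgt p} → y ∉ ⋃ z, φ z '' {p | σ z p / 2 ≤ hgt p} :=
    fun y hy h => hy (iUnion_mono (fun z => image_mono (hC z)) h)
  have hrU : ∀ x, Y x ∈ ⋃ z, φ z '' {p | 0 < hgt p} ↔ r (Y x) ∈ ⋃ z, φ z '' {p | 0 < hgt p} := by
    intro x
    constructor
    · intro hx
      obtain ⟨z, p, hp, hpx⟩ := mem_iUnion.1 hx
      rw [← hpx, hr z p hp]
      exact mem_iUnion.2 ⟨z, _, hρp z p hp (hYσ x z p hpx.symm), rfl⟩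
    · intro hx
      by_contra hcon
      rw [hr' _ (hCU _ hcon)] at hx
      exact hcon hx
  let G : E3 → E3 := fun x => r (Y x)
  have hGb : Bijective G := by
    constructor
    · intro x x' hxx
      have hxx' : r (Y x) = r (Y x') := hxx
      apply hYi
      by_cases hx : Y x ∈ ⋃ z, φ z '' {p | 0 < hgt p}
      · have hx' := (hrU x).1 hx
        rw [hxx', ← hrU] at hx'
        obtain ⟨z, p, hp, hpx⟩ := mem_iUnion.1 hx
        obtain ⟨z', p', hp', hpx'⟩ := mem_iUnion.1 hx'
        have hpσ := hYσ x z p hpx.symm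
        have hpσ' := hYσ x' z' p' hpx'.symm
        rw [← hpx, ← hpx', hr z p hp, hr z' p' hp'] at hxx'
        obtain ⟨rfl, e1⟩ := hinj _ _ _ _ (hρp z p hp hpσ) (hρp z' p' hp' hpσ') hxx'
        rw [← hpx, ← hpx', hρi z ⟨hp, hpσ⟩ ⟨hp', hpσ'⟩ e1]
      · have hx' : Y x' ∉ ⋃ z, φ z '' {p | 0 < hgt p} := by
          rw [hrU, ← hxx', ← hrU]; exact hx
        rwa [hr' _ (hCU _ hx), hr' _ (hCU _ hx')] at hxx'
    · intro y
      by_cases hy : y ∈ ⋃ z, φ z '' {p | 0 < hgt p}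
      · obtain ⟨z, q, hq, rfl⟩ := mem_iUnion.1 hy
        obtain ⟨p, hp, hpσ, rfl⟩ := hρs z q hq
        have : φ z p ∈ range Y := by
          rw [hYr]
          intro hcon
          obtain ⟨z', p', hp', hpp⟩ := mem_iUnion.1 hcon
          have hp'' : σ z' p' ≤ hgt p' := hp'
          obtain ⟨rfl, rfl⟩ := hinj _ _ _ _ ((hσ0 z' p').1.trans_le hp'') hp hpp
          linarith
        obtain ⟨x, hx⟩ := this
        exact ⟨x, by rw [← hr z p hp, ← hx]⟩
      · have : y ∈ range Y := by
          rw [hYr]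
          intro hcon
          obtain ⟨z', p', hp', rfl⟩ := mem_iUnion.1 hcon
          exact hy (mem_iUnion.2 ⟨z', p', (hσ0 z' p').1.trans_le hp', rfl⟩)
        obtain ⟨x, rfl⟩ := this
        exact ⟨x, hr' _ (hCU _ hy)⟩
  have hloc : ∀ x, ContDiffAt ℝ ∞ G x ∧ Injective (fderiv ℝ G x) := by
    intro x
    by_cases hx : Y x ∈ ⋃ z, φ z '' {p | 0 < hgt p}
    · obtain ⟨z, p, hp, hpx⟩ := mem_iUnion.1 hx
      have hpσ := hYσ x z p hpx.symm
      obtain ⟨hop, g, hg, hgφ⟩ := isOpen_image_and_exists_smooth_inverse isOpen_hgt_pos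
        (hφ.contDiffOn_pos z) (fun a ha b hb h => (hinj z z a b ha hb h).2)
        (fun a ha => hφ.injective_fderiv z ha)
      have hV : φ z '' {p | 0 < hgt p} ∈ 𝓝 (Y x) :=
        (hop _ subset_rfl isOpen_hgt_pos).mem_nhds ⟨p, hp, hpx⟩
      have hV' := hYs.continuous.continuousAt.preimage_mem_nhds hV
      have hgY : ContDiffAt ℝ ∞ (fun x => g (Y x)) x :=
        (hg.contDiffAt hV).comp x hYs.contDiffAt
      have hgYx : g (Y x) = p := by rw [← hpx, hgφ p hp]
      have hφp : ContDiffAt ℝ ∞ (φ z) p := (hφ.contDiffOn_pos z).contDiffAt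
        (isOpen_hgt_pos.mem_nhds hp)
      have hρp' : ContDiffAt ℝ ∞ (ρ z) p := (hρ z).contDiffAt
        ((isOpen_lt hgt.continuous (hσs z).continuous).mem_nhds hpσ)
      have hφρ : ContDiffAt ℝ ∞ (φ z) (ρ z p) := (hφ.contDiffOn_pos z).contDiffAt
        (isOpen_hgt_pos.mem_nhds (hρp z p hp hpσ))
      have e0 : HasFDerivAt (fun x => g (Y x)) (fderiv ℝ (fun x => g (Y x)) x) x :=
        (hgY.differentiableAt (by simp)).hasFDerivAt
      set B := fderiv ℝ (fun x => g (Y x)) x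
      have hB : Injective B := by
        have e1 : HasFDerivAt (φ z) (fderiv ℝ (φ z) p) (g (Y x)) := by
          rw [hgYx]; exact (hφp.differentiableAt (by simp)).hasFDerivAt
        have e2 : HasFDerivAt Y ((fderiv ℝ (φ z) p).comp B) x := by
          refine (HasFDerivAt.comp (g := φ z) x e1 e0).congr_of_eventuallyEq ?_
          filter_upwards [hV'] with x' hx'
          obtain ⟨q, hq, hqx⟩ := hx'
          show Y x' = φ z (g (Y x'))
          rw [← hqx, hgφ q hq]
        have e3 := hYd x
        rw [e2.fderiv] at e3
        exact Injective.of_comp (f := fderiv ℝ (φ z) p) e3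
      have hGeq : G =ᶠ[𝓝 x] fun x => φ z (ρ z (g (Y x))) := by
        filter_upwards [hV'] with x' hx'
        obtain ⟨q, hq, hqx⟩ := hx'
        show r (Y x') = φ z (ρ z (g (Y x')))
        rw [← hqx, hgφ q hq, hr z q hq]
      have c1 : ContDiffAt ℝ ∞ (fun x => ρ z (g (Y x))) x :=
        ContDiffAt.comp (g := ρ z) x (by rw [hgYx]; exact hρp') hgY
      refine ⟨(ContDiffAt.comp (g := φ z) x (by rw [hgYx]; exact hφρ) c1).congr_of_eventuallyEq
        hGeq, ?_⟩
      have d1 : HasFDerivAt (fun x => ρ z (g (Y x))) ((fderiv ℝ (ρ z) p).comp B) x :=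
        HasFDerivAt.comp (g := ρ z) x
          (by rw [hgYx]; exact (hρp'.differentiableAt (by simp)).hasFDerivAt) e0
      have d2 : HasFDerivAt G
          ((fderiv ℝ (φ z) (ρ z p)).comp ((fderiv ℝ (ρ z) p).comp B)) x :=
        (HasFDerivAt.comp (g := φ z) x (by
          rw [hgYx]; exact (hφρ.differentiableAt (by simp)).hasFDerivAt) d1).congr_of_eventuallyEq
          hGeq
      rw [d2.fderiv]
      exact (hφ.injective_fderiv z (hρp z p hp hpσ)).comp ((hρd z p hp hpσ).comp hB)
    · have hGeq : G =ᶠ[𝓝 x] Y := by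
        filter_upwards [hYs.continuous.continuousAt.preimage_mem_nhds
          (hCcl.isOpen_compl.mem_nhds (hCU _ hx))] with x' hx'
        exact hr' _ hx'
      exact ⟨hYs.contDiffAt.congr_of_eventuallyEq hGeq, by rw [hGeq.fderiv_eq]; exact hYd x⟩
  have hGs : ContDiff ℝ ∞ G := contDiff_iff_contDiffAt.2 fun x => (hloc x).1
  obtain ⟨I, hI, hIG, hGI⟩ := exists_smooth_inverse_of_bijective hGs hGb fun x => (hloc x).2
  let e : E3 ≃ₘ[ℝ] E3 :=
    { toFun := I
      invFun := G
      left_inv := hGI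
      right_inv := hIG
      contMDiff_toFun := hI.contMDiff
      contMDiff_invFun := hGs.contMDiff }
  refine ⟨e, ?_⟩
  rintro _ ⟨_, ⟨p, hp, rfl⟩, rfl⟩
  have hpA : φ' w p ∈ A := Or.inl ⟨p, hp, rfl⟩
  rw [← image_expChart_axisRay] at hp
  obtain ⟨x, hx, rfl⟩ := hp
  -- Neither `D` nor `r` moves points of the ray, so the inverse of `G` returns it to the half-axis.
  have e1 : G x = φ' w (expChart x) := by
    show r (D (φ' w (expChart x))) = _
    rw [hD.apply_eq hpA]
    refine hr' _ (hCU _ fun hcon => hφ'N _ (hgt_expChart_pos x) ?_)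
    exact iUnion_mono (fun z => image_mono hgt_pos_subset) hcon
  show I (φ' w (expChart x)) ∈ axisRay
  rw [← e1, hIG]
  exact hx

end IsProperSmoothEmbedding

/-! ### The two sides of the boundary -/

namespace IsProperSmoothEmbedding

variable {Z : Type} [TopologicalSpace Z] [DiscreteTopology Z] {φ φ' : Z → E3 → E3}

theorem iUnion_image_pos_eq_sdiff (hφ : IsProperSmoothEmbedding upperHalfSpace3 φ) :
    ⋃ z, φ z '' {p | 0 < hgt p} =
      (⋃ z, φ z '' upperHalfSpace3) \ ⋃ z, φ z '' {p | hgt p = 0} := by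
  rw [← hφ.interior_iUnion_image, ← hφ.frontier_iUnion_image, self_sdiff_frontier]

/-- Half-spaces with the same boundary are on the same side of it, or on opposite sides. -/
theorem image_pos_subset_or_eq_compl [Countable Z]
    (hφ : IsProperSmoothEmbedding upperHalfSpace3 φ)
    (hφ' : IsProperSmoothEmbedding upperHalfSpace3 φ')
    (h : ⋃ z, φ z '' {p | hgt p = 0} = ⋃ z, φ' z '' {p | hgt p = 0}) (z : Z) :
    φ z '' {p | 0 < hgt p} ⊆ ⋃ z, φ' z '' {p | 0 < hgt p} ∨
      φ z '' {p | 0 < hgt p} = (⋃ z, φ' z '' upperHalfSpace3)ᶜ := by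
  have h0 : (φ z '' {p | 0 < hgt p}).Nonempty := ⟨_, vert, by simp, rfl⟩
  have h1 : IsPreconnected (φ z '' {p | 0 < hgt p}) :=
    (convex_halfSpace_gt hgt.isLinear 0).isPreconnected.image _ (hφ.contDiffOn_pos z).continuousOn
  have h2 : ∀ y ∈ φ z '' {p | 0 < hgt p}, y ∉ ⋃ z, φ' z '' {p | hgt p = 0} := by
    rintro _ ⟨p, hp, rfl⟩ hy
    rw [← h] at hy
    obtain ⟨w, q, hq, hqp⟩ := mem_iUnion.1 hy
    obtain ⟨-, rfl⟩ := hφ.eq_of_apply_eq (boundary_subset hq) (hgt_pos_subset hp) hqp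
    exact (show 0 < hgt q from hp).ne' hq
  have h3 : φ z '' {p | 0 < hgt p} ⊆
      (⋃ z, φ' z '' {p | 0 < hgt p}) ∪ (⋃ z, φ' z '' upperHalfSpace3)ᶜ := fun y hy => by
    by_cases hyN : y ∈ ⋃ z, φ' z '' upperHalfSpace3
    · left
      rw [hφ'.iUnion_image_pos_eq_sdiff]
      exact ⟨hyN, h2 y hy⟩
    · exact Or.inr hyN
  rcases isPreconnected_iff_subset_of_disjoint.1 h1 _ _
    (isOpen_iUnion fun z => hφ'.isOpen_image z isOpen_hgt_pos subset_rfl)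
    hφ'.isClosed_range.isOpen_compl h3 (eq_empty_iff_forall_notMem.2 fun y hy =>
      hy.2.2 (iUnion_mono (fun z => image_mono hgt_pos_subset) hy.2.1)) with h4 | h4
  · exact Or.inl h4
  · refine Or.inr (h4.antisymm ?_)
    -- The connected complement meets the open half-space and misses its boundary plane, so it lies
    -- within it.
    refine hφ'.isPreconnected_compl.subset_of_disjoint_of_isClosed (G := φ z '' {p | hgt p = 0})
      (hφ.isOpen_image z isOpen_hgt_pos subset_rfl) ?_ ?_ ?_
    · have e1 : IsClosed (φ z '' upperHalfSpace3) := by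
        simpa using (hφ.isComponentFamily isClosed_upperHalfSpace3 subset_rfl
          ⟨_, flat_mem 0⟩ convex_upperHalfSpace3.isPreconnected).closed {z}
      refine (congrArg IsClosed ?_).mp e1
      rw [← image_union]
      congr 1
      ext p
      exact (le_iff_lt_or_eq (a := (0 : ℝ)) (b := hgt p)).trans
        (or_congr Iff.rfl eq_comm)
    · intro y hy hyb
      have : y ∈ ⋃ z, φ' z '' {p | hgt p = 0} := h ▸ mem_iUnion.2 ⟨z, hyb⟩
      exact hy (iUnion_mono (fun z => image_mono boundary_subset) this)
    · obtain ⟨y, hy⟩ := h0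
      exact ⟨y, h4 hy, hy⟩

/-- If one half-space fills the complement of the others, there is only one. -/
theorem eq_of_image_pos_eq_compl (hφ : IsProperSmoothEmbedding upperHalfSpace3 φ)
    (hφ' : IsProperSmoothEmbedding upperHalfSpace3 φ')
    (h : ⋃ z, φ z '' {p | hgt p = 0} = ⋃ z, φ' z '' {p | hgt p = 0}) {z : Z}
    (hz : φ z '' {p | 0 < hgt p} = (⋃ z, φ' z '' upperHalfSpace3)ᶜ) (w : Z) : w = z := by
  have e1 : IsClosed (φ z '' upperHalfSpace3) := by
    simpa using (hφ.isComponentFamily isClosed_upperHalfSpace3 subset_rfl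
      ⟨_, flat_mem 0⟩ convex_upperHalfSpace3.isPreconnected).closed {z}
  have h0 : φ w 0 ∈ ⋃ z, φ z '' {p | hgt p = 0} := mem_iUnion.2 ⟨w, 0, by simp, rfl⟩
  -- Every boundary plane of `φ` bounds the complement of the `φ'` half-spaces, hence lies in the
  -- closure of the half-space `z`; disjointness leaves only the index `z`.
  rw [h, ← hφ'.frontier_iUnion_image, ← frontier_compl, ← hz] at h0
  have h1 : φ w 0 ∈ φ z '' upperHalfSpace3 :=
    closure_minimal (image_mono hgt_pos_subset) e1 (frontier_subset_closure h0)
  obtain ⟨p, hp, hpw⟩ := h1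
  exact (hφ.eq_of_apply_eq hp (boundary_subset (by simp)) hpw).1.symm

/-- Families of half-spaces with the same boundary agree, or are complementary half-spaces. -/
theorem eq_or_compl_of_boundary_eq [Countable Z] (hφ : IsProperSmoothEmbedding upperHalfSpace3 φ)
    (hφ' : IsProperSmoothEmbedding upperHalfSpace3 φ')
    (h : ⋃ z, φ z '' {p | hgt p = 0} = ⋃ z, φ' z '' {p | hgt p = 0}) :
    ⋃ z, φ z '' upperHalfSpace3 = ⋃ z, φ' z '' upperHalfSpace3 ∨
      ∃ z, (∀ w, w = z) ∧ φ z '' {p | 0 < hgt p} = (⋃ z, φ' z '' upperHalfSpace3)ᶜ ∧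
        φ' z '' {p | 0 < hgt p} = (⋃ z, φ z '' upperHalfSpace3)ᶜ := by
  have hH : upperHalfSpace3 = {p | 0 < hgt p} ∪ {p | hgt p = 0} := by
    ext p
    exact (le_iff_lt_or_eq (a := (0 : ℝ)) (b := hgt p)).trans (or_congr Iff.rfl eq_comm)
  have hsplit : ∀ φ : Z → E3 → E3, ⋃ z, φ z '' upperHalfSpace3 =
      (⋃ z, φ z '' {p | 0 < hgt p}) ∪ ⋃ z, φ z '' {p | hgt p = 0} := fun φ => by
    rw [← iUnion_union_distrib]
    exact iUnion_congr fun z => by rw [hH, image_union]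
  have hone : ∀ (z : Z) (S : Set E3) (φ : Z → E3 → E3), (∀ w, w = z) →
      ⋃ z, φ z '' S = φ z '' S := fun z S φ hz =>
    Subset.antisymm (iUnion_subset fun w => by rw [hz w]) (subset_iUnion (fun z => φ z '' S) z)
  have hopp : ∀ {φ φ' : Z → E3 → E3}, IsProperSmoothEmbedding upperHalfSpace3 φ →
      IsProperSmoothEmbedding upperHalfSpace3 φ' →
      ⋃ z, φ z '' {p | hgt p = 0} = ⋃ z, φ' z '' {p | hgt p = 0} → ∀ z,
      φ z '' {p | 0 < hgt p} = (⋃ z, φ' z '' upperHalfSpace3)ᶜ →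
      (∀ w, w = z) ∧ φ' z '' {p | 0 < hgt p} = (⋃ z, φ z '' upperHalfSpace3)ᶜ := by
    intro φ φ' hφ hφ' h z hz
    have hw := hφ.eq_of_image_pos_eq_compl hφ' h hz
    refine ⟨hw, ?_⟩
    rw [hsplit φ, hone z _ φ hw, hz, h, compl_union, compl_compl, ← hone z _ φ' hw,
      hφ'.iUnion_image_pos_eq_sdiff]
    rfl
  by_cases h1 : ∃ z, φ z '' {p | 0 < hgt p} = (⋃ z, φ' z '' upperHalfSpace3)ᶜ
  · obtain ⟨z, hz⟩ := h1
    obtain ⟨hw, hz'⟩ := hopp hφ hφ' h z hz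
    exact Or.inr ⟨z, hw, hz, hz'⟩
  by_cases h2 : ∃ z, φ' z '' {p | 0 < hgt p} = (⋃ z, φ z '' upperHalfSpace3)ᶜ
  · obtain ⟨z, hz⟩ := h2
    obtain ⟨hw, hz'⟩ := hopp hφ' hφ h.symm z hz
    exact Or.inr ⟨z, hw, hz', hz⟩
  push Not at h1 h2
  left
  rw [hsplit φ, hsplit φ', h]
  congr 1
  exact Subset.antisymm
    (iUnion_subset fun z => (hφ.image_pos_subset_or_eq_compl hφ' h z).resolve_right (h1 z))
    (iUnion_subset fun z => (hφ'.image_pos_subset_or_eq_compl hφ h.symm z).resolve_right (h2 z))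

end IsProperSmoothEmbedding

/-- A diffeomorphism which matches the boundaries of regular neighborhoods matches the neighborhoods,
if there are several components or a knotted one. -/
theorem image_eq_of_image_frontier_eq {n : ℕ∞} {τ τ' N N' : Set E3} (hN : IsRegularNhd n τ N)
    (hN' : IsRegularNhd n τ' N') (g : E3 ≃ₘ[ℝ] E3) (hg : g '' frontier N = frontier N')
    (h : 2 ≤ n ∨ IsKnotted τ ∨ IsKnotted τ') : g '' N = N' := by
  obtain ⟨φ, hφ, rfl, rfl⟩ := hN
  obtain ⟨φ', hφ', rfl, rfl⟩ := hN'
  have hgφ := hφ.comp_diffeomorph g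
  have himg : ∀ S : Set E3, g '' (⋃ z, φ z '' S) = ⋃ z, (fun x => g (φ z x)) '' S := fun S => by
    rw [image_iUnion]
    exact iUnion_congr fun z => by rw [image_image]
  rw [hφ.frontier_iUnion_image, hφ'.frontier_iUnion_image, himg] at hg
  rw [himg]
  rcases hgφ.eq_or_compl_of_boundary_eq hφ' hg with h1 | ⟨z, hz, h1, h2⟩
  · exact h1
  exfalso
  have hone : ∀ (S : Set E3) (φ : Idx n → E3 → E3), ⋃ z, φ z '' S = φ z '' S := fun S φ =>
    Subset.antisymm (iUnion_subset fun w => by rw [hz w]) (subset_iUnion (fun z => φ z '' S) z)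
  rcases h with hn | hk | hk
  · have e1 := (hz ⟨0, lt_of_lt_of_le (by simp) hn⟩).trans
      (hz ⟨1, lt_of_lt_of_le (by norm_num) hn⟩).symm
    simp at e1
  · obtain ⟨e, he⟩ := hφ'.exists_diffeomorph_straighten hgφ h1
    refine hk ⟨g.trans e, isRadial_of_subset_axisRay ?_⟩
    rw [hone]
    refine subset_trans (subset_of_eq ?_) he
    rw [image_image, image_image]
    rfl
  · obtain ⟨e, he⟩ := hgφ.exists_diffeomorph_straighten hφ' h2
    exact hk ⟨e, isRadial_of_subset_axisRay (by rw [hone]; exact he)⟩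

/-! ### The proposition -/

theorem mainTheorem9 (n : ℕ∞) (hn : 1 ≤ n) (τ τ' N N' : Set E3)
    (hτ : IsMultiray n τ) (hτ' : IsMultiray n τ')
    (hN : IsRegularNhd n τ N) (hN' : IsRegularNhd n τ' N') :
    (∀ f : E3 ≃ₘ[ℝ] E3, f '' τ = τ' →
      ∃ g : E3 ≃ₘ[ℝ] E3, g '' frontier N = frontier N' ∧ IsotopicRel τ f g) ∧
    (∀ g : E3 ≃ₘ[ℝ] E3, g '' frontier N = frontier N' →
      (g '' N = N' ∨ 2 ≤ n ∨ (n = 1 ∧ (IsKnotted τ ∨ IsKnotted τ'))) →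
      ∃ f : E3 ≃ₘ[ℝ] E3, f '' τ = τ' ∧ IsotopicRel (interior N)ᶜ g f) := by
  refine ⟨fun f hf => ?_, fun g hg h => ?_⟩
  · obtain ⟨g, hgN, hgf⟩ := exists_isotopicRel_image_eq hN hN' f hf
    exact ⟨g, by rw [Diffeomorph.image_frontier', hgN], hgf⟩
  · refine exists_isotopicRel_image_ray_eq hN hN' g ?_
    rcases h with h | h | ⟨-, h⟩
    · exact h
    · exact image_eq_of_image_frontier_eq hN hN' g hg (Or.inl h)
    · exact image_eq_of_image_frontier_eq hN hN' g hg (Or.inr h)
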